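/- **Setting.** Let $k$ be a field, $\hat G$ a finite group, $\pi:\hat G\to\{\pm1\}$ a surjective homomorphism, $G=\ker\pi$, $H\le G$ a subgroup. Let $\hat\alpha:\hat G^3\to k^\times$ be a normalized $3$-cocycle with coefficients twisted by $\pi$: it equals $1$ if an argument is $e$, and $$\hat\alpha(\omega_4\omega_3,\omega_2,\omega_1)\,\hat\alpha(\omega_4,\omega_3,\omega_2\omega_1)=\hat\alpha(\omega_3,\omega_2,\omega_1)^{\pi(\omega_4)}\,\hat\alpha(\omega_4,\omega_3\omega_2,\omega_1)\,\hat\alpha(\omega_4,\omega_3,\omega_2).$$ Choose representatives $r_q\in G$ of the cosets $q\in G/H$, and $\varsigma\in\hat G\setminus G$. **2-representations.** An $\hat\alpha$-twisted Real 2-representation of $\hat G$ on a $k$-linear category $\mathcal V$ consists of $k$-linear functors $\rho(\omega):{}^{\pi(\omega)}\mathcal V\to\mathcal V$ (where ${}^{+}\mathcal V=\mathcal V$, ${}^{-}\mathcal V=\mathcal V^{op}$), natural isomorphisms $\psi_{\omega_2,\omega_1}:\rho(\omega_2)\circ{}^{\pi(\omega_2)}\rho(\omega_1)\Rightarrow\rho(\omega_2\omega_1)$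 and $\psi_e:\rho(e)\Rightarrow 1_{\mathcal V}$ with $$\hat\alpha(\omega_3,\omega_2,\omega_1)\,\psi_{\omega_3\omega_2,\omega_1}\bigl(\psi_{\omega_3,\omega_2}\circ\rho(\omega_1)\bigr)=\psi_{\omega_3,\omega_2\omega_1}\bigl(\rho(\omega_3)\circ\psi_{\omega_2,\omega_1}^{\pi(\omega_3)}\bigr),$$ $\psi_{e,\omega}=\psi_e\circ\rho(\omega)$ and $\psi_{\omega,e}=\rho(\omega)(\psi_e^{\pi(\omega)})$. A linear $\alpha|_H$-twisted 2-representation of $H$ (with $\alpha=\hat\alpha|_G$) is the same notion for the trivially graded group $H$ and the restriction of $\hat\alpha$. Let $\rho$ be one, on a $k$-linear category $V$. **Induction.** $\mathrm{Ind}_H^G\rho$ acts on $\prod_{q\in G/H}V$. The matrix of $g$ has the entry $\rho(h)$ at $(j,i)$ if $gr_i=r_jh$ with $h\in H$, and $0$ otherwise. If $g_1r_i=r_jh_1$, $g_2r_j=r_lh_2$, the component of $\psi_{g_2,g_1}$ at row $l$ is $$\frac{\alpha(g_2,r_j,h_1)}{\alpha(g_2,g_1,r_i)\,\alpha(r_l,h_2,h_1)}\,\psi_{h_2,h_1};$$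 $\psi_e$ is $\psi_e$ of $\rho$ in each row. **Hyperbolic induction.** For an $\alpha$-twisted 2-representation $\sigma$ of $G$ on $W$, $\mathrm{HInd}_G^{\hat G}\sigma$ acts on $W\times W^{op}$: $g\in G$ acts by $(x,y)\mapsto(\sigma(g)x,\sigma(\varsigma^{-1}g\varsigma)y)$ and $\omega\in\hat G\setminus G$ by $(x,y)\mapsto(\sigma(\omega\varsigma)y,\sigma(\varsigma^{-1}\omega)x)$. Its $\psi$ has the following two components, for $g_i\in G$, $\omega_i\in\hat G\setminus G$ (where $\psi^{-op}$ is the opposite of the inverse): - $\psi_{g_2,g_1}$: $\ \psi_{g_2,g_1}$; $\ \dfrac{\hat\alpha(g_2,\varsigma,\varsigma^{-1}g_1\varsigma)}{\hat\alpha(g_2,g_1,\varsigma)\hat\alpha(\varsigma,\varsigma^{-1}g_2\varsigma,\varsigma^{-1}g_1\varsigma)}\psi^{-op}_{\varsigma^{-1}g_2\varsigma,\varsigma^{-1}g_1\varsigma}$. - $\psi_{\omega_2,g_1}$: $\ \dfrac{\hat\alpha(\omega_2,\varsigma,\varsigma^{-1}g_1\varsigma)}{\hat\alpha(\omega_2,g_1,\varsigma)}\psi_{\omega_2\varsigma,\varsigma^{-1}g_1\varsigma}$;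 $\ \hat\alpha(\varsigma,\varsigma^{-1}\omega_2,g_1)^{-1}\psi^{-op}_{\varsigma^{-1}\omega_2,g_1}$. - $\psi_{g_2,\omega_1}$: $\ \hat\alpha(g_2,\omega_1,\varsigma)^{-1}\psi_{g_2,\omega_1\varsigma}$; $\ \dfrac{\hat\alpha(g_2,\varsigma,\varsigma^{-1}\omega_1)}{\hat\alpha(\varsigma,\varsigma^{-1}g_2\varsigma,\varsigma^{-1}\omega_1)}\psi^{-op}_{\varsigma^{-1}g_2\varsigma,\varsigma^{-1}\omega_1}$. - $\psi_{\omega_2,\omega_1}$: $\ \hat\alpha(\omega_2,\varsigma,\varsigma^{-1}\omega_1)\psi_{\omega_2\varsigma,\varsigma^{-1}\omega_1}$; $\ \dfrac{1}{\hat\alpha(\omega_2,\omega_1,\varsigma)\hat\alpha(\varsigma,\varsigma^{-1}\omega_2,\omega_1\varsigma)}\psi^{-op}_{\varsigma^{-1}\omega_2,\omega_1\varsigma}$. Its $\psi_e$ is $(\psi_e,\psi_e^{-op})$. Put $\mathrm{HInd}_H^{\hat G}=\mathrm{HInd}_G^{\hat G}\circ\mathrm{Ind}_H^G$. **Categorical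 characters.** $\Lambda BH$ is the groupoid with objects $h\in H$ and morphisms $s:h\to shs^{-1}$, $s\in H$; $\Lambda_\pi^{ref}B\hat G$ has objects $g\in G$ and morphisms $\omega:g\to\omega g^{\pi(\omega)}\omega^{-1}$, $\omega\in\hat G$. The categorical trace of $g$ is the $k$-vector space $\mathrm{Tr}_\rho(g)=\mathrm{Nat}(1_{\mathcal V},\rho(g))$. The (Real) categorical character of a (Real) 2-representation is the family of these spaces with the following maps $\beta_{g,\omega}:\mathrm{Tr}_\rho(g)\to\mathrm{Tr}_\rho(\omega g^{\pi(\omega)}\omega^{-1})$ for the morphisms $\omega$. If $\pi(\omega)=1$ and $g'=\omega g\omega^{-1}$, $\beta_{g,\omega}(\phi)$ is $$1\cong\rho(\omega)\rho(\omega^{-1})\xrightarrow{\ \phi\ }\rho(\omega)\rho(g)\rho(\omega^{-1})\cong\rho(\omega g)\rho(\omega^{-1})\cong\rho(g')\rho(\omega)\rho(\omega^{-1})\cong\rho(g'),$$ and if $\pi(\omega)=-1$ and $g'=\omega g^{-1}\omega^{-1}$, it is $$1\cong\rho(\omega)\rho(\omega^{-1})\to\rho(\omega)\rho(g^{-1})\rho(\omega^{-1})\cong\rho(\omega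 g^{-1})\rho(\omega^{-1})\cong\rho(g')\rho(\omega)\rho(\omega^{-1})\cong\rho(g'),$$ where the second map is the contravariant functor $\rho(\omega)$ applied to $\rho(g^{-1})\xrightarrow{\phi}\rho(g^{-1})\rho(g)\cong1$ (at the values of $\rho(\omega^{-1})$). All isomorphisms are given by $\psi$ and $\psi_e$. **Twisted representations.** A representation of a groupoid twisted by a $2$-cocycle $\theta$ is a family of vector spaces $E(x)$ with linear maps satisfying $E(\mathrm{id})=\mathrm{id}$ and $E(\omega_2)E(\omega_1)=\theta([\omega_2|\omega_1]x)\,E(\omega_2\omega_1)$. Isomorphisms are families of linear isomorphisms that commute with these maps. The $2$-cocycle $\tau_\pi^{ref}(\hat\alpha)$ on $\Lambda_\pi^{ref}B\hat G$ has on $[\omega_2|\omega_1]\gamma$ the value $$\hat\alpha(\gamma,\gamma^{-1},\gamma)^{\epsilon}\left(\frac{\hat\alpha(\omega_1\gamma^{-\pi(\omega_1)}\omega_1^{-1},\omega_1\gamma^{\pi(\omega_1)}\omega_1^{-1},\omega_1)\,\hat\alpha(\omega_1,\gamma^{-\pi(\omega_1)},\gamma^{\pi(\omega_1)})}{\hat\alpha(\omega_1\gamma^{-\pi(\omega_1)}\omega_1^{-1},\omega_1,\gamma^{\pi(\omega_1)})}\right)^{\frac{\pi(\omega_2)-1}2}\frac{\hat\alpha(\omega_2,\omega_1,\delta)\,\hat\alpha(\omega_2\omega_1\delta(\omega_2\omega_1)^{-1},\omega_2,\omega_1)}{\hat\alpha(\omega_2,\omega_1\delta\omega_1^{-1},\omega_1)},$$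 where $\delta=\gamma^{\pi(\omega_2\omega_1)}$, $\epsilon=1$ if $\pi(\omega_1)=\pi(\omega_2)=-1$, and $\epsilon=0$ otherwise; $\tau(\alpha|_H)$ is its restriction to $\Lambda BH$. For a $\tau(\alpha|_H)$-twisted representation $E$ of $\Lambda BH$, the induced representation $\mathrm{Ind}(E)$ of $\Lambda_\pi^{ref}B\hat G$ has at $g$ the space generated by the symbols $s\otimes v$, linear in $v\in E(h)$, for the morphisms $s:h\to g$ of $\Lambda_\pi^{ref}B\hat G$ with $h\in H$, modulo $s\otimes E(t)v=\tau_\pi^{ref}(\hat\alpha)([s|t])\,st\otimes v$ for morphisms $t$ of $\Lambda BH$; the action is $\omega\cdot(s\otimes v)=\tau_\pi^{ref}(\hat\alpha)([\omega|s])\,\omega s\otimes v$. **Theorem.** $\mathrm{HInd}_H^{\hat G}(\rho)$ is an $\hat\alpha$-twisted Real 2-representation of $\hat G$. The categorical character $\mathrm{Tr}_\rho$ is a $\tau(\alpha|_H)$-twisted representation of $\Lambda BH$. The Real categorical character $\mathrm{Tr}_{\mathrm{HInd}_H^{\hat G}(\rho)}$ and $\mathrm{Ind}_{\Lambda BH}^{\Lambda_\pi^{ref}B\hat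 G}(\mathrm{Tr}_\rho)$ are $\tau_\pi^{ref}(\hat\alpha)$-twisted representations of $\Lambda_\pi^{ref}B\hat G$, and they are canonically isomorphic: there is exactly one isomorphism of $\tau_\pi^{ref}(\hat\alpha)$-twisted representations $$\mathrm{Tr}_{\mathrm{HInd}_H^{\hat G}(\rho)}\;\xrightarrow{\ \sim\ }\;\mathrm{Ind}_{\Lambda BH}^{\Lambda_\pi^{ref}B\hat G}(\mathrm{Tr}_\rho)$$ such that for all $q\in G/H$, $h\in H$ and $\phi\in\mathrm{Tr}_\rho(h)$ the element of $\mathrm{Tr}_{\mathrm{HInd}_H^{\hat G}(\rho)}(r_qhr_q^{-1})$ which is $\phi$ at the row $q$ of the first factor $\prod_{G/H}V$ and zero at all other rows of $\prod_{G/H}V\times(\prod_{G/H}V)^{op}$ is mapped to the class of $r_q\otimes\phi$. -/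

import Mathlib

open CategoryTheory Opposite

universe v u w w' v₁ u₁ v₂ u₂ uk uG

namespace RealInd

/-! ### Linear structures on products and opposites of linear categories -/

section LinearStructures

variable {k : Type uk} [Field k]

instance preadditivePi {J : Type w} (C : J → Type u) [∀ j, Category.{v} (C j)]
    [∀ j, Preadditive (C j)] : Preadditive (∀ j, C j) where
  homGroup x y := inferInstanceAs (AddCommGroup (∀ j, x j ⟶ y j))
  add_comp _ _ _ _ _ _ := funext fun _ => Preadditive.add_comp _ _ _ _ _ _
  comp_add _ _ _ _ _ _ := funext fun _ => Preadditive.comp_add _ _ _ _ _ _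

instance linearPi {J : Type w} (C : J → Type u) [∀ j, Category.{v} (C j)]
    [∀ j, Preadditive (C j)] [∀ j, Linear k (C j)] : Linear k (∀ j, C j) where
  homModule x y := inferInstanceAs (Module k (∀ j, x j ⟶ y j))
  smul_comp _ _ _ _ _ _ := funext fun _ => Linear.smul_comp _ _ _ _ _ _
  comp_smul _ _ _ _ _ _ := funext fun _ => Linear.comp_smul _ _ _ _ _ _

instance preadditiveProd (C : Type u₁) [Category.{v₁} C] [Preadditive C]
    (D : Type u₂) [Category.{v₂} D] [Preadditive D] : Preadditive (C × D) where
  homGroup x y := inferInstanceAs (AddCommGroup ((x.1 ⟶ y.1) × (x.2 ⟶ y.2)))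
  add_comp _ _ _ _ _ _ :=
    Prod.ext (Preadditive.add_comp _ _ _ _ _ _) (Preadditive.add_comp _ _ _ _ _ _)
  comp_add _ _ _ _ _ _ :=
    Prod.ext (Preadditive.comp_add _ _ _ _ _ _) (Preadditive.comp_add _ _ _ _ _ _)

instance linearProd (C : Type u₁) [Category.{v₁} C] [Preadditive C] [Linear k C]
    (D : Type u₂) [Category.{v₂} D] [Preadditive D] [Linear k D] : Linear k (C × D) where
  homModule x y := inferInstanceAs (Module k ((x.1 ⟶ y.1) × (x.2 ⟶ y.2)))
  smul_comp _ _ _ _ _ _ :=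
    Prod.ext (Linear.smul_comp _ _ _ _ _ _) (Linear.smul_comp _ _ _ _ _ _)
  comp_smul _ _ _ _ _ _ :=
    Prod.ext (Linear.comp_smul _ _ _ _ _ _) (Linear.comp_smul _ _ _ _ _ _)

/-- The opposite of a `k`-linear category, with the same action of `k` on morphisms. -/
instance linearOp (C : Type u) [Category.{v} C] [Preadditive C] [Linear k C] :
    Linear k Cᵒᵖ where
  homModule x y :=
    { smul := fun r f => (r • f.unop).op
      one_smul := fun f => Quiver.Hom.unop_inj (one_smul k f.unop)
      mul_smul := fun r s f => Quiver.Hom.unop_inj (mul_smul r s f.unop)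
      smul_zero := fun r => Quiver.Hom.unop_inj (smul_zero (A := y.unop ⟶ x.unop) r)
      smul_add := fun r f g => Quiver.Hom.unop_inj (smul_add r f.unop g.unop)
      add_smul := fun r s f => Quiver.Hom.unop_inj (add_smul r s f.unop)
      zero_smul := fun f => Quiver.Hom.unop_inj (zero_smul k f.unop) }
  smul_comp _ _ _ r f g := Quiver.Hom.unop_inj (Linear.comp_smul _ _ _ g.unop r f.unop)
  comp_smul _ _ _ f r g := Quiver.Hom.unop_inj (Linear.smul_comp _ _ _ r g.unop f.unop)

@[simp]
theorem op_smul_hom {C : Type u} [Category.{v} C] [Preadditive C] [Linear k C] {x y : C}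
    (c : k) (f : x ⟶ y) : (c • f).op = c • f.op := rfl

@[simp]
theorem unop_smul_hom {C : Type u} [Category.{v} C] [Preadditive C] [Linear k C] {x y : Cᵒᵖ}
    (c : k) (f : x ⟶ y) : (c • f).unop = c • f.unop := rfl

/-- The isomorphism `c • e`, for a nonzero scalar `c`. -/
@[simps]
def smulIso {C : Type u} [Category.{v} C] [Preadditive C] [Linear k C] {x y : C}
    (c : kˣ) (e : x ≅ y) : x ≅ y where
  hom := (c : k) • e.hom
  inv := ((c⁻¹ : kˣ) : k) • e.inv
  hom_inv_id := by simp [smul_smul]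
  inv_hom_id := by simp [smul_smul]

end LinearStructures

/-! ### Twisted cocycles and their transgression -/

section Cocycle

variable {Γ : Type uG} [Group Γ] {k : Type uk} [Field k]

/-- Normalized `3`-cocycles on `BΓ` with coefficients in `kˣ`, on which `ω` acts by
`z ↦ z ^ (π ω)`. -/
structure IsTwistedCocycle (π : Γ →* ℤˣ) (α : Γ → Γ → Γ → kˣ) : Prop where
  one_left : ∀ b a, α 1 b a = 1
  one_mid : ∀ c a, α c 1 a = 1
  one_right : ∀ c b, α c b 1 = 1
  cocycle : ∀ d c b a,
    α (d * c) b a * α d c (b * a) = α c b a ^ ((π d : ℤˣ) : ℤ) * α d (c * b) a * α d c b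

/-- The value on `[ω₂|ω₁]γ` of the reflection-twisted loop transgression of `α`. If `ω₂` and `ω₁`
have degree `1`, only the last factor, the usual loop transgression, is left. -/
def tauRef (π : Γ →* ℤˣ) (α : Γ → Γ → Γ → kˣ) (ω₂ ω₁ γ : Γ) : kˣ :=
  (if π ω₁ = -1 ∧ π ω₂ = -1 then α γ γ⁻¹ γ else 1) *
  (if π ω₂ = -1 then
    (α (ω₁ * γ ^ (-((π ω₁ : ℤˣ) : ℤ)) * ω₁⁻¹) (ω₁ * γ ^ ((π ω₁ : ℤˣ) : ℤ) * ω₁⁻¹) ω₁ *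
      α ω₁ (γ ^ (-((π ω₁ : ℤˣ) : ℤ))) (γ ^ ((π ω₁ : ℤˣ) : ℤ)) /
      α (ω₁ * γ ^ (-((π ω₁ : ℤˣ) : ℤ)) * ω₁⁻¹) ω₁ (γ ^ ((π ω₁ : ℤˣ) : ℤ)))⁻¹
    else 1) *
  (α ω₂ ω₁ (γ ^ ((π (ω₂ * ω₁) : ℤˣ) : ℤ)) *
    α (ω₂ * ω₁ * γ ^ ((π (ω₂ * ω₁) : ℤˣ) : ℤ) * (ω₂ * ω₁)⁻¹) ω₂ ω₁ /
    α ω₂ (ω₁ * γ ^ ((π (ω₂ * ω₁) : ℤˣ) : ℤ) * ω₁⁻¹) ω₁)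

/-- `tauRef π α` is a `2`-cocycle on the unoriented loop groupoid. -/
theorem tauRef_cocycle {π : Γ →* ℤˣ} {α : Γ → Γ → Γ → kˣ} (hα : IsTwistedCocycle π α)
    (c b a x : Γ) (hx : π x = 1) :
    tauRef π α b a x * tauRef π α c (b * a) x =
      tauRef π α (c * b) a x * tauRef π α c b (a * x ^ ((π a : ℤˣ) : ℤ) * a⁻¹) := by
  obtain ⟨A, hA⟩ : ∃ A : Γ → Γ → Γ → Additive kˣ, ∀ d b a, A d b a = Additive.ofMul (α d b a) :=
    ⟨_, fun _ _ _ => rfl⟩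
  have C (d c b a : Γ) : A (d * c) b a + A d c (b * a) -
      (((π d : ℤˣ) : ℤ) • A c b a + A d (c * b) a + A d c b) = 0 := by
    have := congrArg Additive.ofMul (hα.cocycle d c b a)
    simp only [ofMul_mul, ofMul_zpow, ← hA] at this
    rw [this, sub_self]
  have h1 (b a) : A 1 b a = 0 := by rw [hA, hα.one_left]; rfl
  have h2 (b a) : A b 1 a = 0 := by rw [hA, hα.one_mid]; rfl
  have h3 (b a) : A b a 1 = 0 := by rw [hA, hα.one_right]; rfl
  apply Additive.ofMul.injective
  rcases Int.units_eq_one_or (π a) with ha | ha <;> rcases Int.units_eq_one_or (π b) with hb | hb <;>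
    rcases Int.units_eq_one_or (π c) with hc | hc <;>
    simp [tauRef, ha, hb, hc, ofMul_mul, ofMul_div, ← hA, mul_assoc] <;> rw [← sub_eq_zero]
  · have e0 := C (c * b * a * x * a⁻¹ * b⁻¹ * c⁻¹) c b a
    have e1 := C c (b * a * x * a⁻¹ * b⁻¹) b a
    have e2 := C c b (a * x * a⁻¹) a
    have e3 := C c b a x
    simp [ha, hb, hc, hx, mul_assoc] at e0 e1 e2 e3
    linear_combination (norm := module) e0 - e1 + e2 - e3
  · have e0 := C b (a * x⁻¹ * a⁻¹) a x
    have e1 := C (c * b * a * x⁻¹ * a⁻¹ * b⁻¹ * c⁻¹) c b a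
    have e2 := C c (b * a * x⁻¹ * a⁻¹ * b⁻¹) b a
    have e3 := C c b (a * x⁻¹ * a⁻¹) a
    have e4 := C c b a (x⁻¹)
    have e5 := C (b * a * x⁻¹ * a⁻¹ * b⁻¹) (b * a * x * a⁻¹ * b⁻¹) b a
    have e6 := C (b * a * x⁻¹ * a⁻¹ * b⁻¹) b (a * x * a⁻¹) a
    have e7 := C (b * a * x⁻¹ * a⁻¹ * b⁻¹) b a x
    have e8 := C b (a * x⁻¹ * a⁻¹) (a * x * a⁻¹) a
    have e9 := C b a (x⁻¹) x
    simp [ha, hb, hc, hx, mul_assoc, h1, h2, h3] at e0 e1 e2 e3 e4 e5 e6 e7 e8 e9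
    linear_combination (norm := module) e0 + e1 - e2 + e3 - e4 - e5 + e6 - e7 - e8 - e9
  · have e0 := C (c * b * a * x⁻¹ * a⁻¹ * b⁻¹ * c⁻¹) c b a
    have e1 := C c (b * a * x⁻¹ * a⁻¹ * b⁻¹) b a
    have e2 := C c b (a * x⁻¹ * a⁻¹) a
    have e3 := C c b a (x⁻¹)
    simp [ha, hb, hc, hx, mul_assoc] at e0 e1 e2 e3
    linear_combination (norm := module) e0 - e1 + e2 - e3
  · have e0 := C (x⁻¹) x (x⁻¹) x
    have e1 := C (c * b * a * x * a⁻¹ * b⁻¹ * c⁻¹) c b a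
    have e2 := C c (b * a * x * a⁻¹ * b⁻¹) b a
    have e3 := C c b (a * x * a⁻¹) a
    have e4 := C c b a x
    have e5 := C (a * x⁻¹ * a⁻¹) (a * x * a⁻¹) (a * x⁻¹ * a⁻¹) (a * x * a⁻¹)
    have e6 := C b (a * x * a⁻¹) a (x⁻¹)
    have e7 := C (b * a * x * a⁻¹ * b⁻¹) b (a * x⁻¹ * a⁻¹) a
    have e8 := C (b * a * x * a⁻¹ * b⁻¹) (b * a * x⁻¹ * a⁻¹ * b⁻¹) b a
    have e9 := C (b * a * x * a⁻¹ * b⁻¹) b a (x⁻¹)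
    have e10 := C b (a * x * a⁻¹) (a * x⁻¹ * a⁻¹) a
    have e11 := C b a x (x⁻¹)
    have e12 := C (a * x⁻¹ * a⁻¹) (a * x * a⁻¹) (a * x⁻¹ * a⁻¹) a
    have e13 := C (a * x⁻¹ * a⁻¹) (a * x * a⁻¹) a (x⁻¹)
    have e14 := C (a * x⁻¹ * a⁻¹) a x (x⁻¹)
    have e15 := C a (x⁻¹) x (x⁻¹)
    simp [ha, hb, hc, hx, mul_assoc, h1, h2, h3] at e0 e1 e2 e3 e4 e5 e6 e7 e8 e9 e10 e11 e12 e13 e14 e15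
    linear_combination (norm := module) - e0 + e1 - e2 + e3 - e4 + e5 + e6 + e7 - e8 - e9 - e10 - e11 - e12 + e13 - e14 + e15
  · have e0 := C (c * b * a * x⁻¹ * a⁻¹ * b⁻¹ * c⁻¹) c b a
    have e1 := C c (b * a * x⁻¹ * a⁻¹ * b⁻¹) b a
    have e2 := C c b (a * x⁻¹ * a⁻¹) a
    have e3 := C c b a (x⁻¹)
    simp [ha, hb, hc, hx, mul_assoc] at e0 e1 e2 e3
    linear_combination (norm := module) e0 - e1 + e2 - e3
  · have e0 := C b (a * x * a⁻¹) a (x⁻¹)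
    have e1 := C (c * b * a * x * a⁻¹ * b⁻¹ * c⁻¹) c b a
    have e2 := C c (b * a * x * a⁻¹ * b⁻¹) b a
    have e3 := C c b (a * x * a⁻¹) a
    have e4 := C c b a x
    have e5 := C (b * a * x * a⁻¹ * b⁻¹) b (a * x⁻¹ * a⁻¹) a
    have e6 := C (b * a * x * a⁻¹ * b⁻¹) (b * a * x⁻¹ * a⁻¹ * b⁻¹) b a
    have e7 := C (b * a * x * a⁻¹ * b⁻¹) b a (x⁻¹)
    have e8 := C b (a * x * a⁻¹) (a * x⁻¹ * a⁻¹) a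
    have e9 := C b a x (x⁻¹)
    simp [ha, hb, hc, hx, mul_assoc, h1, h2, h3] at e0 e1 e2 e3 e4 e5 e6 e7 e8 e9
    linear_combination (norm := module) e0 + e1 - e2 + e3 - e4 + e5 - e6 - e7 - e8 - e9
  · have e0 := C (c * b * a * x * a⁻¹ * b⁻¹ * c⁻¹) c b a
    have e1 := C c (b * a * x * a⁻¹ * b⁻¹) b a
    have e2 := C c b (a * x * a⁻¹) a
    have e3 := C c b a x
    simp [ha, hb, hc, hx, mul_assoc] at e0 e1 e2 e3
    linear_combination (norm := module) e0 - e1 + e2 - e3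
  · have e0 := C (x⁻¹) x (x⁻¹) x
    have e1 := C (c * b * a * x⁻¹ * a⁻¹ * b⁻¹ * c⁻¹) c b a
    have e2 := C c (b * a * x⁻¹ * a⁻¹ * b⁻¹) b a
    have e3 := C c b (a * x⁻¹ * a⁻¹) a
    have e4 := C c b a (x⁻¹)
    have e5 := C b (a * x⁻¹ * a⁻¹) a x
    have e6 := C (b * a * x⁻¹ * a⁻¹ * b⁻¹) (b * a * x * a⁻¹ * b⁻¹) b a
    have e7 := C (b * a * x⁻¹ * a⁻¹ * b⁻¹) b (a * x * a⁻¹) a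
    have e8 := C (b * a * x⁻¹ * a⁻¹ * b⁻¹) b a x
    have e9 := C b (a * x⁻¹ * a⁻¹) (a * x * a⁻¹) a
    have e10 := C b a (x⁻¹) x
    have e11 := C (a * x⁻¹ * a⁻¹) (a * x * a⁻¹) a (x⁻¹)
    have e12 := C (a * x⁻¹ * a⁻¹) (a * x * a⁻¹) (a * x⁻¹ * a⁻¹) a
    have e13 := C (a * x⁻¹ * a⁻¹) a x (x⁻¹)
    have e14 := C a (x⁻¹) x (x⁻¹)
    simp [ha, hb, hc, hx, mul_assoc, h1, h2, h3] at e0 e1 e2 e3 e4 e5 e6 e7 e8 e9 e10 e11 e12 e13 e14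
    linear_combination (norm := module) - e0 + e1 - e2 + e3 - e4 + e5 - e6 + e7 - e8 - e9 - e10 - e11 + e12 + e13 - e14

end Cocycle

/-! ### Loop groupoids -/

section Loops

/-- Objects of the loop groupoid `ΛBG`: elements of `G`. A morphism `x ⟶ y` is an element `s` with
`y = s x s⁻¹`. -/
@[ext]
structure Loop (G : Type uG) where
  elt : G

instance (G : Type uG) [Group G] : Category.{uG} (Loop G) where
  Hom x y := {s : G // s * x.elt = y.elt * s}
  id x := ⟨1, by simp⟩
  comp f g := ⟨g.1 * f.1, by rw [mul_assoc, f.2, ← mul_assoc, g.2, mul_assoc]⟩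
  id_comp f := Subtype.ext (mul_one f.1)
  comp_id f := Subtype.ext (one_mul f.1)
  assoc f g h := Subtype.ext (mul_assoc h.1 g.1 f.1).symm

variable {Γ : Type uG} [Group Γ]

/-- Objects of the unoriented loop groupoid: elements of `G = ker π`. A morphism `x ⟶ y` is an
element `ω` of `Γ` with `y = ω x ^ (π ω) ω⁻¹`. -/
@[ext]
structure UnorientedLoop (π : Γ →* ℤˣ) where
  elt : π.ker

theorem unoriented_comp (π : Γ →* ℤˣ) {x y z f g : Γ}
    (hf : f * x ^ ((π f : ℤˣ) : ℤ) = y * f) (hg : g * y ^ ((π g : ℤˣ) : ℤ) = z * g) :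
    g * f * x ^ ((π (g * f) : ℤˣ) : ℤ) = z * (g * f) := by
  have hy : y = f * x ^ ((π f : ℤˣ) : ℤ) * f⁻¹ := by rw [hf]; simp
  rw [← mul_assoc, ← hg, hy]
  rcases Int.units_eq_one_or (π f) with h | h <;> rcases Int.units_eq_one_or (π g) with h' | h' <;>
    simp [h, h', mul_assoc]

instance (π : Γ →* ℤˣ) : Category.{uG} (UnorientedLoop π) where
  Hom x y := {ω : Γ // ω * (x.elt : Γ) ^ ((π ω : ℤˣ) : ℤ) = y.elt * ω}
  id x := ⟨1, by simp⟩
  comp f g := ⟨g.1 * f.1, unoriented_comp π f.2 g.2⟩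
  id_comp f := Subtype.ext (mul_one f.1)
  comp_id f := Subtype.ext (one_mul f.1)
  assoc f g h := Subtype.ext (mul_assoc h.1 g.1 f.1).symm

/-- The functor from the loop groupoid of a subgroup `H` of `G = ker π` to the unoriented loop
groupoid. -/
def loopInclusion (π : Γ →* ℤˣ) (H : Subgroup π.ker) : Loop H ⥤ UnorientedLoop π where
  obj x := ⟨x.elt⟩
  map {x y} s := ⟨((s.1 : π.ker) : Γ), by
    have h := congrArg (fun t : H => ((t : π.ker) : Γ)) s.2
    have h' : π ((s.1 : π.ker) : Γ) = 1 := (s.1 : π.ker).2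
    simpa [h'] using h⟩

end Loops

/-! ### Twisted representations of groupoids and their induction -/

section Induction

/-- A `2`-cocycle on a category with values in `kˣ`; the value on composable
morphisms `f`, `g` (first `f`, then `g`) is the one usually written `θ([g|f])`. -/
structure Twisting (k : Type uk) [Field k] (C : Type u₁) [Category.{v₁} C] where
  val : ∀ {x y z : C}, (x ⟶ y) → (y ⟶ z) → kˣ
  cocycle : ∀ {x y z t : C} (f : x ⟶ y) (g : y ⟶ z) (h : z ⟶ t),
    val f g * val (f ≫ g) h = val f (g ≫ h) * val g h

/-- The pullback of a `2`-cocycle along a functor. -/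
def Twisting.pullback {k : Type uk} [Field k] {C : Type u₁} [Category.{v₁} C] {D : Type u₂}
    [Category.{v₂} D] (θ : Twisting k C) (F : D ⥤ C) : Twisting k D where
  val f g := θ.val (F.map f) (F.map g)
  cocycle f g h := by rw [F.map_comp, F.map_comp, θ.cocycle]

/-- A family of vector spaces with linear maps, indexed by the objects and morphisms of `C`. -/
structure ProjRep (k : Type uk) [Field k] (C : Type u₁) [Category.{v₁} C] where
  obj : C → ModuleCat.{w} k
  map : ∀ {x y : C}, (x ⟶ y) → (obj x →ₗ[k] obj y)

variable {k : Type uk} [Field k] {C : Type u₁} [Category.{v₁} C] {D : Type u₂} [Category.{v₂} D]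

/-- `E` is a `θ`-twisted representation. -/
structure ProjRep.IsTwisted (E : ProjRep.{w} k C) (θ : Twisting k C) : Prop where
  map_id : ∀ x, E.map (𝟙 x) = LinearMap.id
  map_map : ∀ {x y z : C} (f : x ⟶ y) (g : y ⟶ z),
    E.map g ∘ₗ E.map f = (θ.val f g : k) • E.map (f ≫ g)

/-- Isomorphisms of twisted representations. -/
@[ext]
structure ProjRep.Iso (E : ProjRep.{w} k C) (E' : ProjRep.{w'} k C) where
  equiv : ∀ x, E.obj x ≃ₗ[k] E'.obj x
  comm : ∀ {x y : C} (f : x ⟶ y) (v : E.obj x), equiv y (E.map f v) = E'.map f (equiv x v)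

variable (F : D ⥤ C) (θ : Twisting k C) (E : ProjRep.{w} k D)

/-- The direct sum of the spaces `E y` over all pairs `(y, s : F y ⟶ x)`. -/
abbrev IndSum (x : C) : Type _ :=
  DirectSum (Σ y : D, (F.obj y ⟶ x)) fun p => E.obj p.1

/-- The element `s ⊗ v` of the direct sum. -/
noncomputable def indSumMk {x : C} {y : D} (s : F.obj y ⟶ x) : E.obj y →ₗ[k] IndSum F E x :=
  open Classical in DirectSum.lof k (Σ y : D, (F.obj y ⟶ x)) (fun p => E.obj p.1) ⟨y, s⟩

/-- The relations `s ⊗ E(t) v = θ([s|F t]) (s ∘ F t) ⊗ v`. -/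
def indRel (x : C) : Submodule k (IndSum F E x) :=
  Submodule.span k {z | ∃ (y y' : D) (t : y ⟶ y') (s : F.obj y' ⟶ x) (v : E.obj y),
    z = indSumMk F E s (E.map t v) - (θ.val (F.map t) s : k) • indSumMk F E (F.map t ≫ s) v}

/-- The action of `f` on the direct sum, `s ⊗ v ↦ θ([f|s]) (f ∘ s) ⊗ v`. -/
noncomputable def indSumMap {x x' : C} (f : x ⟶ x') : IndSum F E x →ₗ[k] IndSum F E x' :=
  open Classical in DirectSum.toModule k _ _ fun p =>
    (θ.val p.2 f : k) • indSumMk F E (p.2 ≫ f)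

theorem indSumMap_mk {x x' : C} (f : x ⟶ x') {y : D} (s : F.obj y ⟶ x) (v : E.obj y) :
    indSumMap F θ E f (indSumMk F E s v) = (θ.val s f : k) • indSumMk F E (s ≫ f) v := by
  classical
  unfold indSumMap
  conv_lhs => rw [indSumMk]
  simp [DirectSum.toModule_lof]

theorem indRel_le {x x' : C} (f : x ⟶ x') :
    indRel F θ E x ≤ (indRel F θ E x').comap (indSumMap F θ E f) := by
  refine Submodule.span_le.2 ?_
  rintro _ ⟨y, y', t, s, v, rfl⟩
  have h : (θ.val (F.map t) s : k) * θ.val (F.map t ≫ s) f =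
      θ.val (F.map t) (s ≫ f) * θ.val s f := by
    exact_mod_cast congrArg Units.val (θ.cocycle (F.map t) s f)
  have key : indSumMap F θ E f
      (indSumMk F E s (E.map t v) - (θ.val (F.map t) s : k) • indSumMk F E (F.map t ≫ s) v) =
      (θ.val s f : k) • (indSumMk F E (s ≫ f) (E.map t v) -
        (θ.val (F.map t) (s ≫ f) : k) • indSumMk F E (F.map t ≫ s ≫ f) v) := by
    rw [map_sub, map_smul, indSumMap_mk, indSumMap_mk, smul_sub, smul_smul, smul_smul, h,
      mul_comm, Category.assoc]
  change indSumMap F θ E f _ ∈ indRel F θ E x'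
  rw [key]
  exact Submodule.smul_mem _ _ (Submodule.subset_span ⟨y, y', t, s ≫ f, v, rfl⟩)

/-- The `θ`-twisted induction of `E` along `F`: the space at `x` is the quotient of the direct sum
of the `E y` over `s : F y ⟶ x` by the relations above, that is, the tensor product of `E` with the
`θ`-twisted groupoid algebra of `C` over the twisted groupoid algebra of `D`. -/
noncomputable def ProjRep.induced : ProjRep k C where
  obj x := ModuleCat.of k (IndSum F E x ⧸ indRel F θ E x)
  map f := (indRel F θ E _).mapQ (indRel F θ E _) (indSumMap F θ E f) (indRel_le F θ E f)

/-- The class of `s ⊗ v` in the induced representation. -/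
noncomputable def ProjRep.inducedMk {x : C} {y : D} (s : F.obj y ⟶ x) (v : E.obj y) :
    (E.induced F θ).obj x :=
  (indRel F θ E x).mkQ (indSumMk F E s v)

end Induction

section Transgression

variable {Γ : Type uG} [Group Γ] {k : Type uk} [Field k]

/-- The `2`-cocycle on the unoriented loop groupoid given by `tauRef`. -/
def tauTwisting {π : Γ →* ℤˣ} {α : Γ → Γ → Γ → kˣ} (hα : IsTwistedCocycle π α) :
    Twisting k (UnorientedLoop π) where
  val {x _ _} f g := tauRef π α g.1 f.1 x.elt
  cocycle {x y _ _} f g h := by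
    have hy : (y.elt : Γ) = f.1 * (x.elt : Γ) ^ ((π f.1 : ℤˣ) : ℤ) * f.1⁻¹ := by
      rw [f.2]; simp
    have H := tauRef_cocycle hα h.1 g.1 f.1 x.elt x.elt.2
    rw [← hy] at H
    exact H

end Transgression

/-! ### Linear 2-representations and their categorical characters -/

section TwoRep

/-- The data of a weak action of the group `G` on the `k`-linear category `V`: `k`-linear functors
`F g`, isomorphisms `ψ : F a ∘ F b ≅ F c` whenever `a * b = c`, and `ψe : F 1 ≅ 1`. The coherence
laws, which involve a `3`-cocycle, are in `TwoRep.IsTwisted`. -/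
structure TwoRep (k : Type uk) [Field k] (G : Type uG) [Group G]
    (V : Type u) [Category.{v} V] [Preadditive V] [Linear k V] where
  F : G → V ⥤ V
  additive : ∀ g, (F g).Additive
  linear : ∀ g, (F g).Linear k
  ψ : ∀ {a b c : G}, a * b = c → (F b ⋙ F a ≅ F c)
  ψe : ∀ {a : G}, a = 1 → (F a ≅ 𝟭 V)

attribute [instance] TwoRep.additive TwoRep.linear

variable {k : Type uk} [Field k] {G : Type uG} [Group G]
variable {V : Type u} [Category.{v} V] [Preadditive V] [Linear k V]

/-- The coherence laws of an `α`-twisted 2-representation. -/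
structure TwoRep.IsTwisted (ρ : TwoRep k G V) (α : G → G → G → kˣ) : Prop where
  assoc : ∀ {c b a cb ba cba : G} (h₁ : c * b = cb) (h₂ : b * a = ba) (h₃ : cb * a = cba)
    (h₄ : c * ba = cba) (x : V),
    (α c b a : k) • ((ρ.ψ h₁).hom.app ((ρ.F a).obj x) ≫ (ρ.ψ h₃).hom.app x) =
      (ρ.F c).map ((ρ.ψ h₂).hom.app x) ≫ (ρ.ψ h₄).hom.app x
  unit_left : ∀ {e a : G} (he : e = 1) (h : e * a = a) (x : V),
    (ρ.ψ h).hom.app x = (ρ.ψe he).hom.app ((ρ.F a).obj x)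
  unit_right : ∀ {e a : G} (he : e = 1) (h : a * e = a) (x : V),
    (ρ.ψ h).hom.app x = (ρ.F a).map ((ρ.ψe he).hom.app x)

/-- The categorical trace of `g`: natural transformations from the identity functor to `F g`. -/
abbrev TwoRep.Tr (ρ : TwoRep k G V) (g : G) : Type (max u v) := 𝟭 V ⟶ ρ.F g

/-- For `g' = s g s⁻¹`, the conjugation map `Tr(g) → Tr(g')`, namely the composite
`1 ≅ F s ∘ F s⁻¹ → F s ∘ F g ∘ F s⁻¹ ≅ F (s g) ∘ F s⁻¹ ≅ F g' ∘ F s ∘ F s⁻¹ ≅ F g'`. -/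
def TwoRep.conj (ρ : TwoRep k G V) {g g' : G} (s : G) (h : s * g = g' * s) :
    ρ.Tr g →ₗ[k] ρ.Tr g' where
  toFun φ :=
    { app := fun x =>
        (ρ.ψe rfl).inv.app x ≫ (ρ.ψ (mul_inv_cancel s)).inv.app x ≫
        (ρ.F s).map (φ.app ((ρ.F s⁻¹).obj x)) ≫
        (ρ.ψ h).hom.app ((ρ.F s⁻¹).obj x) ≫ (ρ.ψ rfl).inv.app ((ρ.F s⁻¹).obj x) ≫
        (ρ.F g').map ((ρ.ψ (mul_inv_cancel s)).hom.app x ≫ (ρ.ψe rfl).hom.app x)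
      naturality := by
        intro x y f
        have h1 := (ρ.ψe (rfl : (1:G) = 1)).inv.naturality f
        have h2 := (ρ.ψ (mul_inv_cancel s)).inv.naturality f
        have h3 := φ.naturality ((ρ.F s⁻¹).map f)
        have h4 := (ρ.ψ h).hom.naturality ((ρ.F s⁻¹).map f)
        have h5 := (ρ.ψ (rfl : g' * s = g' * s)).inv.naturality ((ρ.F s⁻¹).map f)
        have h6 := (ρ.ψ (mul_inv_cancel s)).hom.naturality f
        have h7 := (ρ.ψe (rfl : (1:G) = 1)).hom.naturality f
        simp only [Functor.comp_map, Functor.id_map, Functor.comp_obj, Functor.id_obj] at *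
        simp only [Category.assoc, ← Functor.map_comp]
        rw [reassoc_of% h1, reassoc_of% h2, ← Functor.map_comp_assoc, h3, Functor.map_comp_assoc,
          reassoc_of% h4, reassoc_of% h5, ← Functor.map_comp, reassoc_of% h6, h7] }
  map_add' φ₁ φ₂ := by
    ext x; simp
  map_smul' c φ := by
    ext x; simp

/-- The map `F g⁻¹ → F g⁻¹ ∘ F g ≅ 1` given by `φ` in `Tr(g)`, at the object `x`. -/
def TwoRep.contract (ρ : TwoRep k G V) (g : G) (φ : ρ.Tr g) (x : V) : (ρ.F g⁻¹).obj x ⟶ x :=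
  (ρ.F g⁻¹).map (φ.app x) ≫ (ρ.ψ (inv_mul_cancel g)).hom.app x ≫ (ρ.ψe rfl).hom.app x

theorem TwoRep.contract_naturality (ρ : TwoRep k G V) (g : G) (φ : ρ.Tr g) {x y : V} (f : x ⟶ y) :
    (ρ.F g⁻¹).map f ≫ ρ.contract g φ y = ρ.contract g φ x ≫ f := by
  have h3 := φ.naturality f
  have h4 := (ρ.ψ (inv_mul_cancel g)).hom.naturality f
  have h5 := (ρ.ψe (rfl : (1 : G) = 1)).hom.naturality f
  simp only [Functor.comp_map, Functor.id_map, Functor.comp_obj, Functor.id_obj] at *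
  simp only [TwoRep.contract, Category.assoc]
  rw [← Functor.map_comp_assoc, h3, Functor.map_comp_assoc, reassoc_of% h4, h5]

/-- The categorical character of a 2-representation, on the loop groupoid of `G`. -/
def TwoRep.character (ρ : TwoRep k G V) : ProjRep.{max u v} k (Loop G) where
  obj x := ModuleCat.of k (ρ.Tr x.elt)
  map s := ρ.conj s.1 s.2

end TwoRep

/-! ### Real 2-representations and their Real categorical characters -/

section RealTwoRep

variable {Γ : Type uG} [Group Γ]

/-- The elements of degree `-1`. -/
abbrev OddElt (π : Γ →* ℤˣ) : Type uG := {ω : Γ // π ω = -1}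

section OddElt

variable {π : Γ →* ℤˣ}

/-- `ω⁻¹` -/
def OddElt.inv (ω : OddElt π) : OddElt π := ⟨(ω : Γ)⁻¹, by rw [map_inv, ω.2]; rfl⟩

/-- `ω g` -/
def OddElt.mulKer (ω : OddElt π) (g : π.ker) : OddElt π :=
  ⟨ω * g, by rw [map_mul, ω.2, show π (g : Γ) = 1 from g.2]; rfl⟩

/-- `ω ς` -/
def OddElt.mulOdd (ω ς : OddElt π) : π.ker :=
  ⟨ω * ς, by rw [MonoidHom.mem_ker, map_mul, ω.2, ς.2]; rfl⟩

/-- `ς⁻¹ g ς` -/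
def OddElt.conjKer (ς : OddElt π) (g : π.ker) : π.ker :=
  ς.inv.mulOdd (⟨g * ς, by rw [map_mul, ς.2, show π (g : Γ) = 1 from g.2]; rfl⟩)

end OddElt

/-- The data of a Real weak action of `Γ`, graded by `π`, on the `k`-linear category `V`: linear
functors `F g : V ⥤ V` for `g` of degree `1`, linear functors `Fm ω : Vᵒᵖ ⥤ V` for `ω` of degree
`-1`, isomorphisms `ψ` from the composites `F a ∘ F b` to `F c` whenever `a * b = c` (the names of
the four families record the degrees of `a` and `b`, and the functor assigned to `b` is replaced
by its opposite when `a` has degree `-1`) and `ψe : F 1 ≅ 1`. The coherence laws are in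
`RealTwoRep.IsTwisted`. -/
structure RealTwoRep (k : Type uk) [Field k] {Γ : Type uG} [Group Γ] (π : Γ →* ℤˣ)
    (V : Type u) [Category.{v} V] [Preadditive V] [Linear k V] extends
    TwoRep k π.ker V where
  Fm : OddElt π → Vᵒᵖ ⥤ V
  additive_m : ∀ ω, (Fm ω).Additive
  linear_m : ∀ ω, (Fm ω).Linear k
  ψpm : ∀ {a : π.ker} {b c : OddElt π}, (a : Γ) * b = c → (Fm b ⋙ F a ≅ Fm c)
  ψmp : ∀ {a : OddElt π} {b : π.ker} {c : OddElt π}, (a : Γ) * b = c → ((F b).op ⋙ Fm a ≅ Fm c)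
  ψmm : ∀ {a b : OddElt π} {c : π.ker}, (a : Γ) * b = c → ((Fm b).rightOp ⋙ Fm a ≅ F c)

attribute [instance] RealTwoRep.additive_m RealTwoRep.linear_m

variable {k : Type uk} [Field k] {π : Γ →* ℤˣ}
variable {V : Type u} [Category.{v} V] [Preadditive V] [Linear k V]

/-- The coherence laws of an `α`-twisted Real 2-representation. For all degrees of `c`, `b`, `a`,
`α c b a • (ψ (c b, a) ∘ (ψ (c, b) * F a)) = ψ (c, b a) ∘ (F c * ψ (b, a) ^ (π c))`. -/
structure RealTwoRep.IsTwisted (ρ : RealTwoRep k π V) (α : Γ → Γ → Γ → kˣ) : Prop where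
  ppp : ρ.toTwoRep.IsTwisted fun c b a => α c b a
  ppm : ∀ {c b cb : π.ker} {a ba cba : OddElt π} (h₁ : c * b = cb) (h₂ : (b : Γ) * a = ba)
    (h₃ : (cb : Γ) * a = cba) (h₄ : (c : Γ) * ba = cba) (x : V),
    (α c b a : k) • ((ρ.ψ h₁).hom.app ((ρ.Fm a).obj (op x)) ≫ (ρ.ψpm h₃).hom.app (op x)) =
      (ρ.F c).map ((ρ.ψpm h₂).hom.app (op x)) ≫ (ρ.ψpm h₄).hom.app (op x)
  pmp : ∀ {c a : π.ker} {b cb ba cba : OddElt π} (h₁ : (c : Γ) * b = cb) (h₂ : (b : Γ) * a = ba)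
    (h₃ : (cb : Γ) * a = cba) (h₄ : (c : Γ) * ba = cba) (x : V),
    (α c b a : k) • ((ρ.ψpm h₁).hom.app (op ((ρ.F a).obj x)) ≫ (ρ.ψmp h₃).hom.app (op x)) =
      (ρ.F c).map ((ρ.ψmp h₂).hom.app (op x)) ≫ (ρ.ψpm h₄).hom.app (op x)
  pmm : ∀ {c ba cba : π.ker} {b a cb : OddElt π} (h₁ : (c : Γ) * b = cb) (h₂ : (b : Γ) * a = ba)
    (h₃ : (cb : Γ) * a = cba) (h₄ : c * ba = cba) (x : V),
    (α c b a : k) • ((ρ.ψpm h₁).hom.app (op ((ρ.Fm a).obj (op x))) ≫ (ρ.ψmm h₃).hom.app x) =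
      (ρ.F c).map ((ρ.ψmm h₂).hom.app x) ≫ (ρ.ψ h₄).hom.app x
  mpp : ∀ {b a ba : π.ker} {c cb cba : OddElt π} (h₁ : (c : Γ) * b = cb) (h₂ : b * a = ba)
    (h₃ : (cb : Γ) * a = cba) (h₄ : (c : Γ) * ba = cba) (x : V),
    (α c b a : k) • ((ρ.ψmp h₁).hom.app (op ((ρ.F a).obj x)) ≫ (ρ.ψmp h₃).hom.app (op x)) =
      (ρ.Fm c).map ((ρ.ψ h₂).inv.app x).op ≫ (ρ.ψmp h₄).hom.app (op x)
  mpm : ∀ {b cba : π.ker} {c a cb ba : OddElt π} (h₁ : (c : Γ) * b = cb) (h₂ : (b : Γ) * a = ba)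
    (h₃ : (cb : Γ) * a = cba) (h₄ : (c : Γ) * ba = cba) (x : V),
    (α c b a : k) • ((ρ.ψmp h₁).hom.app (op ((ρ.Fm a).obj (op x))) ≫ (ρ.ψmm h₃).hom.app x) =
      (ρ.Fm c).map ((ρ.ψpm h₂).inv.app (op x)).op ≫ (ρ.ψmm h₄).hom.app x
  mmp : ∀ {a cb cba : π.ker} {c b ba : OddElt π} (h₁ : (c : Γ) * b = cb) (h₂ : (b : Γ) * a = ba)
    (h₃ : cb * a = cba) (h₄ : (c : Γ) * ba = cba) (x : V),
    (α c b a : k) • ((ρ.ψmm h₁).hom.app ((ρ.F a).obj x) ≫ (ρ.ψ h₃).hom.app x) =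
      (ρ.Fm c).map ((ρ.ψmp h₂).inv.app (op x)).op ≫ (ρ.ψmm h₄).hom.app x
  mmm : ∀ {cb ba : π.ker} {c b a cba : OddElt π} (h₁ : (c : Γ) * b = cb) (h₂ : (b : Γ) * a = ba)
    (h₃ : (cb : Γ) * a = cba) (h₄ : (c : Γ) * ba = cba) (x : V),
    (α c b a : k) • ((ρ.ψmm h₁).hom.app ((ρ.Fm a).obj (op x)) ≫ (ρ.ψpm h₃).hom.app (op x)) =
      (ρ.Fm c).map ((ρ.ψmm h₂).inv.app x).op ≫ (ρ.ψmp h₄).hom.app (op x)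
  unit_pm : ∀ {e : π.ker} {a : OddElt π} (he : e = 1) (h : (e : Γ) * a = a) (x : V),
    (ρ.ψpm h).hom.app (op x) = (ρ.ψe he).hom.app ((ρ.Fm a).obj (op x))
  unit_mp : ∀ {e : π.ker} {a : OddElt π} (he : e = 1) (h : (a : Γ) * e = a) (x : V),
    (ρ.ψmp h).hom.app (op x) = (ρ.Fm a).map ((ρ.ψe he).inv.app x).op

/-- For `g' = ω g⁻¹ ω⁻¹` with `ω` of degree `-1`, the map `Tr(g) → Tr(g')` which sends `φ` to
`1 ≅ F ω ∘ F ω⁻¹ → F ω ∘ F g⁻¹ ∘ F ω⁻¹ ≅ F (ω g⁻¹) ∘ F ω⁻¹ ≅ F g' ∘ F ω ∘ F ω⁻¹ ≅ F g'`,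
where the second map is the contravariant functor `F ω` applied to
`F g⁻¹ → F g⁻¹ ∘ F g ≅ 1`. -/
def RealTwoRep.conjOdd (ρ : RealTwoRep k π V) {g g' : π.ker} (ω : OddElt π)
    (h : (ω : Γ) * (g : Γ)⁻¹ = g' * ω) : ρ.toTwoRep.Tr g →ₗ[k] ρ.toTwoRep.Tr g' where
  toFun φ :=
    { app := fun x =>
        (ρ.ψe rfl).inv.app x ≫
        (ρ.ψmm (a := ω) (b := ω.inv) (c := 1) (mul_inv_cancel (ω : Γ))).inv.app x ≫
        (ρ.Fm ω).map (ρ.contract g φ ((ρ.Fm ω.inv).obj (op x))).op ≫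
        (ρ.ψmp (a := ω) (b := g⁻¹) (c := ω.mulKer g⁻¹) rfl).hom.app
          (op ((ρ.Fm ω.inv).obj (op x))) ≫
        (ρ.ψpm (a := g') (b := ω) (c := ω.mulKer g⁻¹) h.symm).inv.app
          (op ((ρ.Fm ω.inv).obj (op x))) ≫
        (ρ.F g').map
          ((ρ.ψmm (a := ω) (b := ω.inv) (c := 1) (mul_inv_cancel (ω : Γ))).hom.app x ≫
            (ρ.ψe rfl).hom.app x)
      naturality := by
        intro x y f
        have h1 := (ρ.ψe (rfl : (1 : π.ker) = 1)).inv.naturality f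
        have h2 := (ρ.ψmm (a := ω) (b := ω.inv) (c := 1)
          (mul_inv_cancel (ω : Γ))).inv.naturality f
        have h6 := (ρ.ψmp (a := ω) (b := g⁻¹) (c := ω.mulKer g⁻¹) rfl).hom.naturality
          ((ρ.Fm ω.inv).map f.op).op
        have h7 := (ρ.ψpm (a := g') (b := ω) (c := ω.mulKer g⁻¹) h.symm).inv.naturality
          ((ρ.Fm ω.inv).map f.op).op
        have h8 := (ρ.ψmm (a := ω) (b := ω.inv) (c := 1)
          (mul_inv_cancel (ω : Γ))).hom.naturality f
        have h9 := (ρ.ψe (rfl : (1 : π.ker) = 1)).hom.naturality f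
        have hP := ρ.contract_naturality g φ ((ρ.Fm ω.inv).map f.op)
        simp only [Functor.comp_map, Functor.id_map, Functor.comp_obj, Functor.id_obj,
          Functor.rightOp_map, Functor.rightOp_obj, Functor.op_map, Functor.op_obj,
          Quiver.Hom.unop_op, unop_op] at *
        simp only [Category.assoc, ← Functor.map_comp]
        rw [reassoc_of% h1, reassoc_of% h2, ← Functor.map_comp_assoc, ← op_comp, ← hP, op_comp,
          Functor.map_comp_assoc, reassoc_of% h6, reassoc_of% h7, ← Functor.map_comp,
          reassoc_of% h8, h9] }
  map_add' φ₁ φ₂ := by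
    ext x; simp [TwoRep.contract]
  map_smul' c φ := by
    ext x; simp [TwoRep.contract]

/-- The Real categorical character of a Real 2-representation, on the unoriented loop groupoid. -/
def RealTwoRep.character (ρ : RealTwoRep k π V) :
    ProjRep.{max u v} k (UnorientedLoop π) where
  obj x := ModuleCat.of k (ρ.toTwoRep.Tr x.elt)
  map {x y} ω :=
    if h : π ω.1 = 1 then
      ρ.toTwoRep.conj (⟨ω.1, h⟩ : π.ker) (Subtype.ext (by simpa [h] using ω.2))
    else
      ρ.conjOdd ⟨ω.1, (Int.units_eq_one_or (π ω.1)).resolve_left h⟩ (by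
        simpa [(Int.units_eq_one_or (π ω.1)).resolve_left h] using ω.2)

end RealTwoRep

/-! ### Induction from a subgroup -/

section Ind

variable {G : Type uG} [Group G] {H : Subgroup G} (r : G ⧸ H → G)
  (hr : ∀ q, (QuotientGroup.mk (r q) : G ⧸ H) = q)

/-- The element `h` of `H` with `g r_i = r_j h`, where `i` is the coset `g⁻¹ j`. -/
def cosetPart (g : G) (j : G ⧸ H) : H :=
  ⟨(r j)⁻¹ * g * r (g⁻¹ • j), by
    rw [mul_assoc, ← QuotientGroup.eq, hr j, ← smul_eq_mul, ← MulAction.Quotient.smul_coe, hr,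
      smul_inv_smul]⟩

theorem cosetPart_mul {g₂ g₁ g : G} (h : g₂ * g₁ = g) (j : G ⧸ H) :
    cosetPart r hr g₂ j * cosetPart r hr g₁ (g₂⁻¹ • j) = cosetPart r hr g j := by
  subst h
  ext
  simp [cosetPart, mul_smul, mul_assoc]

theorem coset_comp {g₂ g₁ g : G} (h : g₂ * g₁ = g) (j : G ⧸ H) :
    g₁⁻¹ • g₂⁻¹ • j = g⁻¹ • j := by
  subst h
  simp [mul_smul]

theorem cosetPart_one {g : G} (h : g = 1) (j : G ⧸ H) : cosetPart r hr g j = 1 := by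
  subst h
  ext
  simp [cosetPart]

theorem cosetPart_fix {g : G} {q : G ⧸ H} {h : H} (hg : g * r q = r q * h) {j : G ⧸ H}
    (hj : j = q) : j = g⁻¹ • j ∧ h = cosetPart r hr g j := by
  subst hj
  have h1 : j = g⁻¹ • j := by
    rw [eq_inv_smul_iff]
    conv_lhs => rw [← hr j]
    rw [MulAction.Quotient.smul_coe, smul_eq_mul, hg, QuotientGroup.mk_mul_of_mem _ h.2, hr]
  refine ⟨h1, Subtype.ext ?_⟩
  simp only [cosetPart]
  rw [← h1, mul_assoc, hg, inv_mul_cancel_left]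

variable {V : Type u} [Category.{v} V]

/-- An isomorphism in a product category from isomorphisms of the components. -/
@[simps]
def piIso {J : Type w} {x y : J → V} (e : ∀ j, x j ≅ y j) : x ≅ y where
  hom j := (e j).hom
  inv j := (e j).inv
  hom_inv_id := funext fun j => (e j).hom_inv_id
  inv_hom_id := funext fun j => (e j).inv_hom_id

/-- The identification of the components of `x` at equal indices. -/
def idxIso {J : Type w} (x : J → V) {i j : J} (h : i = j) : x i ≅ x j :=
  eqToIso (congrArg x h)

theorem idxIso_naturality {J : Type w} {x y : J → V} (f : x ⟶ y) {i j : J} (h : i = j) :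
    f i ≫ (idxIso y h).hom = (idxIso x h).hom ≫ f j := by
  subst h
  simp [idxIso]

variable {k : Type uk} [Field k] [Preadditive V] [Linear k V]

/-- The functor assigned to `g` by the induced 2-representation: its matrix has the entry
`ρ.F h` at `(j, i)` if `g r_i = r_j h`, and its other entries are zero. -/
@[simps]
def indFunctor (ρ : TwoRep k H V) (g : G) : (G ⧸ H → V) ⥤ (G ⧸ H → V) where
  obj x := fun j => (ρ.F (cosetPart r hr g j)).obj (x (g⁻¹ • j))
  map f := fun j => (ρ.F (cosetPart r hr g j)).map (f (g⁻¹ • j))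
  map_id x := funext fun j => (ρ.F (cosetPart r hr g j)).map_id (x (g⁻¹ • j))
  map_comp f f' := funext fun j =>
    (ρ.F (cosetPart r hr g j)).map_comp (f (g⁻¹ • j)) (f' (g⁻¹ • j))

/-- The scalar in the component of the coherence isomorphism of the induced 2-representation at
the row `j`, namely `α(g₂, r_i, h₁) / (α(g₂, g₁, r_l) α(r_j, h₂, h₁))`, where `g₁ r_l = r_i h₁` and
`g₂ r_i = r_j h₂`. -/
def indScalar (α : G → G → G → kˣ) (g₂ g₁ : G) (j : G ⧸ H) : kˣ :=
  α g₂ (r (g₂⁻¹ • j)) (cosetPart r hr g₁ (g₂⁻¹ • j)) /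
    (α g₂ g₁ (r (g₁⁻¹ • g₂⁻¹ • j)) *
      α (r j) (cosetPart r hr g₂ j) (cosetPart r hr g₁ (g₂⁻¹ • j)))

/-- The component at `j` of the coherence isomorphism of the induced 2-representation. -/
@[simps!]
def indComp (ρ : TwoRep k H V) (α : G → G → G → kˣ) {a b c : G} (h : a * b = c)
    (x : G ⧸ H → V) (j : G ⧸ H) :
    (ρ.F (cosetPart r hr a j)).obj
        ((ρ.F (cosetPart r hr b (a⁻¹ • j))).obj (x (b⁻¹ • a⁻¹ • j))) ≅
      (ρ.F (cosetPart r hr c j)).obj (x (c⁻¹ • j)) :=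
  smulIso (indScalar r hr α a b j)
    ((ρ.F (cosetPart r hr a j)).mapIso
        ((ρ.F (cosetPart r hr b (a⁻¹ • j))).mapIso (idxIso x (coset_comp h j))) ≪≫
      (ρ.ψ (cosetPart_mul r hr h j)).app (x (c⁻¹ • j)))

theorem indComp_naturality (ρ : TwoRep k H V) (α : G → G → G → kˣ) {a b c : G} (h : a * b = c)
    {x y : G ⧸ H → V} (f : x ⟶ y) (j : G ⧸ H) :
    (ρ.F (cosetPart r hr a j)).map
        ((ρ.F (cosetPart r hr b (a⁻¹ • j))).map (f (b⁻¹ • a⁻¹ • j))) ≫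
        (indComp r hr ρ α h y j).hom =
      (indComp r hr ρ α h x j).hom ≫ (ρ.F (cosetPart r hr c j)).map (f (c⁻¹ • j)) := by
  have h1 := idxIso_naturality f (coset_comp h j)
  have h2 := (ρ.ψ (cosetPart_mul r hr h j)).hom.naturality (f (c⁻¹ • j))
  simp only [Functor.comp_map] at h2
  simp only [indComp_hom, Linear.comp_smul, Linear.smul_comp, Category.assoc, ← h2]
  simp only [← Functor.map_comp_assoc, ← Functor.map_comp, h1]

/-- The component at `j` of the unit isomorphism of the induced 2-representation. -/
@[simps!]
def indUnit (ρ : TwoRep k H V) {a : G} (h : a = 1) (x : G ⧸ H → V) (j : G ⧸ H) :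
    (ρ.F (cosetPart r hr a j)).obj (x (a⁻¹ • j)) ≅ x j :=
  (ρ.ψe (cosetPart_one r hr h j)).app (x (a⁻¹ • j)) ≪≫
    idxIso x (show a⁻¹ • j = j by rw [h, inv_one, one_smul])

theorem indUnit_naturality (ρ : TwoRep k H V) {a : G} (h : a = 1) {x y : G ⧸ H → V} (f : x ⟶ y)
    (j : G ⧸ H) :
    (ρ.F (cosetPart r hr a j)).map (f (a⁻¹ • j)) ≫ (indUnit r hr ρ h y j).hom =
      (indUnit r hr ρ h x j).hom ≫ f j := by
  have h1 := idxIso_naturality f (show a⁻¹ • j = j by rw [h, inv_one, one_smul])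
  have h2 := (ρ.ψe (cosetPart_one r hr h j)).hom.naturality (f (a⁻¹ • j))
  simp only [Functor.id_map] at h2
  simp only [indUnit_hom, Category.assoc, ← h1]
  exact (Category.assoc _ _ _).symm.trans
    ((congrArg (· ≫ (idxIso y _).hom) h2).trans (Category.assoc _ _ _))

/-- The induction of the twisted 2-representation `ρ` of `H` to `G`, on the product of copies of
`V` indexed by the cosets. -/
def TwoRep.ind (ρ : TwoRep k H V) (α : G → G → G → kˣ) : TwoRep k G (G ⧸ H → V) where
  F := indFunctor r hr ρ
  additive g := ⟨fun {_ _ f f'} => funext fun j =>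
    (ρ.F (cosetPart r hr g j)).map_add (f := f (g⁻¹ • j)) (g := f' (g⁻¹ • j))⟩
  linear g := ⟨fun f c => funext fun j =>
    (ρ.F (cosetPart r hr g j)).map_smul c (f (g⁻¹ • j))⟩
  ψ h := NatIso.ofComponents (fun x => piIso (indComp r hr ρ α h x))
    fun f => funext (indComp_naturality r hr ρ α h f)
  ψe h := NatIso.ofComponents (fun x => piIso (indUnit r hr ρ h x))
    fun f => funext (indUnit_naturality r hr ρ h f)

/-- The component at `j` of the inclusion of `Tr(h)` into the trace of `g = r_q h r_q⁻¹` on the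
induced 2-representation: it is `φ` for `j = q` and zero otherwise. -/
noncomputable def indInclApp (ρ : TwoRep k H V) {g : G} {q : G ⧸ H} {h : H}
    (hg : g * r q = r q * h) (φ : ρ.Tr h) (x : G ⧸ H → V) (j : G ⧸ H) :
    x j ⟶ (ρ.F (cosetPart r hr g j)).obj (x (g⁻¹ • j)) :=
  open Classical in
  if hj : j = q then
    φ.app (x j) ≫ (eqToHom (congrArg ρ.F (cosetPart_fix r hr hg hj).2)).app (x j) ≫
      (ρ.F (cosetPart r hr g j)).map (idxIso x (cosetPart_fix r hr hg hj).1).hom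
  else 0

theorem indInclApp_naturality (ρ : TwoRep k H V) {g : G} {q : G ⧸ H} {h : H}
    (hg : g * r q = r q * h) (φ : ρ.Tr h) {x y : G ⧸ H → V} (f : x ⟶ y) (j : G ⧸ H) :
    f j ≫ indInclApp r hr ρ hg φ y j =
      indInclApp r hr ρ hg φ x j ≫ (ρ.F (cosetPart r hr g j)).map (f (g⁻¹ • j)) := by
  unfold indInclApp
  split_ifs with hj
  · have h1 := φ.naturality (f j)
    have h2 := (eqToHom (congrArg ρ.F (cosetPart_fix r hr hg hj).2)).naturality (f j)
    have h3 := idxIso_naturality f (cosetPart_fix r hr hg hj).1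
    simp only [Functor.id_map, Functor.id_obj] at h1
    simp only [Category.assoc, ← Functor.map_comp, ← h3]
    rw [reassoc_of% h1, reassoc_of% h2, Functor.map_comp]
  · simp

/-- The inclusion of `Tr(h)` into the trace of `g = r_q h r_q⁻¹` on the induced
2-representation. -/
noncomputable def TwoRep.indIncl (ρ : TwoRep k H V) (α : G → G → G → kˣ) {g : G} {q : G ⧸ H}
    {h : H} (hg : g * r q = r q * h) : ρ.Tr h →ₗ[k] (ρ.ind r hr α).Tr g where
  toFun φ :=
    { app := indInclApp r hr ρ hg φ
      naturality := fun _ _ f => funext (indInclApp_naturality r hr ρ hg φ f) }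
  map_add' φ₁ φ₂ := by
    ext x j
    change indInclApp r hr ρ hg (φ₁ + φ₂) x j =
      indInclApp r hr ρ hg φ₁ x j + indInclApp r hr ρ hg φ₂ x j
    unfold indInclApp
    split_ifs <;> simp
  map_smul' c φ := by
    ext x j
    change indInclApp r hr ρ hg (c • φ) x j = c • indInclApp r hr ρ hg φ x j
    unfold indInclApp
    split_ifs <;> simp

end Ind

/-! ### Hyperbolic induction -/

section HInd

variable {k : Type uk} [Field k] {V : Type u} [Category.{v} V] [Preadditive V] [Linear k V]

section Isos

variable {G : Type uG} [Group G] (σ : TwoRep k G V) {a b c : G} (h : a * b = c) (s : kˣ)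

/-- The isomorphism `s • ψ` at the object `x`. -/
def psiIso (x : V) : (σ.F a).obj ((σ.F b).obj x) ≅ (σ.F c).obj x :=
  smulIso s ((σ.ψ h).app x)

/-- The isomorphism `s • (ψ⁻¹)ᵒᵖ` in the opposite category at the object `x`. -/
def psiOpIso (x : V) : op ((σ.F a).obj ((σ.F b).obj x)) ≅ op ((σ.F c).obj x) :=
  smulIso s ((σ.ψ h).app x).symm.op

theorem psiIso_naturality {x y : V} (f : x ⟶ y) :
    (σ.F a).map ((σ.F b).map f) ≫ (psiIso σ h s y).hom =
      (psiIso σ h s x).hom ≫ (σ.F c).map f := by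
  have h2 := (σ.ψ h).hom.naturality f
  simp only [Functor.comp_map] at h2
  simp [psiIso, h2]

theorem psiOpIso_naturality {x y : V} (f : x ⟶ y) :
    ((σ.F a).map ((σ.F b).map f)).op ≫ (psiOpIso σ h s x).hom =
      (psiOpIso σ h s y).hom ≫ ((σ.F c).map f).op := by
  have h2 := congrArg Quiver.Hom.op ((σ.ψ h).inv.naturality f)
  simp only [Functor.comp_map, op_comp] at h2
  simp [psiOpIso, h2]

end Isos

variable {Γ : Type uG} [Group Γ] {π : Γ →* ℤˣ}

/-- The functor `(x, y) ↦ (F (ω ς) y, F (ς⁻¹ ω) x)` assigned to an odd `ω`. -/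
@[simps]
def oddFunctor (σ : TwoRep k π.ker V) (ς ω : OddElt π) : (V × Vᵒᵖ)ᵒᵖ ⥤ V × Vᵒᵖ where
  obj p := ((σ.F (ω.mulOdd ς)).obj p.unop.2.unop, op ((σ.F (ς.inv.mulOdd ω)).obj p.unop.1))
  map f := Prod.mkHom ((σ.F (ω.mulOdd ς)).map f.unop.2.unop)
    ((σ.F (ς.inv.mulOdd ω)).map f.unop.1).op

/-- The hyperbolic induction to `Γ` of a twisted 2-representation `σ` of `G = ker π`, on
`V × Vᵒᵖ`. An element `g` of `G` acts by `(F g, (F (ς⁻¹ g ς))ᵒᵖ)`. -/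
def TwoRep.hind (σ : TwoRep k π.ker V) (α : Γ → Γ → Γ → kˣ) (ς : OddElt π) :
    RealTwoRep k π (V × Vᵒᵖ) where
  F g := (σ.F g).prod (σ.F (ς.conjKer g)).op
  additive g := ⟨Prod.ext (σ.F g).map_add (σ.F (ς.conjKer g)).op.map_add⟩
  linear g := ⟨fun f s => Prod.ext ((σ.F g).map_smul s f.1)
    (congrArg Quiver.Hom.op ((σ.F (ς.conjKer g)).map_smul s f.2.unop))⟩
  ψ {a b c} h := NatIso.ofComponents
    (fun p => Iso.prod (psiIso σ h 1 p.1)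
      (psiOpIso σ (a := ς.conjKer a) (b := ς.conjKer b) (c := ς.conjKer c)
        (by subst h; ext; simp [OddElt.conjKer, OddElt.inv, OddElt.mulOdd, mul_assoc])
        (α a ς (ς.conjKer b) / (α a b ς * α ς (ς.conjKer a) (ς.conjKer b))) p.2.unop))
    fun f => Prod.ext (psiIso_naturality σ _ _ f.1) (psiOpIso_naturality σ _ _ f.2.unop)
  ψe {a} h := NatIso.ofComponents
    (fun p => Iso.prod ((σ.ψe h).app p.1)
      ((σ.ψe (a := ς.conjKer a)
        (by subst h; ext; simp [OddElt.conjKer, OddElt.inv, OddElt.mulOdd])).app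
          p.2.unop).symm.op)
    fun f => Prod.ext ((σ.ψe h).hom.naturality f.1)
      (congrArg Quiver.Hom.op ((σ.ψe _).inv.naturality f.2.unop).symm)
  Fm ω := oddFunctor σ ς ω
  additive_m ω := ⟨Prod.ext (σ.F _).map_add (congrArg Quiver.Hom.op (σ.F _).map_add)⟩
  linear_m ω := ⟨fun f s => Prod.ext ((σ.F _).map_smul s f.unop.2.unop)
    (congrArg Quiver.Hom.op ((σ.F _).map_smul s f.unop.1))⟩
  ψpm {a b c} h := NatIso.ofComponents
    (fun p => Iso.prod
      (psiIso σ (a := a) (b := b.mulOdd ς) (c := c.mulOdd ς)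
        (by ext; simp [OddElt.mulOdd, ← h, mul_assoc])
        (α a b ς)⁻¹ p.unop.2.unop)
      (psiOpIso σ (a := ς.conjKer a) (b := ς.inv.mulOdd b) (c := ς.inv.mulOdd c)
        (by ext; simp [OddElt.conjKer, OddElt.inv, OddElt.mulOdd, ← h, mul_assoc])
        (α a ς (ς.inv.mulOdd b) / α ς (ς.conjKer a) (ς.inv.mulOdd b)) p.unop.1))
    fun f => Prod.ext (psiIso_naturality σ _ _ f.unop.2.unop)
      (psiOpIso_naturality σ _ _ f.unop.1)
  ψmp {a b c} h := NatIso.ofComponents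
    (fun p => Iso.prod
      (psiIso σ (a := a.mulOdd ς) (b := ς.conjKer b) (c := c.mulOdd ς)
        (by ext; simp [OddElt.conjKer, OddElt.inv, OddElt.mulOdd, ← h, mul_assoc])
        (α a ς (ς.conjKer b) / α a b ς) p.unop.2.unop)
      (psiOpIso σ (a := ς.inv.mulOdd a) (b := b) (c := ς.inv.mulOdd c)
        (by ext; simp [OddElt.inv, OddElt.mulOdd, ← h, mul_assoc])
        (α ς (ς.inv.mulOdd a) b)⁻¹ p.unop.1))
    fun f => Prod.ext (psiIso_naturality σ _ _ f.unop.2.unop)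
      (psiOpIso_naturality σ _ _ f.unop.1)
  ψmm {a b c} h := NatIso.ofComponents
    (fun p => Iso.prod
      (psiIso σ (a := a.mulOdd ς) (b := ς.inv.mulOdd b) (c := c)
        (by ext; simp [OddElt.inv, OddElt.mulOdd, ← h, mul_assoc])
        (α a ς (ς.inv.mulOdd b)) p.1)
      (psiOpIso σ (a := ς.inv.mulOdd a) (b := b.mulOdd ς) (c := ς.conjKer c)
        (by ext; simp [OddElt.conjKer, OddElt.inv, OddElt.mulOdd, ← h, mul_assoc])
        (α a b ς * α ς (ς.inv.mulOdd a) (b.mulOdd ς))⁻¹ p.2.unop))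
    fun f => Prod.ext (psiIso_naturality σ _ _ f.1) (psiOpIso_naturality σ _ _ f.2.unop)

/-- The inclusion of the trace of `g` on `σ` into its trace on the hyperbolic induction,
`φ ↦ (φ, 0)`. -/
def TwoRep.hindIncl (σ : TwoRep k π.ker V) (α : Γ → Γ → Γ → kˣ) (ς : OddElt π) (g : π.ker) :
    σ.Tr g →ₗ[k] (σ.hind α ς).toTwoRep.Tr g where
  toFun φ :=
    { app := fun p => Prod.mkHom (φ.app p.1) 0
      naturality := fun _ _ f => Prod.ext (φ.naturality f.1) (by
        change f.2 ≫ 0 = 0 ≫ _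
        simp) }
  map_add' φ₁ φ₂ := by
    refine NatTrans.ext (funext fun p => Prod.ext rfl ?_)
    exact (add_zero (0 : p.2 ⟶ ((σ.F (ς.conjKer g)).op.obj p.2))).symm
  map_smul' c φ := by
    refine NatTrans.ext (funext fun p => Prod.ext rfl ?_)
    exact (smul_zero (A := p.2 ⟶ ((σ.F (ς.conjKer g)).op.obj p.2)) c).symm

/-- The hyperbolic induction from `H` to `Γ`: induction from `H` to `G = ker π`, followed by
hyperbolic induction from `G` to `Γ`. -/
def TwoRep.hindFrom {H : Subgroup π.ker} (ρ : TwoRep k H V) (α : Γ → Γ → Γ → kˣ)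
    (r : π.ker ⧸ H → π.ker) (hr : ∀ q, (QuotientGroup.mk (r q) : π.ker ⧸ H) = q)
    (ς : OddElt π) : RealTwoRep k π ((π.ker ⧸ H → V) × (π.ker ⧸ H → V)ᵒᵖ) :=
  (ρ.ind r hr fun c b a => α c b a).hind α ς

end HInd

/-- The morphism `h ⟶ g` of the unoriented loop groupoid given by `t`, for `g = t h t⁻¹`. -/
def cosetHom {Γ : Type uG} [Group Γ] {π : Γ →* ℤˣ} {H : Subgroup π.ker} {g t : π.ker} {h : H}
    (hg : g * t = t * h) : (loopInclusion π H).obj ⟨h⟩ ⟶ (⟨g⟩ : UnorientedLoop π) :=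
  ⟨t, by
    have ht : π (t : Γ) = 1 := t.2
    have h' := congrArg (fun s : π.ker => (s : Γ)) hg
    change (t : Γ) * ((h : π.ker) : Γ) ^ ((π (t : Γ) : ℤˣ) : ℤ) = g * t
    simpa [ht] using h'.symm⟩

end RealInd

/-!
The coherence laws of the induced and of the hyperbolically induced 2-representation hold because
those of `ρ` do, up to scalars which cancel by instances of the cocycle identity
(`TwoRep.IsTwisted.ind`, `TwoRep.IsTwisted.hind`).

That the characters are twisted by the transgression of `α` rests on one observation. The
conjugation map `Tr(g) → Tr(g')` of an element `s` is a transformation natural in `x`, and every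
object is isomorphic to one in the image of the functor `F s`. At an object `F s x` the map is given
by a formula without inverses in the group: for `s` of degree `1`, it is `F s (φ)` followed by
`F s ∘ F g ≅ F (s g) ≅ F g' ∘ F s` (`TwoRep.IsTwisted.conj_app_obj`), and similarly in degree `-1`,
with the contraction of `φ` (`RealTwoRep.IsTwisted.conjOdd_app_obj`). Composites of conjugation
maps can be computed from these formulas with one use of the coherence law for each factor of the
`2`-cocycle; in degree `-1`, the additional factors come from the contraction of a conjugate.

For the comparison, a natural transformation out of the identity of `∏ V` has no components
outside the cosets fixed by `g`, and at a fixed coset it is an element of a trace on `ρ`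
(`trRow_of_ne`, `trRow_eq`). Likewise the trace on `W × Wᵒᵖ` is the sum of two parts, one for each
factor, which are exchanged by the elements of degree `-1`. Conjugation by an element of degree `1`
permutes the rows and acts in them by the conjugation maps of `ρ`, with the scalar that compares the
two ways around a square of the loop groupoid (`TwoRep.IsTwisted.map_hindFromIncl`). Hence the
inclusion of the row of the trivial coset is a morphism from the character of `ρ` to the restriction
of the character of the hyperbolic induction, and by Frobenius reciprocity it extends to a morphism
`comparison` from the induced character, which maps `r_q ⊗ φ` to `φ` at the row `q`
(`comparison_cosetHom`). The induced character at `g` is spanned by the elements `r_q ⊗ φ` for the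
cosets `q` fixed by `g`, and by the images of such elements under `ς` (`exists_cosetSum_add`). The
former are mapped bijectively to the part in the first factor and the latter to the part in the
second, so `comparison` is bijective. As every isomorphism with the prescribed values is inverse to
`comparison` on these elements (`apply_comparison`), there is exactly one.
-/

namespace RealInd

/-! ### Natural families determined on the image of a functor -/

section Equivalences

/-- Two natural transformations out of the identity agree if they agree on the image of a
functor with a right inverse. -/
theorem hom_ext_of_section {V : Type u} [Category.{v} V] {C : Type u₁} [Category.{v₁} C]
    (K : C ⥤ V) (L : V ⥤ C) (E : L ⋙ K ≅ 𝟭 V) {Q : V ⥤ V} {φ φ' : 𝟭 V ⟶ Q}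
    (h : ∀ x, φ.app (K.obj x) = φ'.app (K.obj x)) : φ = φ' := by
  ext x
  -- Both sides are natural, and every object is isomorphic to one in the image of `K`.
  have h1 := φ.naturality (E.hom.app x)
  have h2 := φ'.naturality (E.hom.app x)
  simp only [Functor.id_map, Functor.comp_obj, Functor.id_obj] at h1 h2
  rw [← cancel_epi (E.hom.app x)]
  exact h1.trans ((congrArg (· ≫ _) (h _)).trans h2.symm)

/-- Transporting a natural family `R x : K x ⟶ Q (K x)` along an isomorphism `K ∘ L ≅ 1` gives back
`R` on the image of `K`, if the isomorphism satisfies a triangle identity up to a scalar. -/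
theorem transport_app_obj {k : Type uk} [Field k] {V : Type u} [Category.{v} V] [Preadditive V]
    [Linear k V] {C : Type u₁} [Category.{v₁} C] (K : C ⥤ V) (L : V ⥤ C) (E : L ⋙ K ≅ 𝟭 V)
    (Q : V ⥤ V) [Q.Additive] [Q.Linear k]
    (R : ∀ x, K.obj x ⟶ Q.obj (K.obj x))
    (hR : ∀ {x y : C} (f : x ⟶ y), K.map f ≫ R y = R x ≫ Q.map (K.map f))
    {x : C} (E' : L.obj (K.obj x) ⟶ x) (c : kˣ)
    (hE : K.map E' = (c : k) • E.hom.app (K.obj x)) :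
    E.inv.app (K.obj x) ≫ R (L.obj (K.obj x)) ≫ Q.map (E.hom.app (K.obj x)) = R x := by
  have h1 : E.hom.app (K.obj x) = ((c⁻¹ : kˣ) : k) • K.map E' := by
    rw [hE, smul_smul]; simp
  have h2 : E.inv.app (K.obj x) ≫ K.map E' = (c : k) • 𝟙 (K.obj x) := by
    rw [hE, Linear.comp_smul, Iso.inv_hom_id_app]
    rfl
  rw [h1, Q.map_smul, Linear.comp_smul, Linear.comp_smul, ← hR, ← Category.assoc, h2,
    Linear.smul_comp, smul_smul]
  simp

end Equivalences

theorem eq_smul_inv_of_smul_eq {k : Type uk} [Field k] {M : Type u} [AddCommGroup M] [Module k M]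
    {c : kˣ} {x y : M} (h : x = (c : k) • y) : y = ((c⁻¹ : kˣ) : k) • x := by
  rw [h, smul_smul, ← Units.val_mul, inv_mul_cancel, Units.val_one, one_smul]

/-! ### Categorical characters of 2-representations -/

section TwoRep

variable {k : Type uk} [Field k] {G : Type uG} [Group G]
variable {V : Type u} [Category.{v} V] [Preadditive V] [Linear k V]
variable {ρ : TwoRep k G V} {α : G → G → G → kˣ}

/-- The component at `x` of `ψ : F a ∘ F b ≅ F c`. -/
def TwoRep.mulApp (ρ : TwoRep k G V) {a b c : G} (h : a * b = c) (x : V) :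
    (ρ.F a).obj ((ρ.F b).obj x) ≅ (ρ.F c).obj x :=
  (ρ.ψ h).app x

/-- The component at `x` of `ψe : F 1 ≅ 1`. -/
def TwoRep.oneApp (ρ : TwoRep k G V) {a : G} (h : a = 1) (x : V) : (ρ.F a).obj x ≅ x :=
  (ρ.ψe h).app x

theorem TwoRep.mulApp_naturality (ρ : TwoRep k G V) {a b c : G} (h : a * b = c) {x y : V}
    (f : x ⟶ y) : (ρ.F a).map ((ρ.F b).map f) ≫ (ρ.mulApp h y).hom =
      (ρ.mulApp h x).hom ≫ (ρ.F c).map f :=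
  (ρ.ψ h).hom.naturality f

theorem TwoRep.mulApp_inv_naturality (ρ : TwoRep k G V) {a b c : G} (h : a * b = c) {x y : V}
    (f : x ⟶ y) : (ρ.F c).map f ≫ (ρ.mulApp h y).inv =
      (ρ.mulApp h x).inv ≫ (ρ.F a).map ((ρ.F b).map f) :=
  (ρ.ψ h).inv.naturality f

theorem TwoRep.oneApp_naturality (ρ : TwoRep k G V) {a : G} (h : a = 1) {x y : V}
    (f : x ⟶ y) : (ρ.F a).map f ≫ (ρ.oneApp h y).hom = (ρ.oneApp h x).hom ≫ f :=
  (ρ.ψe h).hom.naturality f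

theorem TwoRep.tr_naturality (ρ : TwoRep k G V) {g : G} (φ : ρ.Tr g) {x y : V} (f : x ⟶ y) :
    f ≫ (φ.app y : y ⟶ (ρ.F g).obj y) = φ.app x ≫ (ρ.F g).map f :=
  φ.naturality f

theorem TwoRep.IsTwisted.mulApp_assoc (hρ : ρ.IsTwisted α) {c b a cb ba cba : G}
    (h₁ : c * b = cb) (h₂ : b * a = ba) (h₃ : cb * a = cba) (h₄ : c * ba = cba) (x : V) :
    (ρ.F c).map (ρ.mulApp h₂ x).hom ≫ (ρ.mulApp h₄ x).hom =
      (α c b a : k) • ((ρ.mulApp h₁ ((ρ.F a).obj x)).hom ≫ (ρ.mulApp h₃ x).hom) :=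
  (hρ.assoc h₁ h₂ h₃ h₄ x).symm

theorem TwoRep.IsTwisted.mulApp_one_left (hρ : ρ.IsTwisted α) {e a : G} (he : e = 1)
    (h : e * a = a) (x : V) : ρ.mulApp h x = ρ.oneApp he ((ρ.F a).obj x) :=
  Iso.ext (hρ.unit_left he h x)

theorem TwoRep.IsTwisted.mulApp_one_right (hρ : ρ.IsTwisted α) {e a : G} (he : e = 1)
    (h : a * e = a) (x : V) : ρ.mulApp h x = (ρ.F a).mapIso (ρ.oneApp he x) :=
  Iso.ext (hρ.unit_right he h x)

/-- The isomorphism `F s ∘ F s⁻¹ ≅ 1`. -/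
def TwoRep.cancelIso (ρ : TwoRep k G V) (s : G) : ρ.F s⁻¹ ⋙ ρ.F s ≅ 𝟭 V :=
  ρ.ψ (mul_inv_cancel s) ≪≫ ρ.ψe rfl

/-- The conjugation map on categorical traces is determined by a formula without inverse group
elements on the image of `F s`. -/
theorem TwoRep.IsTwisted.conj_app_obj (hρ : ρ.IsTwisted α) {g g' : G} (s : G)
    (h : s * g = g' * s) (φ : ρ.Tr g) (x : V) :
    (ρ.conj s h φ).app ((ρ.F s).obj x) =
      (ρ.F s).map (φ.app x) ≫ (ρ.mulApp h x).hom ≫ (ρ.mulApp rfl x).inv := by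
  have key := transport_app_obj (ρ.F s) (ρ.F s⁻¹) (ρ.cancelIso s) (ρ.F g')
    (fun x => (ρ.F s).map (φ.app x) ≫ (ρ.mulApp h x).hom ≫ (ρ.mulApp rfl x).inv)
    (fun {x y} f => by
      simp only [Category.assoc]
      rw [← ρ.mulApp_inv_naturality, ← Functor.map_comp_assoc, ρ.tr_naturality,
        Functor.map_comp_assoc, reassoc_of% ρ.mulApp_naturality h f])
    -- The two ways to contract `F s ∘ F s⁻¹ ∘ F s` to `F s` differ by `α s s⁻¹ s`.
    (x := x) ((ρ.mulApp (inv_mul_cancel s) x).hom ≫ (ρ.oneApp rfl x).hom) (α s s⁻¹ s) (by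
      have h1 := hρ.mulApp_assoc (mul_inv_cancel s) (inv_mul_cancel s) (one_mul s) (mul_one s) x
      rw [hρ.mulApp_one_left rfl (one_mul s), hρ.mulApp_one_right rfl (mul_one s)] at h1
      exact ((ρ.F s).map_comp _ _).trans h1)
  rw [← key]
  simp [TwoRep.conj, TwoRep.cancelIso]
  rfl

/-- Elements of the trace that agree on the image of `F s` are equal, as `F s` is an
equivalence. -/
theorem TwoRep.tr_ext (ρ : TwoRep k G V) (s : G) {g : G} {φ φ' : ρ.Tr g}
    (h : ∀ x, φ.app ((ρ.F s).obj x) = φ'.app ((ρ.F s).obj x)) : φ = φ' :=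
  hom_ext_of_section (ρ.F s) (ρ.F s⁻¹) (ρ.cancelIso s) h

/-- The conjugation maps compose up to the transgression of `α`: the three values of `α` come from
the coherence laws for `(t, s, g)`, `(g'', t, s)` and `(t, g', s)`. -/
theorem TwoRep.IsTwisted.conj_conj (hρ : ρ.IsTwisted α) {g g' g'' : G} {s t ts : G}
    (hts : t * s = ts) (hs : s * g = g' * s) (ht : t * g' = g'' * t) (h : ts * g = g'' * ts)
    (φ : ρ.Tr g) :
    ρ.conj t ht (ρ.conj s hs φ) =
      ((α t s g * α g'' t s / α t g' s : kˣ) : k) • ρ.conj ts h φ := by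
  refine ρ.tr_ext ts fun x => ?_
  have e1 : t * (g' * s) = g'' * ts := by rw [← mul_assoc, ht, mul_assoc, hts]
  have e2 : g'' * t * s = g'' * ts := by rw [mul_assoc, hts]
  have n1 := ρ.mulApp_naturality hts (φ.app x)
  have b1 := eq_smul_inv_of_smul_eq (hρ.mulApp_assoc hts hs h e1 x)
  have b2 := hρ.mulApp_assoc (c := g'') (b := t) (a := s) rfl hts e2 rfl x
  have b3 := eq_smul_inv_of_smul_eq (hρ.mulApp_assoc ht rfl e2 e1 x)
  rw [← cancel_epi (ρ.mulApp hts x).hom, ρ.tr_naturality, hρ.conj_app_obj, hρ.conj_app_obj,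
    ← cancel_mono (ρ.mulApp rfl x).hom]
  simp only [NatTrans.app_smul, hρ.conj_app_obj, Category.assoc, Linear.comp_smul,
    Linear.smul_comp, b2, Functor.map_comp, Iso.inv_hom_id, Iso.inv_hom_id_assoc,
    Iso.map_inv_hom_id_assoc, Category.comp_id,
    b3, ← reassoc_of% n1, b1, smul_smul]
  congr 1
  push_cast
  field_simp

theorem TwoRep.IsTwisted.conj_one (hρ : ρ.IsTwisted α) {g : G} {s : G} (hs : s = 1)
    (h : s * g = g * s) (φ : ρ.Tr g) : ρ.conj s h φ = φ := by
  refine ρ.tr_ext s fun x => ?_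
  have key (c : G) (hc : c = g) (h₁ : s * g = c) (h₂ : g * s = c) :
      (ρ.F s).map (φ.app x) ≫ (ρ.mulApp h₁ x).hom ≫ (ρ.mulApp h₂ x).inv =
        φ.app ((ρ.F s).obj x) := by
    subst hc
    rw [hρ.mulApp_one_left hs h₁, hρ.mulApp_one_right hs h₂, Functor.mapIso_inv,
      reassoc_of% ρ.oneApp_naturality hs (φ.app x)]
    simp only [Functor.id_obj]
    rw [← ρ.tr_naturality, Iso.hom_inv_id_assoc]
  rw [hρ.conj_app_obj]
  exact key _ (by rw [hs, mul_one]) h rfl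

theorem TwoRep.IsTwisted.character_isTwisted (hρ : ρ.IsTwisted α) (θ : Twisting k (Loop G))
    (hθ : ∀ {x y z : Loop G} (f : x ⟶ y) (g : y ⟶ z), θ.val f g =
      α g.1 f.1 x.elt * α z.elt g.1 f.1 / α g.1 y.elt f.1) :
    ρ.character.IsTwisted θ where
  map_id x := LinearMap.ext fun φ => hρ.conj_one rfl _ φ
  map_map f g := LinearMap.ext fun φ => by
    rw [hθ f g]
    exact hρ.conj_conj rfl f.2 g.2 (f ≫ g).2 φ

end TwoRep

/-! ### Real categorical characters of Real 2-representations -/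

section Contract

variable {k : Type uk} [Field k] {G : Type uG} [Group G]
variable {V : Type u} [Category.{v} V] [Preadditive V] [Linear k V]
variable {ρ : TwoRep k G V} {α : G → G → G → kˣ}

theorem TwoRep.contract_eq (ρ : TwoRep k G V) (g : G) (φ : ρ.Tr g) (x : V) :
    ρ.contract g φ x = (ρ.F g⁻¹).map (φ.app x) ≫
      (ρ.mulApp (inv_mul_cancel g) x).hom ≫ (ρ.oneApp rfl x).hom := rfl

/-- The contraction of a conjugate is the conjugate of the contraction, up to a scalar. -/
theorem TwoRep.IsTwisted.contract_conj (hρ : ρ.IsTwisted α) {g g' s d : G} (h : s * g = g' * s)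
    (h₁ : g'⁻¹ * s = d) (h₂ : s * g⁻¹ = d) (φ : ρ.Tr g) (x : V) :
    ρ.contract g' (ρ.conj s h φ) ((ρ.F s).obj x) =
      ((α g'⁻¹ s g / (α g'⁻¹ g' s * α s g⁻¹ g) : kˣ) : k) •
        ((ρ.mulApp h₁ x).hom ≫ (ρ.mulApp h₂ x).inv ≫ (ρ.F s).map (ρ.contract g φ x)) := by
  have e1 : g'⁻¹ * (g' * s) = s := by simp
  have e2 : d * g = s := by simp [← h₂]
  have a1 := hρ.mulApp_assoc h₁ h e2 e1 x
  have a2 := eq_smul_inv_of_smul_eq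
    (hρ.mulApp_assoc (inv_mul_cancel g') rfl (one_mul s) e1 x)
  have a3 := hρ.mulApp_assoc h₂ (inv_mul_cancel g) e2 (mul_one s) x
  have n1 := ρ.mulApp_naturality h₁ (φ.app x)
  have n2 := ρ.mulApp_inv_naturality h₂ (φ.app x)
  simp only [Functor.id_obj] at n1 n2
  rw [hρ.mulApp_one_left rfl (one_mul s)] at a2
  rw [hρ.mulApp_one_right rfl (mul_one s), Functor.mapIso_hom] at a3
  rw [contract_eq, contract_eq, hρ.conj_app_obj]
  simp only [Functor.map_comp, Category.assoc, a2, a3, ← reassoc_of% n1, ← reassoc_of% n2,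
    Iso.map_inv_hom_id_assoc, Linear.comp_smul, Iso.inv_hom_id_assoc, a1, smul_smul]
  congr 1
  push_cast
  field_simp

end Contract

section OpFunctor

variable {C : Type u₁} [Category.{v₁} C] {D : Type u₂} [Category.{v₂} D] (F : Cᵒᵖ ⥤ D)

theorem map_op_hom_inv_assoc {x y : C} (e : x ≅ y) {z : D} (f : F.obj (op y) ⟶ z) :
    F.map e.hom.op ≫ F.map e.inv.op ≫ f = f := by
  rw [← Functor.map_comp_assoc, ← op_comp, e.inv_hom_id, op_id, CategoryTheory.Functor.map_id,
    Category.id_comp]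

end OpFunctor

section RealTwoRep

variable {Γ : Type uG} [Group Γ] {k : Type uk} [Field k] {π : Γ →* ℤˣ}
variable {V : Type u} [Category.{v} V] [Preadditive V] [Linear k V]
variable {ρ : RealTwoRep k π V} {α : Γ → Γ → Γ → kˣ}

/-- The component at `x` of `ψ : F a ∘ F b ≅ F c` for `b` of degree `-1`. -/
def RealTwoRep.pmApp (ρ : RealTwoRep k π V) {a : π.ker} {b c : OddElt π} (h : (a : Γ) * b = c)
    (x : V) : (ρ.F a).obj ((ρ.Fm b).obj (op x)) ≅ (ρ.Fm c).obj (op x) :=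
  (ρ.ψpm h).app (op x)

/-- The component at `x` of `ψ : F a ∘ F b ≅ F c` for `a` of degree `-1`. -/
def RealTwoRep.mpApp (ρ : RealTwoRep k π V) {a : OddElt π} {b : π.ker} {c : OddElt π}
    (h : (a : Γ) * b = c) (x : V) :
    (ρ.Fm a).obj (op ((ρ.F b).obj x)) ≅ (ρ.Fm c).obj (op x) :=
  (ρ.ψmp h).app (op x)

/-- The component at `x` of `ψ : F a ∘ F b ≅ F c` for `a` and `b` of degree `-1`. -/
def RealTwoRep.mmApp (ρ : RealTwoRep k π V) {a b : OddElt π} {c : π.ker} (h : (a : Γ) * b = c)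
    (x : V) : (ρ.Fm a).obj (op ((ρ.Fm b).obj (op x))) ≅ (ρ.F c).obj x :=
  (ρ.ψmm h).app x

theorem RealTwoRep.pmApp_naturality (ρ : RealTwoRep k π V) {a : π.ker} {b c : OddElt π}
    (h : (a : Γ) * b = c) {x y : V} (f : x ⟶ y) :
    (ρ.F a).map ((ρ.Fm b).map f.op) ≫ (ρ.pmApp h x).hom =
      (ρ.pmApp h y).hom ≫ (ρ.Fm c).map f.op :=
  (ρ.ψpm h).hom.naturality f.op

theorem RealTwoRep.pmApp_inv_naturality (ρ : RealTwoRep k π V) {a : π.ker} {b c : OddElt π}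
    (h : (a : Γ) * b = c) {x y : V} (f : x ⟶ y) :
    (ρ.Fm c).map f.op ≫ (ρ.pmApp h x).inv =
      (ρ.pmApp h y).inv ≫ (ρ.F a).map ((ρ.Fm b).map f.op) :=
  (ρ.ψpm h).inv.naturality f.op

theorem RealTwoRep.mpApp_naturality (ρ : RealTwoRep k π V) {a : OddElt π} {b : π.ker}
    {c : OddElt π} (h : (a : Γ) * b = c) {x y : V} (f : x ⟶ y) :
    (ρ.Fm a).map ((ρ.F b).map f).op ≫ (ρ.mpApp h x).hom =
      (ρ.mpApp h y).hom ≫ (ρ.Fm c).map f.op :=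
  (ρ.ψmp h).hom.naturality f.op

theorem RealTwoRep.mmApp_naturality (ρ : RealTwoRep k π V) {a b : OddElt π} {c : π.ker}
    (h : (a : Γ) * b = c) {x y : V} (f : x ⟶ y) :
    (ρ.Fm a).map ((ρ.Fm b).map f.op).op ≫ (ρ.mmApp h y).hom =
      (ρ.mmApp h x).hom ≫ (ρ.F c).map f :=
  (ρ.ψmm h).hom.naturality f

/-! The coherence laws, solved for the composite with the image of a coherence isomorphism. -/

namespace RealTwoRep.IsTwisted

theorem ppm' (hρ : ρ.IsTwisted α) {c b cb : π.ker} {a ba cba : OddElt π} (h₁ : c * b = cb)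
    (h₂ : (b : Γ) * a = ba) (h₃ : (cb : Γ) * a = cba) (h₄ : (c : Γ) * ba = cba) (x : V) :
    (ρ.F c).map (ρ.pmApp h₂ x).hom ≫ (ρ.pmApp h₄ x).hom =
      (α c b a : k) • ((ρ.mulApp h₁ ((ρ.Fm a).obj (op x))).hom ≫ (ρ.pmApp h₃ x).hom) :=
  (hρ.ppm h₁ h₂ h₃ h₄ x).symm

theorem pmp' (hρ : ρ.IsTwisted α) {c a : π.ker} {b cb ba cba : OddElt π}
    (h₁ : (c : Γ) * b = cb) (h₂ : (b : Γ) * a = ba) (h₃ : (cb : Γ) * a = cba)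
    (h₄ : (c : Γ) * ba = cba) (x : V) :
    (ρ.F c).map (ρ.mpApp h₂ x).hom ≫ (ρ.pmApp h₄ x).hom =
      (α c b a : k) • ((ρ.pmApp h₁ ((ρ.F a).obj x)).hom ≫ (ρ.mpApp h₃ x).hom) :=
  (hρ.pmp h₁ h₂ h₃ h₄ x).symm

theorem pmm' (hρ : ρ.IsTwisted α) {c ba cba : π.ker} {b a cb : OddElt π}
    (h₁ : (c : Γ) * b = cb) (h₂ : (b : Γ) * a = ba) (h₃ : (cb : Γ) * a = cba)
    (h₄ : c * ba = cba) (x : V) :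
    (ρ.F c).map (ρ.mmApp h₂ x).hom ≫ (ρ.mulApp h₄ x).hom =
      (α c b a : k) • ((ρ.pmApp h₁ ((ρ.Fm a).obj (op x))).hom ≫ (ρ.mmApp h₃ x).hom) :=
  (hρ.pmm h₁ h₂ h₃ h₄ x).symm

theorem mpp' (hρ : ρ.IsTwisted α) {b a ba : π.ker} {c cb cba : OddElt π}
    (h₁ : (c : Γ) * b = cb) (h₂ : b * a = ba) (h₃ : (cb : Γ) * a = cba)
    (h₄ : (c : Γ) * ba = cba) (x : V) :
    (ρ.Fm c).map (ρ.mulApp h₂ x).inv.op ≫ (ρ.mpApp h₄ x).hom =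
      (α c b a : k) • ((ρ.mpApp h₁ ((ρ.F a).obj x)).hom ≫ (ρ.mpApp h₃ x).hom) :=
  (hρ.mpp h₁ h₂ h₃ h₄ x).symm

theorem mpm' (hρ : ρ.IsTwisted α) {b cba : π.ker} {c a cb ba : OddElt π}
    (h₁ : (c : Γ) * b = cb) (h₂ : (b : Γ) * a = ba) (h₃ : (cb : Γ) * a = cba)
    (h₄ : (c : Γ) * ba = cba) (x : V) :
    (ρ.Fm c).map (ρ.pmApp h₂ x).inv.op ≫ (ρ.mmApp h₄ x).hom =
      (α c b a : k) • ((ρ.mpApp h₁ ((ρ.Fm a).obj (op x))).hom ≫ (ρ.mmApp h₃ x).hom) :=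
  (hρ.mpm h₁ h₂ h₃ h₄ x).symm

theorem mmp' (hρ : ρ.IsTwisted α) {a cb cba : π.ker} {c b ba : OddElt π}
    (h₁ : (c : Γ) * b = cb) (h₂ : (b : Γ) * a = ba) (h₃ : cb * a = cba)
    (h₄ : (c : Γ) * ba = cba) (x : V) :
    (ρ.Fm c).map (ρ.mpApp h₂ x).inv.op ≫ (ρ.mmApp h₄ x).hom =
      (α c b a : k) • ((ρ.mmApp h₁ ((ρ.F a).obj x)).hom ≫ (ρ.mulApp h₃ x).hom) :=
  (hρ.mmp h₁ h₂ h₃ h₄ x).symm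

theorem mmm' (hρ : ρ.IsTwisted α) {cb ba : π.ker} {c b a cba : OddElt π}
    (h₁ : (c : Γ) * b = cb) (h₂ : (b : Γ) * a = ba) (h₃ : (cb : Γ) * a = cba)
    (h₄ : (c : Γ) * ba = cba) (x : V) :
    (ρ.Fm c).map (ρ.mmApp h₂ x).inv.op ≫ (ρ.mpApp h₄ x).hom =
      (α c b a : k) • ((ρ.mmApp h₁ ((ρ.Fm a).obj (op x))).hom ≫ (ρ.pmApp h₃ x).hom) :=
  (hρ.mmm h₁ h₂ h₃ h₄ x).symm

theorem unit_pm' (hρ : ρ.IsTwisted α) {e : π.ker} {a : OddElt π} (he : e = 1)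
    (h : (e : Γ) * a = a) (x : V) : ρ.pmApp h x = ρ.oneApp he ((ρ.Fm a).obj (op x)) :=
  Iso.ext (hρ.unit_pm he h x)

theorem unit_mp' (hρ : ρ.IsTwisted α) {e : π.ker} {a : OddElt π} (he : e = 1)
    (h : (a : Γ) * e = a) (x : V) : ρ.mpApp h x = (ρ.Fm a).mapIso (ρ.oneApp he x).symm.op :=
  Iso.ext (hρ.unit_mp he h x)

end RealTwoRep.IsTwisted

/-- The isomorphism `F ω ∘ F ω⁻¹ ≅ 1` for `ω` of degree `-1`. -/
def RealTwoRep.cancelIso (ρ : RealTwoRep k π V) (ω : OddElt π) :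
    (ρ.Fm ω.inv).rightOp ⋙ ρ.Fm ω ≅ 𝟭 V :=
  ρ.ψmm (a := ω) (b := ω.inv) (c := 1) (mul_inv_cancel (ω : Γ)) ≪≫ ρ.ψe rfl

theorem RealTwoRep.tr_ext (ρ : RealTwoRep k π V) (ω : OddElt π) {g : π.ker}
    {φ φ' : ρ.toTwoRep.Tr g}
    (h : ∀ x : V, φ.app ((ρ.Fm ω).obj (op x)) = φ'.app ((ρ.Fm ω).obj (op x))) : φ = φ' :=
  hom_ext_of_section (ρ.Fm ω) (ρ.Fm ω.inv).rightOp (ρ.cancelIso ω) fun x => h x.unop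

/-- The conjugation map of an element `ω` of degree `-1` is determined by a formula without
`ω⁻¹` on the image of `F ω`. -/
theorem RealTwoRep.IsTwisted.conjOdd_app_obj (hρ : ρ.IsTwisted α) {g g' : π.ker} (ω : OddElt π)
    (h : (ω : Γ) * (g : Γ)⁻¹ = g' * ω) {d : OddElt π} (h₁ : (ω : Γ) * (g⁻¹ : π.ker) = d)
    (h₂ : (g' : Γ) * ω = d) (φ : ρ.toTwoRep.Tr g) (x : V) :
    (ρ.conjOdd ω h φ).app ((ρ.Fm ω).obj (op x)) =
      (ρ.Fm ω).map (ρ.contract g φ x).op ≫ (ρ.mpApp h₁ x).hom ≫ (ρ.pmApp h₂ x).inv := by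
  obtain rfl : ω.mulKer g⁻¹ = d := Subtype.ext h₁
  have hω : (ω : Γ) * ω.inv = (1 : π.ker) := mul_inv_cancel (ω : Γ)
  have hω' : (ω.inv : Γ) * ω = (1 : π.ker) := inv_mul_cancel (ω : Γ)
  have key := transport_app_obj (ρ.Fm ω) (ρ.Fm ω.inv).rightOp (ρ.cancelIso ω) (ρ.F g')
    (fun x => (ρ.Fm ω).map (ρ.contract g φ x.unop).op ≫ (ρ.mpApp h₁ x.unop).hom ≫
      (ρ.pmApp h₂ x.unop).inv)
    (fun {x y} f => by
      simp only [Category.assoc]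
      rw [← f.op_unop, ← ρ.pmApp_inv_naturality, ← Functor.map_comp_assoc, ← op_comp,
        ← ρ.contract_naturality, op_comp, Functor.map_comp_assoc,
        reassoc_of% ρ.mpApp_naturality h₁ f.unop])
    -- The two ways to contract `F ω ∘ F ω⁻¹ ∘ F ω` to `F ω` differ by `α ω ω⁻¹ ω`.
    (x := op x) ((ρ.oneApp rfl x).inv ≫ (ρ.mmApp hω' x).inv).op (α ω ω.inv ω) (by
      have e1 : ((1 : π.ker) : Γ) * ω = ω := one_mul (ω : Γ)
      have e2 : (ω : Γ) * (1 : π.ker) = ω := mul_one (ω : Γ)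
      have h1 := hρ.mmm' hω hω' e1 e2 x
      rw [hρ.unit_pm' rfl e1, hρ.unit_mp' rfl e2] at h1
      rw [op_comp, Functor.map_comp]
      exact h1)
  rw [← key]
  simp [RealTwoRep.conjOdd, RealTwoRep.cancelIso]
  rfl

/-- For `ω` of degree `-1`, the contraction of the conjugate of `φ` is the image of `φ` itself under
the contravariant functor `F ω`, up to a scalar. -/
theorem RealTwoRep.IsTwisted.contract_conjOdd (hρ : ρ.IsTwisted α) {g g' : π.ker} {ω : OddElt π}
    (h : (ω : Γ) * (g : Γ)⁻¹ = g' * ω) {d : OddElt π} (h₁ : ((g'⁻¹ : π.ker) : Γ) * ω = d)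
    (h₂ : (ω : Γ) * g = d) (φ : ρ.toTwoRep.Tr g) (x : V) :
    ρ.contract g' (ρ.conjOdd ω h φ) ((ρ.Fm ω).obj (op x)) =
      (((α ω (g : Γ)⁻¹ g * α (g' : Γ)⁻¹ g' ω * α (g' : Γ)⁻¹ (ω * (g : Γ)⁻¹) g)⁻¹ : kˣ) : k) •
        ((ρ.pmApp h₁ x).hom ≫ (ρ.mpApp h₂ x).inv ≫ (ρ.Fm ω).map (φ.app x).op) := by
  have f1 : (ω : Γ) * (g⁻¹ : π.ker) = ω.mulKer g⁻¹ := rfl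
  have f2 : (g' : Γ) * ω = ω.mulKer g⁻¹ := h.symm
  have f3 : ((ω.mulKer g⁻¹ : OddElt π) : Γ) * g = ω := by simp [OddElt.mulKer]
  have f4 : ((g'⁻¹ : π.ker) : Γ) * (ω.mulKer g⁻¹ : OddElt π) = ω := by simp [← f2]
  have u1 : (ω : Γ) * (1 : π.ker) = ω := mul_one (ω : Γ)
  have u2 : ((1 : π.ker) : Γ) * ω = ω := one_mul (ω : Γ)
  have a1 := hρ.mpp' f1 (inv_mul_cancel g) f3 u1 x
  have a2 := hρ.ppm' (inv_mul_cancel g') f2 u2 f4 ((ρ.F g).obj x)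
  have a3 := hρ.pmp' f4 f3 h₂ h₁ x
  rw [hρ.unit_mp' rfl u1] at a1
  rw [hρ.unit_pm' rfl u2] at a2
  have b1 : (ρ.Fm ω).map (ρ.oneApp rfl x).hom.op ≫
      (ρ.Fm ω).map (ρ.mulApp (inv_mul_cancel g) x).hom.op ≫ (ρ.mpApp f1 ((ρ.F g).obj x)).hom =
      (((α ω (g : Γ)⁻¹ g)⁻¹ : kˣ) : k) • (ρ.mpApp f3 x).inv := by
    have h := eq_smul_inv_of_smul_eq a1
    rw [← cancel_mono (ρ.mpApp f3 x).hom]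
    simp only [Category.assoc, Linear.smul_comp, Iso.inv_hom_id]
    erw [h]
    simp only [Linear.comp_smul, ← op_comp, Iso.inv_hom_id, op_id, Category.id_comp,
      ← Functor.map_comp, Functor.mapIso_hom, Iso.op_hom, Iso.symm_hom, Category.assoc]
    rw [CategoryTheory.Functor.map_id]
    rfl
  have b2 : (ρ.F g'⁻¹).map (ρ.pmApp f2 ((ρ.F g).obj x)).inv ≫
      (ρ.mulApp (inv_mul_cancel g') ((ρ.Fm ω).obj (op ((ρ.F g).obj x)))).hom ≫
      (ρ.oneApp rfl ((ρ.Fm ω).obj (op ((ρ.F g).obj x)))).hom =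
      (((α (g' : Γ)⁻¹ g' ω)⁻¹ : kˣ) : k) • (ρ.pmApp f4 ((ρ.F g).obj x)).hom := by
    have h := eq_smul_inv_of_smul_eq a2
    erw [h]
    simp
  have b3 : (ρ.F g'⁻¹).map (ρ.mpApp f3 x).inv ≫ (ρ.pmApp f4 ((ρ.F g).obj x)).hom =
      (((α (g' : Γ)⁻¹ (ω * (g : Γ)⁻¹) g)⁻¹ : kˣ) : k) •
        ((ρ.pmApp h₁ x).hom ≫ (ρ.mpApp h₂ x).inv) := by
    have h := eq_smul_inv_of_smul_eq a3
    rw [← cancel_mono (ρ.mpApp h₂ x).hom]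
    simp only [Category.assoc, Linear.smul_comp, Iso.inv_hom_id]
    erw [h]
    simp
    rfl
  -- Move `φ` to the right end by naturality; the coherence isomorphisms in front of it are then
  -- contracted by `b1`, `b2` and `b3`.
  have n1 := ρ.mpApp_naturality f1 (φ.app x)
  have n2 := ρ.pmApp_inv_naturality f2 (φ.app x)
  have n3 := ρ.mulApp_naturality (inv_mul_cancel g') ((ρ.Fm ω).map (φ.app x).op)
  have n4 := ρ.oneApp_naturality rfl ((ρ.Fm ω).map (φ.app x).op)
  simp only [Functor.id_obj] at n1 n2 n3 n4
  rw [ρ.contract_eq, hρ.conjOdd_app_obj ω h f1 f2, ρ.contract_eq]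
  simp only [op_comp, Functor.map_comp, Category.assoc, reassoc_of% n1, n2, reassoc_of% n3, n4]
  rw [← Functor.map_comp_assoc, ← Functor.map_comp_assoc, Category.assoc, b1, Functor.map_smul,
    Linear.smul_comp, reassoc_of% b2, Linear.smul_comp, Linear.comp_smul, reassoc_of% b3,
    Linear.smul_comp, smul_smul, smul_smul, Category.assoc]
  congr 1
  push_cast
  field_simp

/-! Composites of conjugation maps, according to the degrees of the two elements. As the conjugation
map of an element of degree `-1` sees `φ` only through its contraction, it is the contraction of a
conjugate that has to be computed when the second element has degree `-1`. -/

theorem RealTwoRep.IsTwisted.conj_conjOdd (hρ : ρ.IsTwisted α) {g g' g'' t : π.ker}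
    {s ts : OddElt π} (hts : (t : Γ) * s = ts) (hs : (s : Γ) * (g : Γ)⁻¹ = g' * s)
    (ht : t * g' = g'' * t) (h : (ts : Γ) * (g : Γ)⁻¹ = g'' * ts) (φ : ρ.toTwoRep.Tr g) :
    ρ.conj t ht (ρ.conjOdd s hs φ) =
      ((α t s (g : Γ)⁻¹ * α g'' t s / α t g' s : kˣ) : k) • ρ.conjOdd ts h φ := by
  refine ρ.tr_ext ts fun x => ?_
  have f1 : (s : Γ) * (g⁻¹ : π.ker) = s.mulKer g⁻¹ := rfl
  have f2 : (g' : Γ) * s = s.mulKer g⁻¹ := hs.symm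
  have e1 : (ts : Γ) * (g⁻¹ : π.ker) = ts.mulKer g⁻¹ := rfl
  have e2 : (g'' : Γ) * ts = ts.mulKer g⁻¹ := h.symm
  have e3 : (t : Γ) * (s.mulKer g⁻¹ : OddElt π) = ts.mulKer g⁻¹ := by
    rw [← e1, ← f1, ← mul_assoc, hts]
  have e4 : ((g'' * t : π.ker) : Γ) * s = ts.mulKer g⁻¹ := by
    rw [← e2, ← hts, ← mul_assoc]; rfl
  have n1 := ρ.pmApp_naturality hts (ρ.contract g φ x)
  have b1 := eq_smul_inv_of_smul_eq (hρ.pmp' hts f1 e1 e3 x)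
  have b2 := hρ.ppm' (c := g'') (b := t) rfl hts e4 e2 x
  have b3 := eq_smul_inv_of_smul_eq (hρ.ppm' ht f2 e4 e3 x)
  rw [← cancel_epi (ρ.pmApp hts x).hom, ρ.tr_naturality, hρ.ppp.conj_app_obj,
    hρ.conjOdd_app_obj s hs f1 f2, ← cancel_mono (ρ.pmApp e2 x).hom]
  simp only [NatTrans.app_smul, hρ.conjOdd_app_obj ts h e1 e2, Category.assoc, Linear.comp_smul,
    Linear.smul_comp, b2, Functor.map_comp, Iso.inv_hom_id, Iso.inv_hom_id_assoc,
    Iso.map_inv_hom_id_assoc, Category.comp_id,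
    b3, ← reassoc_of% n1, b1, smul_smul]
  congr 1
  push_cast
  field_simp

theorem RealTwoRep.IsTwisted.conjOdd_conj (hρ : ρ.IsTwisted α) {g g' g'' s : π.ker}
    {t ts : OddElt π} (hts : (t : Γ) * s = ts) (hs : s * g = g' * s)
    (ht : (t : Γ) * (g' : Γ)⁻¹ = g'' * t) (h : (ts : Γ) * (g : Γ)⁻¹ = g'' * ts)
    (φ : ρ.toTwoRep.Tr g) :
    ρ.conjOdd t ht (ρ.conj s hs φ) =
      ((α (g' : Γ)⁻¹ s g / (α (g' : Γ)⁻¹ g' s * α s (g : Γ)⁻¹ g) *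
        (α t s (g : Γ)⁻¹ * α g'' t s / α t (g' : Γ)⁻¹ s) : kˣ) : k) • ρ.conjOdd ts h φ := by
  refine ρ.tr_ext ts fun x => ?_
  have f2 : g'⁻¹ * s = s * g⁻¹ := by
    rw [inv_mul_eq_iff_eq_mul, ← mul_assoc, ← hs, mul_inv_cancel_right]
  have d1 : (t : Γ) * (g'⁻¹ : π.ker) = t.mulKer g'⁻¹ := rfl
  have d2 : (g'' : Γ) * t = t.mulKer g'⁻¹ := ht.symm
  have e1 : (ts : Γ) * (g⁻¹ : π.ker) = ts.mulKer g⁻¹ := rfl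
  have e2 : (g'' : Γ) * ts = ts.mulKer g⁻¹ := h.symm
  have e3 : (t : Γ) * (s * g⁻¹ : π.ker) = ts.mulKer g⁻¹ := by
    rw [← e1, ← hts, mul_assoc]; rfl
  have e4 : ((t.mulKer g'⁻¹ : OddElt π) : Γ) * s = ts.mulKer g⁻¹ := by
    rw [← e2, ← hts, ← mul_assoc, d2]
  have n1 := ρ.mpApp_naturality hts (ρ.contract g φ x)
  have b1 := eq_smul_inv_of_smul_eq (hρ.mpp' hts rfl e1 e3 x)
  have b2 := hρ.pmp' d2 hts e4 e2 x
  have b3 := eq_smul_inv_of_smul_eq (hρ.mpp' d1 f2 e4 e3 x)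
  rw [← cancel_epi (ρ.mpApp hts x).hom, ρ.tr_naturality,
    hρ.conjOdd_app_obj t ht d1 d2, hρ.ppp.contract_conj hs f2 rfl, ← cancel_mono (ρ.pmApp e2 x).hom]
  simp only [NatTrans.app_smul, hρ.conjOdd_app_obj ts h e1 e2, Category.assoc, Linear.comp_smul,
    Linear.smul_comp, b2, Functor.map_comp, Iso.inv_hom_id, Iso.inv_hom_id_assoc,
    Category.comp_id, op_comp, op_smul_hom, Functor.map_smul,
    b3, ← reassoc_of% n1, b1, smul_smul, map_op_hom_inv_assoc]
  congr 1
  push_cast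
  field_simp

theorem RealTwoRep.IsTwisted.conjOdd_conjOdd (hρ : ρ.IsTwisted α) {g g' g'' ts : π.ker}
    {t s : OddElt π} (hts : (t : Γ) * s = ts) (hs : (s : Γ) * (g : Γ)⁻¹ = g' * s)
    (ht : (t : Γ) * (g' : Γ)⁻¹ = g'' * t) (h : ts * g = g'' * ts) (φ : ρ.toTwoRep.Tr g) :
    ρ.conjOdd t ht (ρ.conjOdd s hs φ) =
      (((α s (g : Γ)⁻¹ g * α (g' : Γ)⁻¹ g' s * α (g' : Γ)⁻¹ (s * (g : Γ)⁻¹) g)⁻¹ *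
        (α t s g * α g'' t s / α t (g' : Γ)⁻¹ s) : kˣ) : k) • ρ.conj ts h φ := by
  refine ρ.toTwoRep.tr_ext ts fun x => ?_
  have f1 : (s : Γ) * g = s.mulKer g := rfl
  have f2 : ((g'⁻¹ : π.ker) : Γ) * s = s.mulKer g := by
    rw [← f1, Subgroup.coe_inv, inv_mul_eq_iff_eq_mul, ← mul_assoc, ← hs, inv_mul_cancel_right]
  have d1 : (t : Γ) * (g'⁻¹ : π.ker) = t.mulKer g'⁻¹ := rfl
  have d2 : (g'' : Γ) * t = t.mulKer g'⁻¹ := ht.symm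
  have e3 : (t : Γ) * (s.mulKer g : OddElt π) = (g'' * ts : π.ker) := by
    rw [← h, ← f1, ← mul_assoc, hts]; rfl
  have e4 : ((t.mulKer g'⁻¹ : OddElt π) : Γ) * s = (g'' * ts : π.ker) := by
    rw [← d2, mul_assoc, hts]; rfl
  have n1 := ρ.mmApp_naturality hts (φ.app x)
  have b1 := eq_smul_inv_of_smul_eq (hρ.mmp' hts f1 h e3 x)
  have b2 := hρ.pmm' d2 hts e4 rfl x
  have b3 := eq_smul_inv_of_smul_eq (hρ.mpm' d1 f2 e4 e3 x)
  rw [← cancel_epi (ρ.mmApp hts x).hom, ρ.toTwoRep.tr_naturality,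
    hρ.conjOdd_app_obj t ht d1 d2, hρ.contract_conjOdd hs f2 f1, ← cancel_mono (ρ.mulApp rfl x).hom]
  simp only [NatTrans.app_smul, hρ.ppp.conj_app_obj, Category.assoc, Linear.comp_smul,
    Linear.smul_comp, b2, Functor.map_comp, Iso.inv_hom_id, Iso.inv_hom_id_assoc,
    Category.comp_id, op_comp, op_smul_hom, Functor.map_smul,
    b3, ← reassoc_of% n1, b1, smul_smul, map_op_hom_inv_assoc]
  congr 1
  push_cast
  field_simp

theorem RealTwoRep.character_map_of_even (ρ : RealTwoRep k π V) {x y : UnorientedLoop π}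
    (ω : x ⟶ y) {s : π.ker} (hs : (s : Γ) = ω.1) (h : s * x.elt = y.elt * s) :
    ρ.character.map ω = ρ.conj s h := by
  have h' : π ω.1 = 1 := by rw [← hs]; exact s.2
  obtain rfl : (⟨ω.1, h'⟩ : π.ker) = s := Subtype.ext hs.symm
  exact dif_pos h'

theorem RealTwoRep.character_map_of_odd (ρ : RealTwoRep k π V) {x y : UnorientedLoop π}
    (ω : x ⟶ y) {s : OddElt π} (hs : (s : Γ) = ω.1)
    (h : (s : Γ) * (x.elt : Γ)⁻¹ = y.elt * s) :
    ρ.character.map ω = ρ.conjOdd s h := by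
  have h' : π ω.1 = -1 := by rw [← hs]; exact s.2
  obtain rfl : (⟨ω.1, h'⟩ : OddElt π) = s := Subtype.ext hs.symm
  exact dif_neg (by rw [h']; decide)

/-- The scalar that arises from `contract_conjOdd` is the one in the definition of `tauRef`, by two
instances of the cocycle identity. -/
theorem IsTwistedCocycle.odd_contract_scalar (hα : IsTwistedCocycle π α) {s g g' : Γ}
    (hs : π s = -1) (h : s * g⁻¹ = g' * s) (hg : π g' = 1) :
    (α s g⁻¹ g * α g'⁻¹ g' s * α g'⁻¹ (s * g⁻¹) g)⁻¹ =
      α g g⁻¹ g * (α g'⁻¹ g' s * α s g g⁻¹ / α g'⁻¹ s g⁻¹)⁻¹ := by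
  have h1 := hα.cocycle s g g⁻¹ g
  have h2 := hα.cocycle g'⁻¹ s g⁻¹ g
  have e : g'⁻¹ * s = s * g := by
    rw [inv_mul_eq_iff_eq_mul, ← mul_assoc, ← h, inv_mul_cancel_right]
  simp [hs, hg, e, hα.one_mid, hα.one_right] at h1 h2
  rw [h1] at h2
  have h3 : α s g g⁻¹ = α g g⁻¹ g * (α s g⁻¹ g * α g'⁻¹ (s * g⁻¹) g * α g'⁻¹ s g⁻¹) := by
    rw [← h2]; simp
  rw [h3]
  ext
  push_cast
  field_simp

/-- The Real categorical character of an `α`-twisted Real 2-representation is a representation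
twisted by the transgression of `α`. -/
theorem RealTwoRep.IsTwisted.character_isTwisted (hρ : ρ.IsTwisted α)
    (hα : IsTwistedCocycle π α) : ρ.character.IsTwisted (tauTwisting hα) where
  map_id x := LinearMap.ext fun φ => by
    rw [ρ.character_map_of_even (𝟙 x) (s := 1) rfl (by simp)]
    exact hρ.ppp.conj_one rfl _ φ
  map_map {x y z} f g := LinearMap.ext fun φ => by
    have hf := f.2
    have hg := g.2
    have hfg := (f ≫ g).2
    have hfg' : (f ≫ g).1 = g.1 * f.1 := rfl
    have ex : (y.elt : Γ) = f.1 * (x.elt : Γ) ^ ((π f.1 : ℤˣ) : ℤ) * f.1⁻¹ := by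
      rw [hf, mul_inv_cancel_right]
    have ez : (z.elt : Γ) = g.1 * f.1 * (x.elt : Γ) ^ ((π (g.1 * f.1) : ℤˣ) : ℤ) *
        (g.1 * f.1)⁻¹ := by
      rw [← hfg', hfg, mul_inv_cancel_right]
    rcases Int.units_eq_one_or (π f.1) with h1 | h1 <;>
      rcases Int.units_eq_one_or (π g.1) with h2 | h2
    · have Hf : (⟨f.1, h1⟩ : π.ker) * x.elt = y.elt * ⟨f.1, h1⟩ :=
        Subtype.ext (by simpa [h1] using hf)
      have Hg : (⟨g.1, h2⟩ : π.ker) * y.elt = z.elt * ⟨g.1, h2⟩ :=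
        Subtype.ext (by simpa [h2] using hg)
      have Hfg : (⟨g.1, h2⟩ * ⟨f.1, h1⟩ : π.ker) * x.elt = z.elt * (⟨g.1, h2⟩ * ⟨f.1, h1⟩) :=
        Subtype.ext (by simpa [h1, h2, hfg'] using hfg)
      rw [ρ.character_map_of_even f rfl Hf, ρ.character_map_of_even g rfl Hg,
        ρ.character_map_of_even (f ≫ g) rfl Hfg]
      refine (hρ.ppp.conj_conj rfl Hf Hg Hfg φ).trans ?_
      congr 2
      simp [tauTwisting, tauRef, h1, h2] at ex ez ⊢
      simp only [ex, ez]
    · have Hf : (⟨f.1, h1⟩ : π.ker) * x.elt = y.elt * ⟨f.1, h1⟩ :=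
        Subtype.ext (by simpa [h1] using hf)
      have Hg : ((⟨g.1, h2⟩ : OddElt π) : Γ) * (y.elt : Γ)⁻¹ = z.elt * (⟨g.1, h2⟩ : OddElt π) := by
        simpa [h2] using hg
      have Hfg : ((OddElt.mulKer ⟨g.1, h2⟩ ⟨f.1, h1⟩ : OddElt π) : Γ) * (x.elt : Γ)⁻¹ =
          z.elt * (OddElt.mulKer ⟨g.1, h2⟩ ⟨f.1, h1⟩ : OddElt π) := by
        change g.1 * f.1 * _ = _ * (g.1 * f.1)
        simpa [h1, h2, hfg'] using hfg
      rw [ρ.character_map_of_even f rfl Hf, ρ.character_map_of_odd g rfl Hg,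
        ρ.character_map_of_odd (f ≫ g) rfl Hfg]
      refine (hρ.conjOdd_conj rfl Hf Hg Hfg φ).trans ?_
      congr 2
      simp [tauTwisting, tauRef, h1, h2] at ex ez ⊢
      simp only [ex, ez, mul_inv_rev, inv_inv, mul_assoc]
    · have Hf : ((⟨f.1, h1⟩ : OddElt π) : Γ) * (x.elt : Γ)⁻¹ = y.elt * (⟨f.1, h1⟩ : OddElt π) := by
        simpa [h1] using hf
      have Hg : (⟨g.1, h2⟩ : π.ker) * y.elt = z.elt * ⟨g.1, h2⟩ :=
        Subtype.ext (by simpa [h2] using hg)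
      have h3 : π (g.1 * f.1) = -1 := by simp [h1, h2]
      have Hfg : ((⟨g.1 * f.1, h3⟩ : OddElt π) : Γ) * (x.elt : Γ)⁻¹ =
          z.elt * (⟨g.1 * f.1, h3⟩ : OddElt π) := by
        simpa [h1, h2, hfg'] using hfg
      rw [ρ.character_map_of_odd f rfl Hf, ρ.character_map_of_even g rfl Hg,
        ρ.character_map_of_odd (f ≫ g) rfl Hfg]
      refine (hρ.conj_conjOdd rfl Hf Hg Hfg φ).trans ?_
      congr 2
      simp [tauTwisting, tauRef, h1, h2] at ex ez ⊢
      simp only [ex, ez]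
    · have Hf : ((⟨f.1, h1⟩ : OddElt π) : Γ) * (x.elt : Γ)⁻¹ = y.elt * (⟨f.1, h1⟩ : OddElt π) := by
        simpa [h1] using hf
      have Hg : ((⟨g.1, h2⟩ : OddElt π) : Γ) * (y.elt : Γ)⁻¹ = z.elt * (⟨g.1, h2⟩ : OddElt π) := by
        simpa [h2] using hg
      have Hfg : OddElt.mulOdd ⟨g.1, h2⟩ ⟨f.1, h1⟩ * x.elt =
          z.elt * OddElt.mulOdd ⟨g.1, h2⟩ ⟨f.1, h1⟩ := by
        refine Subtype.ext ?_
        change g.1 * f.1 * _ = _ * (g.1 * f.1)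
        simpa [h1, h2, hfg'] using hfg
      rw [ρ.character_map_of_odd f rfl Hf, ρ.character_map_of_odd g rfl Hg,
        ρ.character_map_of_even (f ≫ g) rfl Hfg]
      refine (hρ.conjOdd_conjOdd rfl Hf Hg Hfg φ).trans ?_
      congr 2
      rw [hα.odd_contract_scalar h1 Hf y.elt.2]
      simp [tauTwisting, tauRef, h1, h2] at ex ez ⊢
      simp only [ex, ez, mul_inv_rev, inv_inv, mul_assoc]

end RealTwoRep

/-! ### The hyperbolic induction is a twisted Real 2-representation -/

section HInd

variable {k : Type uk} [Field k] {V : Type u} [Category.{v} V] [Preadditive V] [Linear k V]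

section Isos

variable {G : Type uG} [Group G] {σ : TwoRep k G V} {α : G → G → G → kˣ}

/-- The coherence law for rescaled coherence isomorphisms. -/
theorem TwoRep.IsTwisted.psiIso_assoc (hσ : σ.IsTwisted α) {c b a cb ba cba : G}
    (h₁ : c * b = cb) (h₂ : b * a = ba) (h₃ : cb * a = cba) (h₄ : c * ba = cba)
    {u s₁ s₂ s₃ s₄ : kˣ} (hs : u * s₁ * s₃ = α c b a * s₂ * s₄) (x : V) :
    (u : k) • ((psiIso σ h₁ s₁ ((σ.F a).obj x)).hom ≫ (psiIso σ h₃ s₃ x).hom) =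
      (σ.F c).map (psiIso σ h₂ s₂ x).hom ≫ (psiIso σ h₄ s₄ x).hom := by
  have h := hσ.mulApp_assoc h₁ h₂ h₃ h₄ x
  change (u : k) • (((s₁ : k) • (σ.mulApp h₁ ((σ.F a).obj x)).hom) ≫
      ((s₃ : k) • (σ.mulApp h₃ x).hom)) =
    (σ.F c).map ((s₂ : k) • (σ.mulApp h₂ x).hom) ≫ ((s₄ : k) • (σ.mulApp h₄ x).hom)
  simp only [Functor.map_smul, Linear.smul_comp, Linear.comp_smul, h, smul_smul,
    ← Units.val_mul]
  congr 2
  calc _ = u * s₁ * s₃ := by rw [mul_assoc u, mul_comm s₁]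
    _ = _ := by rw [hs]; simp only [mul_comm, mul_left_comm]

/-- The coherence law for rescaled inverse coherence isomorphisms in the opposite category. -/
theorem TwoRep.IsTwisted.psiOpIso_assoc (hσ : σ.IsTwisted α) {c b a cb ba cba : G}
    (h₁ : c * b = cb) (h₂ : b * a = ba) (h₃ : cb * a = cba) (h₄ : c * ba = cba)
    {u s₁ s₂ s₃ s₄ : kˣ} (hs : u * s₁ * s₃ * α c b a = s₂ * s₄) (x : V) :
    (u : k) • ((psiOpIso σ h₁ s₁ ((σ.F a).obj x)).hom ≫ (psiOpIso σ h₃ s₃ x).hom) =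
      ((σ.F c).map (psiOpIso σ h₂ s₂ x).hom.unop).op ≫ (psiOpIso σ h₄ s₄ x).hom := by
  apply Quiver.Hom.unop_inj
  have h := hσ.mulApp_assoc h₁ h₂ h₃ h₄ x
  have h' : (σ.mulApp h₃ x).inv ≫ (σ.mulApp h₁ ((σ.F a).obj x)).inv =
      (α c b a : k) • ((σ.mulApp h₄ x).inv ≫ (σ.F c).map (σ.mulApp h₂ x).inv) := by
    rw [← cancel_mono ((σ.F c).map (σ.mulApp h₂ x).hom), ← cancel_mono (σ.mulApp h₄ x).hom]
    simp [h, Linear.smul_comp]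
  change (u : k) • (((s₃ : k) • (σ.mulApp h₃ x).inv) ≫
      ((s₁ : k) • (σ.mulApp h₁ ((σ.F a).obj x)).inv)) =
    ((s₄ : k) • (σ.mulApp h₄ x).inv) ≫ (σ.F c).map ((s₂ : k) • (σ.mulApp h₂ x).inv)
  simp only [Functor.map_smul, Linear.smul_comp, Linear.comp_smul, h', smul_smul,
    ← Units.val_mul]
  congr 2
  calc _ = u * s₁ * s₃ * α c b a := by simp only [mul_assoc]
    _ = _ := by rw [hs]

theorem TwoRep.IsTwisted.psiIso_unit_left (hσ : σ.IsTwisted α) {e a : G} (he : e = 1)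
    (h : e * a = a) {s : kˣ} (hs : s = 1) (x : V) :
    (psiIso σ h s x).hom = (σ.oneApp he ((σ.F a).obj x)).hom := by
  rw [← hσ.mulApp_one_left he h, hs]
  exact one_smul k _

theorem TwoRep.IsTwisted.psiIso_unit_right (hσ : σ.IsTwisted α) {e a : G} (he : e = 1)
    (h : a * e = a) {s : kˣ} (hs : s = 1) (x : V) :
    (psiIso σ h s x).hom = (σ.F a).map (σ.oneApp he x).hom := by
  rw [← Functor.mapIso_hom, ← hσ.mulApp_one_right he h, hs]
  exact one_smul k _

theorem TwoRep.IsTwisted.psiOpIso_unit_left (hσ : σ.IsTwisted α) {e a : G} (he : e = 1)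
    (h : e * a = a) {s : kˣ} (hs : s = 1) (x : V) :
    (psiOpIso σ h s x).hom = (σ.oneApp he ((σ.F a).obj x)).inv.op := by
  rw [← hσ.mulApp_one_left he h, hs]
  exact one_smul k _

theorem TwoRep.IsTwisted.psiOpIso_unit_right (hσ : σ.IsTwisted α) {e a : G} (he : e = 1)
    (h : a * e = a) {s : kˣ} (hs : s = 1) (x : V) :
    (psiOpIso σ h s x).hom = ((σ.F a).map (σ.oneApp he x).inv).op := by
  rw [← Functor.mapIso_inv, ← hσ.mulApp_one_right he h, hs]
  exact one_smul k _

end Isos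

variable {Γ : Type uG} [Group Γ] {π : Γ →* ℤˣ} {α : Γ → Γ → Γ → kˣ}

/-- The cocycle identity in additive notation. -/
theorem IsTwistedCocycle.exists_additive (hα : IsTwistedCocycle π α) :
    ∃ A : Γ → Γ → Γ → Additive kˣ, (∀ c b a, Additive.ofMul (α c b a) = A c b a) ∧
      (∀ d c b a, π d = 1 →
        A (d * c) b a + A d c (b * a) = A c b a + A d (c * b) a + A d c b) ∧
      (∀ d c b a, π d = -1 →
        A (d * c) b a + A d c (b * a) = -A c b a + A d (c * b) a + A d c b) := by
  refine ⟨fun c b a => Additive.ofMul (α c b a), fun _ _ _ => rfl, fun d c b a hd => ?_,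
    fun d c b a hd => ?_⟩
  · have := congrArg Additive.ofMul (hα.cocycle d c b a)
    simpa [hd] using this
  · have := congrArg Additive.ofMul (hα.cocycle d c b a)
    simpa [hd] using this

theorem OddElt.conjKer_eq_one (ς : OddElt π) {e : π.ker} (he : e = 1) : ς.conjKer e = 1 := by
  subst he
  ext
  simp [OddElt.conjKer, OddElt.inv, OddElt.mulOdd]

-- The same simp set brings the group elements of all cases into normal form.
set_option linter.unusedSimpArgs false in
/-- The hyperbolic induction is twisted by `α`. In each component, the coherence law is the one of
`σ` up to a scalar identity, which is a combination of at most four instances of the cocycle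
identity. -/
theorem TwoRep.IsTwisted.hind {σ : TwoRep k π.ker V}
    (hσ : σ.IsTwisted fun c b a => α c b a) (hα : IsTwistedCocycle π α) (ς : OddElt π) :
    (σ.hind α ς).IsTwisted α := by
  obtain ⟨A, hA, Cp, Cm⟩ := hα.exists_additive
  exact {
  ppp :=
    { assoc := fun {c b a cb ba cba} h₁ h₂ h₃ h₄ x => by
        refine Prod.ext ?_ ?_
        · refine hσ.psiIso_assoc h₁ h₂ h₃ h₄ ?_ x.1
          simp
        · refine hσ.psiOpIso_assoc (c := ς.conjKer c) (b := ς.conjKer b) (a := ς.conjKer a)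
            _ _ _ _ ?_ x.2.unop
          have e0 := Cp c b ς ((ς : Γ)⁻¹ * a * ς) c.2
          have e1 := Cp c b a ς c.2
          have e2 := Cm ς ((ς : Γ)⁻¹ * c * ς) ((ς : Γ)⁻¹ * b * ς) ((ς : Γ)⁻¹ * a * ς) ς.2
          have e3 := Cp c ς ((ς : Γ)⁻¹ * b * ς) ((ς : Γ)⁻¹ * a * ς) c.2
          apply Additive.ofMul.injective
          simp only [hA, ofMul_one, ofMul_mul, ofMul_div, ofMul_inv, OddElt.mulOdd, OddElt.conjKer,
            OddElt.inv, ← h₁, ← h₂, mul_assoc, mul_inv_cancel_left,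
            inv_mul_cancel_left, Subgroup.coe_mul] at e0 e1 e2 e3 ⊢
          linear_combination (norm := module) e0 - e1 + e2 - e3
      unit_left := fun {e a} he h x => by
        have he' := ς.conjKer_eq_one he
        refine Prod.ext ?_ ?_
        · exact hσ.psiIso_unit_left he h rfl x.1
        · refine hσ.psiOpIso_unit_left he' _ ?_ x.2.unop
          simp [ς.conjKer_eq_one rfl, he, hα.one_left, hα.one_mid]
      unit_right := fun {e a} he h x => by
        have he' := ς.conjKer_eq_one he
        refine Prod.ext ?_ ?_
        · exact hσ.psiIso_unit_right he h rfl x.1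
        · refine hσ.psiOpIso_unit_right he' _ ?_ x.2.unop
          simp [ς.conjKer_eq_one rfl, he, hα.one_mid, hα.one_right] }
  ppm {c b cb a ba cba} h₁ h₂ h₃ h₄ x := by
    refine Prod.ext ?_ ?_
    · refine hσ.psiIso_assoc (c := c) (b := b) (a := a.mulOdd ς) _ _ _ _ ?_ x.2.unop
      have e0 := Cp c b a ς c.2
      apply Additive.ofMul.injective
      simp only [hA, ofMul_one, ofMul_mul, ofMul_div, ofMul_inv, OddElt.mulOdd, OddElt.conjKer,
        OddElt.inv, ← h₁, ← h₂, mul_assoc, mul_inv_cancel_left,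
        inv_mul_cancel_left, Subgroup.coe_mul] at e0 ⊢
      linear_combination (norm := module) -e0
    · refine hσ.psiOpIso_assoc (c := ς.conjKer c) (b := ς.conjKer b) (a := ς.inv.mulOdd a)
        _ _ _ _ ?_ x.1
      have e0 := Cp c ς ((ς : Γ)⁻¹ * b * ς) ((ς : Γ)⁻¹ * a) c.2
      have e1 := Cp c b ς ((ς : Γ)⁻¹ * a) c.2
      have e2 := Cm ς ((ς : Γ)⁻¹ * c * ς) ((ς : Γ)⁻¹ * b * ς) ((ς : Γ)⁻¹ * a) ς.2
      apply Additive.ofMul.injective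
      simp only [hA, ofMul_one, ofMul_mul, ofMul_div, ofMul_inv, OddElt.mulOdd, OddElt.conjKer,
        OddElt.inv, ← h₁, ← h₂, mul_assoc, mul_inv_cancel_left,
        inv_mul_cancel_left, Subgroup.coe_mul] at e0 e1 e2 ⊢
      linear_combination (norm := module) -e0 + e1 + e2
  pmp {c a b cb ba cba} h₁ h₂ h₃ h₄ x := by
    refine Prod.ext ?_ ?_
    · refine hσ.psiIso_assoc (c := c) (b := b.mulOdd ς) (a := ς.conjKer a) _ _ _ _ ?_ x.2.unop
      have e0 := Cp c b ς ((ς : Γ)⁻¹ * a * ς) c.2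
      have e1 := Cp c b a ς c.2
      apply Additive.ofMul.injective
      simp only [hA, ofMul_one, ofMul_mul, ofMul_div, ofMul_inv, OddElt.mulOdd, OddElt.conjKer,
        OddElt.inv, ← h₁, ← h₂, mul_assoc, mul_inv_cancel_left,
        inv_mul_cancel_left, Subgroup.coe_mul] at e0 e1 ⊢
      linear_combination (norm := module) e0 - e1
    · refine hσ.psiOpIso_assoc (c := ς.conjKer c) (b := ς.inv.mulOdd b) (a := a) _ _ _ _ ?_ x.1
      have e0 := Cp c ς ((ς : Γ)⁻¹ * b) a c.2
      have e1 := Cm ς ((ς : Γ)⁻¹ * c * ς) ((ς : Γ)⁻¹ * b) a ς.2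
      apply Additive.ofMul.injective
      simp only [hA, ofMul_one, ofMul_mul, ofMul_div, ofMul_inv, OddElt.mulOdd, OddElt.conjKer,
        OddElt.inv, ← h₁, ← h₂, mul_assoc, mul_inv_cancel_left,
        inv_mul_cancel_left, Subgroup.coe_mul] at e0 e1 ⊢
      linear_combination (norm := module) -e0 + e1
  pmm {c ba cba b a cb} h₁ h₂ h₃ h₄ x := by
    refine Prod.ext ?_ ?_
    · refine hσ.psiIso_assoc (c := c) (b := b.mulOdd ς) (a := ς.inv.mulOdd a) _ _ _ _ ?_ x.1
      have e0 := Cp c b ς ((ς : Γ)⁻¹ * a) c.2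
      apply Additive.ofMul.injective
      simp only [hA, ofMul_one, ofMul_mul, ofMul_div, ofMul_inv, OddElt.mulOdd, OddElt.conjKer,
        OddElt.inv, ← h₁, ← h₂, mul_assoc, mul_inv_cancel_left,
        inv_mul_cancel_left, Subgroup.coe_mul] at e0 ⊢
      linear_combination (norm := module) e0
    · refine hσ.psiOpIso_assoc (c := ς.conjKer c) (b := ς.inv.mulOdd b) (a := a.mulOdd ς)
        _ _ _ _ ?_ x.2.unop
      have e0 := Cp c ς ((ς : Γ)⁻¹ * b) (a * ς) c.2
      have e1 := Cm ς ((ς : Γ)⁻¹ * c * ς) ((ς : Γ)⁻¹ * b) (a * ς) ς.2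
      have e2 := Cp c b a ς c.2
      apply Additive.ofMul.injective
      simp only [hA, ofMul_one, ofMul_mul, ofMul_div, ofMul_inv, OddElt.mulOdd, OddElt.conjKer,
        OddElt.inv, ← h₁, ← h₂, mul_assoc, mul_inv_cancel_left,
        inv_mul_cancel_left, Subgroup.coe_mul] at e0 e1 e2 ⊢
      linear_combination (norm := module) -e0 + e1 - e2
  mpp {b a ba c cb cba} h₁ h₂ h₃ h₄ x := by
    refine Prod.ext ?_ ?_
    · refine hσ.psiIso_assoc (c := c.mulOdd ς) (b := ς.conjKer b) (a := ς.conjKer a)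
        (s₂ := _⁻¹) _ _ _ _ ?_ x.2.unop
      have e0 := Cm c b ς ((ς : Γ)⁻¹ * a * ς) c.2
      have e1 := Cm c ς ((ς : Γ)⁻¹ * b * ς) ((ς : Γ)⁻¹ * a * ς) c.2
      have e2 := Cm c b a ς c.2
      apply Additive.ofMul.injective
      simp only [hA, ofMul_one, ofMul_mul, ofMul_div, ofMul_inv, OddElt.mulOdd, OddElt.conjKer,
        OddElt.inv, ← h₁, ← h₂, mul_assoc, mul_inv_cancel_left,
        inv_mul_cancel_left, Subgroup.coe_mul] at e0 e1 e2 ⊢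
      linear_combination (norm := module) e0 - e1 - e2
    · refine hσ.psiOpIso_assoc (c := ς.inv.mulOdd c) (b := b) (a := a) (s₂ := _⁻¹) _ _ _ _ ?_ x.1
      have e0 := Cm ς ((ς : Γ)⁻¹ * c) b a ς.2
      apply Additive.ofMul.injective
      simp only [hA, ofMul_one, ofMul_mul, ofMul_div, ofMul_inv, OddElt.mulOdd, OddElt.conjKer,
        OddElt.inv, ← h₁, ← h₂, mul_assoc, mul_inv_cancel_left,
        inv_mul_cancel_left, Subgroup.coe_mul] at e0 ⊢
      linear_combination (norm := module) e0
  mpm {b cba c a cb ba} h₁ h₂ h₃ h₄ x := by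
    refine Prod.ext ?_ ?_
    · refine hσ.psiIso_assoc (c := c.mulOdd ς) (b := ς.conjKer b) (a := ς.inv.mulOdd a)
        (s₂ := _⁻¹) _ _ _ _ ?_ x.1
      have e0 := Cm c b ς ((ς : Γ)⁻¹ * a) c.2
      have e1 := Cm c ς ((ς : Γ)⁻¹ * b * ς) ((ς : Γ)⁻¹ * a) c.2
      apply Additive.ofMul.injective
      simp only [hA, ofMul_one, ofMul_mul, ofMul_div, ofMul_inv, OddElt.mulOdd, OddElt.conjKer,
        OddElt.inv, ← h₁, ← h₂, mul_assoc, mul_inv_cancel_left,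
        inv_mul_cancel_left, Subgroup.coe_mul] at e0 e1 ⊢
      linear_combination (norm := module) e0 - e1
    · refine hσ.psiOpIso_assoc (c := ς.inv.mulOdd c) (b := b) (a := a.mulOdd ς)
        (s₂ := _⁻¹) _ _ _ _ ?_ x.2.unop
      have e0 := Cm c b a ς c.2
      have e1 := Cm ς ((ς : Γ)⁻¹ * c) b (a * ς) ς.2
      apply Additive.ofMul.injective
      simp only [hA, ofMul_one, ofMul_mul, ofMul_div, ofMul_inv, OddElt.mulOdd, OddElt.conjKer,
        OddElt.inv, ← h₁, ← h₂, mul_assoc, mul_inv_cancel_left,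
        inv_mul_cancel_left, Subgroup.coe_mul] at e0 e1 ⊢
      linear_combination (norm := module) -e0 + e1
  mmp {a cb cba c b ba} h₁ h₂ h₃ h₄ x := by
    refine Prod.ext ?_ ?_
    · refine hσ.psiIso_assoc (c := c.mulOdd ς) (b := ς.inv.mulOdd b) (a := a)
        (s₂ := _⁻¹) _ _ _ _ ?_ x.1
      have e0 := Cm c ς ((ς : Γ)⁻¹ * b) a c.2
      apply Additive.ofMul.injective
      simp only [hA, ofMul_one, ofMul_mul, ofMul_div, ofMul_inv, OddElt.mulOdd, OddElt.conjKer,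
        OddElt.inv, ← h₁, ← h₂, mul_assoc, mul_inv_cancel_left,
        inv_mul_cancel_left, Subgroup.coe_mul] at e0 ⊢
      linear_combination (norm := module) -e0
    · refine hσ.psiOpIso_assoc (c := ς.inv.mulOdd c) (b := b.mulOdd ς) (a := ς.conjKer a)
        (s₂ := _⁻¹) _ _ _ _ ?_ x.2.unop
      have e0 := Cm c b a ς c.2
      have e1 := Cm c b ς ((ς : Γ)⁻¹ * a * ς) c.2
      have e2 := Cm ς ((ς : Γ)⁻¹ * c) (b * ς) ((ς : Γ)⁻¹ * a * ς) ς.2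
      apply Additive.ofMul.injective
      simp only [hA, ofMul_one, ofMul_mul, ofMul_div, ofMul_inv, OddElt.mulOdd, OddElt.conjKer,
        OddElt.inv, ← h₁, ← h₂, mul_assoc, mul_inv_cancel_left,
        inv_mul_cancel_left, Subgroup.coe_mul] at e0 e1 e2 ⊢
      linear_combination (norm := module) -e0 + e1 + e2
  mmm {cb ba c b a cba} h₁ h₂ h₃ h₄ x := by
    refine Prod.ext ?_ ?_
    · refine hσ.psiIso_assoc (c := c.mulOdd ς) (b := ς.inv.mulOdd b) (a := a.mulOdd ς)
        (s₂ := _⁻¹) _ _ _ _ ?_ x.2.unop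
      have e0 := Cm c b a ς c.2
      have e1 := Cm c ς ((ς : Γ)⁻¹ * b) (a * ς) c.2
      apply Additive.ofMul.injective
      simp only [hA, ofMul_one, ofMul_mul, ofMul_div, ofMul_inv, OddElt.mulOdd, OddElt.conjKer,
        OddElt.inv, ← h₁, ← h₂, mul_assoc, mul_inv_cancel_left,
        inv_mul_cancel_left, Subgroup.coe_mul] at e0 e1 ⊢
      linear_combination (norm := module) -e0 - e1
    · refine hσ.psiOpIso_assoc (c := ς.inv.mulOdd c) (b := b.mulOdd ς) (a := ς.inv.mulOdd a)
        (s₂ := _⁻¹) _ _ _ _ ?_ x.1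
      have e0 := Cm c b ς ((ς : Γ)⁻¹ * a) c.2
      have e1 := Cm ς ((ς : Γ)⁻¹ * c) (b * ς) ((ς : Γ)⁻¹ * a) ς.2
      apply Additive.ofMul.injective
      simp only [hA, ofMul_one, ofMul_mul, ofMul_div, ofMul_inv, OddElt.mulOdd, OddElt.conjKer,
        OddElt.inv, ← h₁, ← h₂, mul_assoc, mul_inv_cancel_left,
        inv_mul_cancel_left, Subgroup.coe_mul] at e0 e1 ⊢
      linear_combination (norm := module) e0 + e1
  unit_pm {e a} he h x := by
    have he' := ς.conjKer_eq_one he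
    refine Prod.ext ?_ ?_
    · refine hσ.psiIso_unit_left he _ ?_ x.2.unop
      simp [he, hα.one_left]
    · refine hσ.psiOpIso_unit_left he' _ ?_ x.1
      simp [ς.conjKer_eq_one rfl, he, hα.one_left, hα.one_mid]
  unit_mp {e a} he h x := by
    have he' := ς.conjKer_eq_one he
    refine Prod.ext ?_ ?_
    · refine hσ.psiIso_unit_right he' _ ?_ x.2.unop
      simp [ς.conjKer_eq_one rfl, he, hα.one_mid, hα.one_right]
    · refine hσ.psiOpIso_unit_right he _ ?_ x.1
      simp [he, hα.one_right] }

end HInd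

/-! ### The induction from a subgroup is a twisted 2-representation -/

section Rows

variable {k : Type uk} [Field k] {G : Type uG} [Group G]
variable {V : Type u} [Category.{v} V] [Preadditive V] [Linear k V]
variable {ρ : TwoRep k G V} {α : G → G → G → kˣ} {J : Type w}

/-- The coherence law in a row of a permutation-like action on `J → V`, where the indices that
occur are only propositionally equal. -/
theorem TwoRep.IsTwisted.row_assoc (hρ : ρ.IsTwisted α) (x : J → V) (n : J → G) (t : J → J)
    {c b cb ba cba : G} {i i' l m : J} (hi : i = i') (hl : t i' = l) (hm : t i = m) (hml : m = l)
    (h₁ : c * b = cb) (h₂ : b * n i = ba) (h₃ : cb * n i' = cba) (h₄ : c * ba = cba)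
    {u s₁ s₂ s₃ s₄ : kˣ} (hs : u * s₁ * s₃ = α c b (n i) * s₂ * s₄) :
    (u : k) • (((s₁ : k) • ((ρ.F c).map ((ρ.F b).map
        (idxIso (fun i => (ρ.F (n i)).obj (x (t i))) hi).hom) ≫
        (ρ.mulApp h₁ ((ρ.F (n i')).obj (x (t i')))).hom)) ≫
        ((s₃ : k) • ((ρ.F cb).map ((ρ.F (n i')).map (idxIso x hl).hom) ≫
          (ρ.mulApp h₃ (x l)).hom))) =
      (ρ.F c).map ((s₂ : k) • ((ρ.F b).map ((ρ.F (n i)).map (idxIso x hm).hom) ≫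
        (ρ.mulApp h₂ (x m)).hom)) ≫
        ((s₄ : k) • ((ρ.F c).map ((ρ.F ba).map (idxIso x hml).hom) ≫
          (ρ.mulApp h₄ (x l)).hom)) := by
  subst hi hm hml
  have h := congrArg Units.val hs
  push_cast at h
  simp only [idxIso, eqToIso_refl, Iso.refl_hom, CategoryTheory.Functor.map_id, Category.id_comp,
    Functor.map_smul, Linear.comp_smul, Linear.smul_comp, hρ.mulApp_assoc h₁ h₂ h₃ h₄, smul_smul]
  congr 1
  linear_combination h

theorem TwoRep.IsTwisted.row_unit_left (hρ : ρ.IsTwisted α) (x : J → V) (n : J → G) (t : J → J)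
    {e : G} (he : e = 1) {i j : J} (hi : i = j) (ht : t i = t j) (h : e * n i = n j) {s : kˣ}
    (hs : s = 1) :
    (s : k) • ((ρ.F e).map ((ρ.F (n i)).map (idxIso x ht).hom) ≫ (ρ.mulApp h (x (t j))).hom) =
      (ρ.oneApp he ((ρ.F (n i)).obj (x (t i)))).hom ≫
        (idxIso (fun i => (ρ.F (n i)).obj (x (t i))) hi).hom := by
  subst hi hs
  simp [idxIso, hρ.mulApp_one_left he h]

theorem TwoRep.IsTwisted.row_unit_right (hρ : ρ.IsTwisted α) (x : J → V) {a e : G} (he : e = 1)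
    {i j : J} (hi : i = j) (h : a * e = a) {s : kˣ} (hs : s = 1) :
    (s : k) • ((ρ.F a).map ((ρ.F e).map (idxIso x hi).hom) ≫ (ρ.mulApp h (x j)).hom) =
      (ρ.F a).map ((ρ.oneApp he (x i)).hom ≫ (idxIso x hi).hom) := by
  subst hi hs
  simp [idxIso, hρ.mulApp_one_right he h]

end Rows

section Ind

variable {k : Type uk} [Field k] {G : Type uG} [Group G] {H : Subgroup G} (r : G ⧸ H → G)
  (hr : ∀ q, (QuotientGroup.mk (r q) : G ⧸ H) = q)
variable {V : Type u} [Category.{v} V] [Preadditive V] [Linear k V]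
variable {ρ : TwoRep k H V} {α : G → G → G → kˣ}

theorem IsTwistedCocycle.restrict_ker {Γ : Type uG} [Group Γ] {π : Γ →* ℤˣ}
    {α : Γ → Γ → Γ → kˣ} (hα : IsTwistedCocycle π α) :
    IsTwistedCocycle (1 : π.ker →* ℤˣ) fun c b a => α c b a where
  one_left b a := hα.one_left b a
  one_mid c a := hα.one_mid c a
  one_right c b := hα.one_right c b
  cocycle d c b a := by
    have h := hα.cocycle d c b a
    rw [show π (d : Γ) = 1 from d.2] at h
    exact h

/-- The scalar identity behind the coherence law of the induced 2-representation. The four instances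
of the cocycle identity belong to the four simplices that decompose the prism with the vertical
edges `r_q`, whose two ends are the simplices of `α c b a` and of `α` at the coset parts. -/
theorem indScalar_assoc (hα : IsTwistedCocycle (1 : G →* ℤˣ) α) {c b a cb ba : G}
    (h₁ : c * b = cb) (h₂ : b * a = ba) (j : G ⧸ H) :
    α c b a * indScalar r hr α c b j * indScalar r hr α cb a j =
      α (cosetPart r hr c j) (cosetPart r hr b (c⁻¹ • j)) (cosetPart r hr a (b⁻¹ • c⁻¹ • j)) *
        indScalar r hr α b a (c⁻¹ • j) * indScalar r hr α c ba j := by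
  subst h₁ h₂
  obtain ⟨A, hA, C, -⟩ := hα.exists_additive
  have e0 := C c b a (r (a⁻¹ • b⁻¹ • c⁻¹ • j)) rfl
  have e1 := C c b (r (b⁻¹ • c⁻¹ • j)) (cosetPart r hr a (b⁻¹ • c⁻¹ • j)) rfl
  have e2 := C c (r (c⁻¹ • j)) (cosetPart r hr b (c⁻¹ • j))
    (cosetPart r hr a (b⁻¹ • c⁻¹ • j)) rfl
  have e3 := C (r j) (cosetPart r hr c j) (cosetPart r hr b (c⁻¹ • j))
    (cosetPart r hr a (b⁻¹ • c⁻¹ • j)) rfl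
  apply Additive.ofMul.injective
  simp only [indScalar, mul_inv_rev, mul_smul, cosetPart, hA, ofMul_mul, ofMul_div, mul_assoc,
    mul_inv_cancel_left] at e0 e1 e2 e3 ⊢
  linear_combination (norm := module) -e0 + e1 - e2 + e3

theorem indScalar_one_left (hα : IsTwistedCocycle (1 : G →* ℤˣ) α) {e : G} (he : e = 1) (a : G)
    (j : G ⧸ H) : indScalar r hr α e a j = 1 := by
  subst he
  simp [indScalar, cosetPart, hα.one_left, hα.one_mid]

theorem indScalar_one_right (hα : IsTwistedCocycle (1 : G →* ℤˣ) α) {e : G} (he : e = 1) (a : G)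
    (j : G ⧸ H) : indScalar r hr α a e j = 1 := by
  subst he
  simp [indScalar, cosetPart, hα.one_mid, hα.one_right]

/-- The induction of a twisted 2-representation is twisted. -/
theorem TwoRep.IsTwisted.ind (hρ : ρ.IsTwisted fun c b a => α c b a)
    (hα : IsTwistedCocycle (1 : G →* ℤˣ) α) : (ρ.ind r hr α).IsTwisted α where
  assoc {c b a cb ba cba} h₁ h₂ h₃ h₄ x := funext fun j =>
    hρ.row_assoc x (cosetPart r hr a) (a⁻¹ • ·) (coset_comp h₁ j) (coset_comp h₃ j)
      (coset_comp h₂ (c⁻¹ • j)) (coset_comp h₄ j) (cosetPart_mul r hr h₁ j)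
      (cosetPart_mul r hr h₂ (c⁻¹ • j)) (cosetPart_mul r hr h₃ j) (cosetPart_mul r hr h₄ j)
      (indScalar_assoc r hr hα h₁ h₂ j)
  unit_left {e a} he h x := funext fun j =>
    hρ.row_unit_left x (cosetPart r hr a) (a⁻¹ • ·) (cosetPart_one r hr he j)
      (show e⁻¹ • j = j by rw [he, inv_one, one_smul]) (coset_comp h j) (cosetPart_mul r hr h j)
      (indScalar_one_left r hr hα he a j)
  unit_right {e a} he h x := funext fun j =>
    hρ.row_unit_right x (cosetPart_one r hr he (a⁻¹ • j)) (coset_comp h j)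
      (cosetPart_mul r hr h j) (indScalar_one_right r hr hα he a j)

end Ind

/-! ### Conjugation on the trace of an induced 2-representation -/

section RowConj

variable {k : Type uk} [Field k] {G : Type uG} [Group G]
variable {V : Type u} [Category.{v} V] [Preadditive V] [Linear k V]
variable {ρ : TwoRep k G V} {α : G → G → G → kˣ} {J : Type w}

/-- The conjugation map of the 2-representation `ρ`, read off in a row of `J → V`. -/
theorem TwoRep.IsTwisted.row_conj (hρ : ρ.IsTwisted α) (x : J → V) (n : J → G) (t : J → J)
    {h h' c : G} {j j' i m : J} (hj : j = j') (hi : t j = i) (hm : i = m) (hm' : t j' = m)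
    (hh : n j * h = h' * n j) (h₁ : n j * h = c) (h₂ : h' * n j' = c) (φ : ρ.Tr h)
    {s s' u : kˣ} (hs : s / s' = u) :
    (ρ.F (n j)).map (φ.app (x (t j)) ≫ (ρ.F h).map (idxIso x hi).hom) ≫
        ((s : k) • ((ρ.F (n j)).map ((ρ.F h).map (idxIso x hm).hom) ≫ (ρ.mulApp h₁ (x m)).hom)) ≫
        (((s'⁻¹ : kˣ) : k) • ((ρ.mulApp h₂ (x m)).inv ≫
          (ρ.F h').map ((ρ.F (n j')).map (idxIso x hm').inv))) =
      (u : k) • ((ρ.conj (n j) hh φ).app ((ρ.F (n j)).obj (x (t j))) ≫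
        (ρ.F h').map (idxIso (fun l => (ρ.F (n l)).obj (x (t l))) hj).hom) := by
  subst hj hi hm h₂ hs
  rw [hρ.conj_app_obj]
  simp [idxIso, smul_smul, div_eq_mul_inv, mul_comm]

end RowConj

section Ind

variable {k : Type uk} [Field k] {G : Type uG} [Group G] {H : Subgroup G} (r : G ⧸ H → G)
  (hr : ∀ q, (QuotientGroup.mk (r q) : G ⧸ H) = q)
variable {V : Type u} [Category.{v} V] [Preadditive V] [Linear k V]
variable {ρ : TwoRep k H V} {α : G → G → G → kˣ}

theorem indInclApp_self (ρ : TwoRep k H V) {g : G} {q : G ⧸ H}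
    (hg : g * r q = r q * cosetPart r hr g q) (hq : q = g⁻¹ • q) (φ : ρ.Tr (cosetPart r hr g q))
    (x : G ⧸ H → V) :
    indInclApp r hr ρ hg φ x q =
      φ.app (x q) ≫ (ρ.F (cosetPart r hr g q)).map (idxIso x hq).hom := by
  unfold indInclApp
  rw [dif_pos rfl]
  simp

theorem indInclApp_of_ne (ρ : TwoRep k H V) {g : G} {q : G ⧸ H} {h : H}
    (hg : g * r q = r q * h) (φ : ρ.Tr h) (x : G ⧸ H → V) {j : G ⧸ H} (hj : j ≠ q) :
    indInclApp r hr ρ hg φ x j = 0 :=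
  dif_neg hj

theorem coset_transport (hr : ∀ q, (QuotientGroup.mk (r q) : G ⧸ H) = q) {g : G} {i j : G ⧸ H}
    {h : H} (hg : g * r i = r j * h) : i = g⁻¹ • j := by
  rw [eq_inv_smul_iff]
  conv_lhs => rw [← hr i]
  rw [MulAction.Quotient.smul_coe, smul_eq_mul, hg,
    QuotientGroup.mk_mul_of_mem _ h.2, hr]

theorem eq_cosetPart {g : G} {j : G ⧸ H} {h : H} (hg : g * r (g⁻¹ • j) = r j * h) :
    h = cosetPart r hr g j := by
  refine Subtype.ext ?_
  simp only [cosetPart]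
  rw [mul_assoc, hg, inv_mul_cancel_left]

/-- Conjugation on the trace of the induced 2-representation permutes the rows as `G` permutes
the cosets, and acts in each row by conjugation on the trace of `ρ`, up to a quotient of two
values of the transgression of `α`. -/
theorem TwoRep.IsTwisted.conj_indIncl (hρ : ρ.IsTwisted fun c b a => α c b a)
    (hα : IsTwistedCocycle (1 : G →* ℤˣ) α) {g γ γ' : G} {i j : G ⧸ H} {h h₁ h' : H}
    (hγ : γ * r i = r i * h) (hg : g * r i = r j * h₁) (hγ' : γ' * r j = r j * h')
    (hc : g * γ = γ' * g) (hh : h₁ * h = h' * h₁) (φ : ρ.Tr h) :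
    (ρ.ind r hr α).conj g hc (ρ.indIncl r hr α hγ φ) =
      ((α g (r i) h * α γ' g (r i) / α g γ (r i) /
        (α (r j) h₁ h * α γ' (r j) h₁ / α (r j) h' h₁) : kˣ) : k) •
        ρ.indIncl r hr α hγ' (ρ.conj h₁ hh φ) := by
  refine (ρ.ind r hr α).tr_ext g fun x => ?_
  rw [(hρ.ind r hr hα).conj_app_obj]
  obtain rfl := coset_transport r hr hg
  obtain rfl := eq_cosetPart r hr hg
  funext l
  -- Off the row `j`, both sides vanish.
  by_cases hl : l = j
  · subst hl
    have hi := coset_transport r hr hγ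
    have hj := coset_transport r hr hγ'
    obtain rfl : h = cosetPart r hr γ (g⁻¹ • l) := eq_cosetPart r hr (by rw [← hi]; exact hγ)
    obtain rfl : h' = cosetPart r hr γ' l := eq_cosetPart r hr (by rw [← hj]; exact hγ')
    have hs : indScalar r hr α g γ l / indScalar r hr α γ' g l =
        α g (r (g⁻¹ • l)) (cosetPart r hr γ (g⁻¹ • l)) * α γ' g (r (g⁻¹ • l)) /
          α g γ (r (g⁻¹ • l)) / (α (r l) (cosetPart r hr g l) (cosetPart r hr γ (g⁻¹ • l)) *
            α γ' (r l) (cosetPart r hr g l) /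
              α (r l) (cosetPart r hr γ' l) (cosetPart r hr g l)) := by
      unfold indScalar
      rw [← hi, ← hj]
      ext
      push_cast
      field_simp
    have e₁ := indInclApp_self r hr ρ hγ hi φ x
    have e₂ := indInclApp_self r hr ρ hγ' hj (ρ.conj (cosetPart r hr g l) hh φ)
      (((ρ.ind r hr α).F g).obj x)
    have key := hρ.row_conj x (cosetPart r hr g) (g⁻¹ • ·) hj hi (coset_comp hc l)
      (coset_comp rfl l) hh (cosetPart_mul r hr hc l) (cosetPart_mul r hr rfl l) φ hs
    refine Eq.trans ?_ (key.trans ?_)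
    · exact congrArg (fun f => (ρ.F (cosetPart r hr g l)).map f ≫
        (indComp r hr ρ α hc x l).hom ≫ (indComp r hr ρ α rfl x l).inv) e₁
    · exact congrArg (fun f => (_ : k) • f) e₂.symm
  · have hl' : g⁻¹ • l ≠ g⁻¹ • j := fun h => hl (smul_left_cancel _ h)
    have e₁ := indInclApp_of_ne r hr ρ hγ φ x hl'
    have e₂ := indInclApp_of_ne r hr ρ hγ' (ρ.conj (cosetPart r hr g j) hh φ)
      (((ρ.ind r hr α).F g).obj x) hl
    trans 0
    · refine (congrArg (fun f => (ρ.F (cosetPart r hr g l)).map f ≫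
        (indComp r hr ρ α hc x l).hom ≫ (indComp r hr ρ α rfl x l).inv) e₁).trans ?_
      simp
      rfl
    · exact (smul_zero _).symm.trans (congrArg (fun f => (_ : k) • f) e₂.symm)

end Ind

/-! ### Induced twisted representations -/

section Induced

variable {k : Type uk} [Field k] {C : Type u₁} [Category.{v₁} C] {D : Type u₂} [Category.{v₂} D]
variable {F : D ⥤ C} {θ : Twisting k C} {E : ProjRep.{w} k D} {T : ProjRep.{w'} k C}

theorem ProjRep.IsTwisted.map_map_apply (hT : T.IsTwisted θ) {x y z : C} (f : x ⟶ y) (g : y ⟶ z)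
    (v : T.obj x) : T.map g (T.map f v) = (θ.val f g : k) • T.map (f ≫ g) v :=
  LinearMap.congr_fun (hT.map_map f g) v

theorem ProjRep.IsTwisted.map_comp_apply (hT : T.IsTwisted θ) {x y z : C} (f : x ⟶ y)
    (g : y ⟶ z) (v : T.obj x) :
    T.map (f ≫ g) v = (((θ.val f g)⁻¹ : kˣ) : k) • T.map g (T.map f v) :=
  eq_smul_inv_of_smul_eq (hT.map_map_apply f g v)

theorem ProjRep.IsTwisted.map_id_apply (hT : T.IsTwisted θ) {x : C} (v : T.obj x) :
    T.map (𝟙 x) v = v :=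
  LinearMap.congr_fun (hT.map_id x) v

/-- A twisted representation is invertible on isomorphisms. -/
theorem ProjRep.IsTwisted.map_map_inv (hT : T.IsTwisted θ) {x y : C} (f : x ⟶ y) [IsIso f]
    (v : T.obj y) : T.map f (((θ.val (inv f) f)⁻¹ : kˣ) • T.map (inv f) v) = v := by
  rw [Units.smul_def, map_smul, hT.map_map_apply, smul_smul, ← Units.val_mul, inv_mul_cancel,
    Units.val_one, one_smul, IsIso.inv_hom_id, hT.map_id_apply]

theorem ProjRep.IsTwisted.map_injective (hT : T.IsTwisted θ) {x y : C} (f : x ⟶ y) [IsIso f] :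
    Function.Injective (T.map f) := by
  intro v w h
  have h' := congrArg (T.map (inv f)) h
  rwa [hT.map_map_apply, hT.map_map_apply, IsIso.hom_inv_id, hT.map_id_apply, hT.map_id_apply,
    ← Units.smul_def, ← Units.smul_def, smul_left_cancel_iff] at h'

variable (F θ E) in
/-- The linear map `v ↦ s ⊗ v` into the induced representation. -/
noncomputable def ProjRep.inducedMkₗ {x : C} {y : D} (s : F.obj y ⟶ x) :
    E.obj y →ₗ[k] (E.induced F θ).obj x :=
  (indRel F θ E x).mkQ ∘ₗ indSumMk F E s

theorem ProjRep.inducedMkₗ_apply {x : C} {y : D} (s : F.obj y ⟶ x) (v : E.obj y) :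
    E.inducedMkₗ F θ s v = E.inducedMk F θ s v := rfl

theorem ProjRep.inducedMk_map {x : C} {y y' : D} (t : y ⟶ y') (s : F.obj y' ⟶ x) (v : E.obj y) :
    E.inducedMk F θ s (E.map t v) =
      (θ.val (F.map t) s : k) • E.inducedMk F θ (F.map t ≫ s) v := by
  have h : indSumMk F E s (E.map t v) -
      (θ.val (F.map t) s : k) • indSumMk F E (F.map t ≫ s) v ∈ indRel F θ E x :=
    Submodule.subset_span ⟨y, y', t, s, v, rfl⟩
  exact ((Submodule.Quotient.eq _).2 h).trans ((indRel F θ E x).mkQ.map_smul _ _)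

theorem ProjRep.induced_map_mk {x x' : C} (f : x ⟶ x') {y : D} (s : F.obj y ⟶ x) (v : E.obj y) :
    (E.induced F θ).map f (E.inducedMk F θ s v) =
      (θ.val s f : k) • E.inducedMk F θ (s ≫ f) v := by
  change (indRel F θ E x').mkQ (indSumMap F θ E f (indSumMk F E s v)) = _
  rw [indSumMap_mk, map_smul]
  rfl

theorem indSum_hom_ext {x : C} {M : Type*} [AddCommGroup M] [Module k M]
    {f g : IndSum F E x →ₗ[k] M}
    (h : ∀ (y : D) (s : F.obj y ⟶ x) (v : E.obj y),
      f (indSumMk F E s v) = g (indSumMk F E s v)) : f = g := by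
  classical
  refine DirectSum.linearMap_ext k fun p => LinearMap.ext fun v => ?_
  have := h p.1 p.2 v
  unfold indSumMk at this
  simp only [LinearMap.comp_apply]
  convert this

theorem ProjRep.induced_hom_ext {x : C} {M : Type*} [AddCommGroup M] [Module k M]
    {f g : (E.induced F θ).obj x →ₗ[k] M}
    (h : ∀ (y : D) (s : F.obj y ⟶ x) (v : E.obj y),
      f (E.inducedMk F θ s v) = g (E.inducedMk F θ s v)) : f = g :=
  Submodule.linearMap_qext (indRel F θ E x) (indSum_hom_ext h)

/-- The induced representation is spanned by the classes of the symbols `s ⊗ v`. -/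
theorem ProjRep.induced_eq_top {x : C} {N : Submodule k ((E.induced F θ).obj x)}
    (h : ∀ (y : D) (s : F.obj y ⟶ x) (v : E.obj y), E.inducedMk F θ s v ∈ N) : N = ⊤ := by
  rw [← N.ker_mkQ, LinearMap.ker_eq_top]
  refine ProjRep.induced_hom_ext fun y s v => ?_
  simpa using h y s v

/-- The induced representation is twisted, provided that the `2`-cocycle is normalized. -/
theorem ProjRep.induced_isTwisted (hθ : ∀ {x y : C} (f : x ⟶ y), θ.val f (𝟙 y) = 1) :
    (E.induced F θ).IsTwisted θ where
  map_id x := ProjRep.induced_hom_ext fun y s v => by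
    rw [ProjRep.induced_map_mk, hθ, Units.val_one, one_smul, Category.comp_id]
    rfl
  map_map f g := ProjRep.induced_hom_ext fun y s v => by
    have h := congrArg Units.val (θ.cocycle s f g)
    push_cast at h
    rw [LinearMap.comp_apply, LinearMap.smul_apply, ProjRep.induced_map_mk, map_smul,
      ProjRep.induced_map_mk, ProjRep.induced_map_mk, smul_smul, smul_smul, h, mul_comm,
      Category.assoc]

/-- The linear map `s ⊗ v ↦ T(s) (η v)` on the direct sum. -/
noncomputable def indSumLift (T : ProjRep.{w'} k C) (η : ∀ y, E.obj y →ₗ[k] T.obj (F.obj y))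
    (x : C) : IndSum F E x →ₗ[k] T.obj x :=
  open Classical in DirectSum.toModule k _ _ fun p => T.map p.2 ∘ₗ η p.1

theorem indSumLift_mk (η : ∀ y, E.obj y →ₗ[k] T.obj (F.obj y)) {x : C} {y : D}
    (s : F.obj y ⟶ x) (v : E.obj y) : indSumLift T η x (indSumMk F E s v) = T.map s (η y v) := by
  classical
  unfold indSumLift indSumMk
  simp [DirectSum.toModule_lof]

/-- The morphism out of the induced representation that corresponds to a morphism `η` from `E` to
the restriction of `T` under Frobenius reciprocity. -/
noncomputable def ProjRep.inducedLift (hT : T.IsTwisted θ)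
    (η : ∀ y, E.obj y →ₗ[k] T.obj (F.obj y))
    (hη : ∀ {y y' : D} (t : y ⟶ y') (v : E.obj y), η y' (E.map t v) = T.map (F.map t) (η y v))
    (x : C) : (E.induced F θ).obj x →ₗ[k] T.obj x :=
  (indRel F θ E x).liftQ (indSumLift T η x) (by
    refine Submodule.span_le.2 ?_
    rintro _ ⟨y, y', t, s, v, rfl⟩
    rw [SetLike.mem_coe, LinearMap.mem_ker, map_sub, map_smul, indSumLift_mk, indSumLift_mk, hη,
      hT.map_map_apply, sub_self])

variable (hT : T.IsTwisted θ) (η : ∀ y, E.obj y →ₗ[k] T.obj (F.obj y))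
  (hη : ∀ {y y' : D} (t : y ⟶ y') (v : E.obj y), η y' (E.map t v) = T.map (F.map t) (η y v))

theorem ProjRep.inducedLift_mk {x : C} {y : D} (s : F.obj y ⟶ x) (v : E.obj y) :
    ProjRep.inducedLift hT η hη x (E.inducedMk F θ s v) = T.map s (η y v) :=
  indSumLift_mk η s v

theorem ProjRep.inducedLift_map {x x' : C} (f : x ⟶ x') (z : (E.induced F θ).obj x) :
    ProjRep.inducedLift hT η hη x' ((E.induced F θ).map f z) =
      T.map f (ProjRep.inducedLift hT η hη x z) := by
  have h : ProjRep.inducedLift hT η hη x' ∘ₗ (E.induced F θ).map f =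
      T.map f ∘ₗ ProjRep.inducedLift hT η hη x := ProjRep.induced_hom_ext fun y s v => by
    rw [LinearMap.comp_apply, LinearMap.comp_apply, ProjRep.induced_map_mk, map_smul,
      ProjRep.inducedLift_mk, ProjRep.inducedLift_mk, hT.map_map_apply]
  exact LinearMap.congr_fun h z

/-- A family of maps `ι y : E y → T (a y)` and isomorphisms `R y : F y ⟶ a y` induce maps
`E y → T (F y)`. The scalar makes them the composites of `ι y` with the inverse of `T (R y)`, which
is `T ((R y)⁻¹)` only up to a value of `θ`. -/
noncomputable def ProjRep.pullAlong (θ : Twisting k C) {a : D → C}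
    (R : ∀ y, F.obj y ⟶ a y) [∀ y, IsIso (R y)] (ι : ∀ y, E.obj y →ₗ[k] T.obj (a y)) (y : D) :
    E.obj y →ₗ[k] T.obj (F.obj y) :=
  (((θ.val (inv (R y)) (R y))⁻¹ : kˣ) : k) • T.map (inv (R y)) ∘ₗ ι y

theorem ProjRep.IsTwisted.map_pullAlong (hT : T.IsTwisted θ) {a : D → C}
    (R : ∀ y, F.obj y ⟶ a y) [∀ y, IsIso (R y)] (ι : ∀ y, E.obj y →ₗ[k] T.obj (a y)) (y : D)
    (v : E.obj y) : T.map (R y) (ProjRep.pullAlong θ R ι y v) = ι y v :=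
  hT.map_map_inv (R y) (ι y v)

/-- The maps `pullAlong` commute with the morphisms of the source category if the maps `ι` do, up
to the scalars that compare the two ways around a square. -/
theorem ProjRep.IsTwisted.pullAlong_map (hT : T.IsTwisted θ) {a : D → C}
    (R : ∀ y, F.obj y ⟶ a y) [∀ y, IsIso (R y)] (ι : ∀ y, E.obj y →ₗ[k] T.obj (a y))
    {y y' : D} (t : y ⟶ y') (g : a y ⟶ a y') (hg : R y ≫ g = F.map t ≫ R y') (v : E.obj y)
    (hι : T.map g (ι y v) = (θ.val (R y) g / θ.val (F.map t) (R y') : kˣ) • ι y' (E.map t v)) :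
    ProjRep.pullAlong θ R ι y' (E.map t v) =
      T.map (F.map t) (ProjRep.pullAlong θ R ι y v) := by
  refine hT.map_injective (R y') ?_
  rw [hT.map_pullAlong, hT.map_map_apply, ← hg, hT.map_comp_apply, hT.map_pullAlong, hι,
    ← Units.smul_def, ← Units.smul_def, smul_smul, smul_smul]
  rw [← div_eq_mul_inv, div_mul_div_cancel, div_self', one_smul]

end Induced

/-! ### Rows of the trace of an induced 2-representation -/

section Rows

variable {k : Type uk} [Field k] {G : Type uG} [Group G] {H : Subgroup G} (r : G ⧸ H → G)
  (hr : ∀ q, (QuotientGroup.mk (r q) : G ⧸ H) = q)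
variable {V : Type u} [Category.{v} V] [Preadditive V] [Linear k V]
variable (ρ : TwoRep k H V) (α : G → G → G → kˣ)

theorem mul_rep_of_fixed {g : G} {q : G ⧸ H} (hq : q = g⁻¹ • q) :
    g * r q = r q * cosetPart r hr g q := by
  have h : g * r (g⁻¹ • q) = r q * cosetPart r hr g q := by simp [cosetPart, mul_assoc]
  rwa [← hq] at h

variable {r hr ρ α} in
/-- The component at the row `j` of an element of the trace of `g` on the induced
2-representation, as a morphism of `V`. -/
def trRow {g : G} (φ : (ρ.ind r hr α).Tr g) (x : G ⧸ H → V) (j : G ⧸ H) :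
    x j ⟶ (ρ.F (cosetPart r hr g j)).obj (x (g⁻¹ • j)) :=
  φ.app x j

variable {r hr ρ α} in
theorem trRow_naturality {g : G} (φ : (ρ.ind r hr α).Tr g) {x y : G ⧸ H → V}
    (f : ∀ j, x j ⟶ y j) (j : G ⧸ H) :
    f j ≫ trRow φ y j = trRow φ x j ≫ (ρ.F (cosetPart r hr g j)).map (f (g⁻¹ • j)) :=
  congrFun (φ.naturality (X := x) (Y := y) f) j

variable {r hr ρ α} in
/-- The trace of `g` is concentrated in the rows fixed by `g`. -/
theorem trRow_of_ne {g : G} (φ : (ρ.ind r hr α).Tr g) (x : G ⧸ H → V) {j : G ⧸ H}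
    (hj : j ≠ g⁻¹ • j) : trRow φ x j = 0 := by
  classical
  -- Naturality with respect to the endomorphism that is `𝟙` at `j` and zero elsewhere.
  have h := trRow_naturality φ (x := x) (y := x) (fun i => if i = j then 𝟙 _ else 0) j
  simpa [hj.symm] using h

variable {r hr ρ α} in
/-- The component at a fixed row is determined by its values at constant families. -/
theorem trRow_eq {g : G} (φ : (ρ.ind r hr α).Tr g) (x : G ⧸ H → V) {q : G ⧸ H}
    (hq : q = g⁻¹ • q) :
    trRow φ x q = trRow φ (fun _ => x q) q ≫
      (ρ.F (cosetPart r hr g q)).map (idxIso x hq).hom := by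
  classical
  -- Naturality with respect to the morphism to the constant family that is `𝟙` at `q` and zero
  -- elsewhere.
  have h := trRow_naturality φ (x := x) (y := fun _ => x q)
    (fun i => if h : i = q then (idxIso x h).hom else 0) q
  simp only [dif_pos, dif_pos hq.symm] at h
  have h₁ : (idxIso x (rfl : q = q)).hom = 𝟙 _ := rfl
  have h₂ : (idxIso x hq.symm).hom ≫ (idxIso x hq).hom = 𝟙 _ := by simp [idxIso]
  rw [h₁, Category.id_comp] at h
  rw [h, Category.assoc, ← Functor.map_comp]
  erw [h₂]
  rw [CategoryTheory.Functor.map_id, Category.comp_id]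

/-- The row `q` of an element of the trace of `g` on the induced 2-representation. -/
def TwoRep.indRow (g : G) (q : G ⧸ H) :
    (ρ.ind r hr α).Tr g →ₗ[k] ρ.Tr (cosetPart r hr g q) where
  toFun φ :=
    { app := fun x => trRow φ (fun _ => x) q
      naturality := fun _ _ f => trRow_naturality φ (fun _ => f) q }
  map_add' _ _ := rfl
  map_smul' _ _ := rfl

/-- The element of the trace of `g` on the induced 2-representation with given fixed rows. -/
noncomputable def TwoRep.ofRows [Fintype (G ⧸ H)] (g : G) :
    (∀ q : {q : G ⧸ H // q = g⁻¹ • q}, ρ.Tr (cosetPart r hr g q)) →ₗ[k]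
      (ρ.ind r hr α).Tr g :=
  open Classical in
  ∑ q : {q : G ⧸ H // q = g⁻¹ • q},
    ρ.indIncl r hr α (mul_rep_of_fixed r hr q.2) ∘ₗ LinearMap.proj q

theorem TwoRep.ofRows_apply [Fintype (G ⧸ H)] (g : G)
    (φ : ∀ q : {q : G ⧸ H // q = g⁻¹ • q}, ρ.Tr (cosetPart r hr g q)) :
    ρ.ofRows r hr α g φ = open Classical in ∑ q : {q : G ⧸ H // q = g⁻¹ • q},
      ρ.indIncl r hr α (mul_rep_of_fixed r hr q.2) (φ q) := by
  simp only [TwoRep.ofRows, LinearMap.sum_apply, LinearMap.comp_apply, LinearMap.proj_apply]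

theorem TwoRep.indRow_indIncl {g : G} {q : G ⧸ H} (hq : q = g⁻¹ • q)
    (φ : ρ.Tr (cosetPart r hr g q)) :
    ρ.indRow r hr α g q (ρ.indIncl r hr α (mul_rep_of_fixed r hr hq) φ) = φ := by
  ext x
  refine (indInclApp_self r hr ρ (mul_rep_of_fixed r hr hq) hq φ fun _ => x).trans ?_
  refine (congrArg (φ.app x ≫ ·) ?_).trans (Category.comp_id _)
  exact (ρ.F (cosetPart r hr g q)).map_id x

theorem TwoRep.indRow_indIncl_of_ne {g : G} {q q' : G ⧸ H} {h : H} (hg : g * r q = r q * h)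
    (hq : q' ≠ q) (φ : ρ.Tr h) :
    ρ.indRow r hr α g q' (ρ.indIncl r hr α hg φ) = 0 := by
  ext x
  exact indInclApp_of_ne r hr ρ hg φ (fun _ => x) hq

theorem TwoRep.indRow_ofRows [Fintype (G ⧸ H)] (g : G)
    (φ : ∀ q : {q : G ⧸ H // q = g⁻¹ • q}, ρ.Tr (cosetPart r hr g q))
    (q : {q : G ⧸ H // q = g⁻¹ • q}) :
    ρ.indRow r hr α g q (ρ.ofRows r hr α g φ) = φ q := by
  classical
  rw [ρ.ofRows_apply, map_sum]
  exact (Finset.sum_eq_single q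
    (fun q' _ hq => ρ.indRow_indIncl_of_ne r hr α _ (fun h => hq (Subtype.ext h.symm)) _)
    fun h => absurd (Finset.mem_univ q) h).trans (ρ.indRow_indIncl r hr α q.2 _)

/-- An element of the trace of `g` is determined by its rows at the cosets fixed by `g`. -/
theorem TwoRep.tr_ind_ext {g : G} {φ φ' : (ρ.ind r hr α).Tr g}
    (h : ∀ q, q = g⁻¹ • q → ρ.indRow r hr α g q φ = ρ.indRow r hr α g q φ') : φ = φ' := by
  refine NatTrans.ext (funext fun x => funext fun j => ?_)
  change trRow φ x j = trRow φ' x j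
  by_cases hj : j = g⁻¹ • j
  · rw [trRow_eq φ x hj, trRow_eq φ' x hj]
    exact congrArg (fun f => f ≫ _) (congrArg (fun t => t.app (x j)) (h j hj))
  · rw [trRow_of_ne φ x hj, trRow_of_ne φ' x hj]

theorem TwoRep.ofRows_indRow [Fintype (G ⧸ H)] (g : G) (φ : (ρ.ind r hr α).Tr g) :
    ρ.ofRows r hr α g (fun q => ρ.indRow r hr α g q φ) = φ :=
  ρ.tr_ind_ext r hr α fun q hq => ρ.indRow_ofRows r hr α g _ ⟨q, hq⟩

end Rows

/-! ### The two factors of the trace of a hyperbolic induction -/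

section HIndTrace

variable {k : Type uk} [Field k] {Γ : Type uG} [Group Γ] {π : Γ →* ℤˣ}
variable {V : Type u} [Category.{v} V] [Preadditive V] [Linear k V]
variable (σ : TwoRep k π.ker V) (α : Γ → Γ → Γ → kˣ) (ς : OddElt π)

variable {σ α ς} in
/-- The component of an element of the trace in the first factor of `V × Vᵒᵖ`. -/
def trFst {g : π.ker} (t : (σ.hind α ς).toTwoRep.Tr g) (p : V × Vᵒᵖ) :
    p.1 ⟶ (σ.F g).obj p.1 :=
  (t.app p).1

variable {σ α ς} in
/-- The component of an element of the trace in the second factor of `V × Vᵒᵖ`. -/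
def trSnd {g : π.ker} (t : (σ.hind α ς).toTwoRep.Tr g) (p : V × Vᵒᵖ) :
    p.2 ⟶ op ((σ.F (ς.conjKer g)).obj p.2.unop) :=
  (t.app p).2

variable {σ α ς} in
theorem trFst_naturality {g : π.ker} (t : (σ.hind α ς).toTwoRep.Tr g) {p q : V × Vᵒᵖ}
    (f : p.1 ⟶ q.1) : f ≫ trFst t q = trFst t p ≫ (σ.F g).map f :=
  congrArg Prod.fst (t.naturality (X := p) (Y := q) (Prod.mkHom f 0))

/-- The first component of an element of the trace. -/
def TwoRep.hindFst (g : π.ker) : (σ.hind α ς).toTwoRep.Tr g →ₗ[k] σ.Tr g where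
  toFun t :=
    { app := fun x => trFst t (x, op x)
      naturality := fun x y f => trFst_naturality t (p := (x, op x)) (q := (y, op y)) f }
  map_add' _ _ := rfl
  map_smul' _ _ := rfl

variable {σ α ς} in
/-- The elements of the trace that vanish in the second factor. -/
def VanishesInSnd {g : π.ker} (t : (σ.hind α ς).toTwoRep.Tr g) : Prop := ∀ p, trSnd t p = 0

variable {σ α ς} in
/-- The elements of the trace that vanish in the first factor. -/
def VanishesInFst {g : π.ker} (t : (σ.hind α ς).toTwoRep.Tr g) : Prop := ∀ p, trFst t p = 0

theorem TwoRep.vanishesInSnd_hindIncl (g : π.ker) (φ : σ.Tr g) :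
    VanishesInSnd (σ.hindIncl α ς g φ) :=
  fun _ => rfl

variable {σ α ς} in
theorem trFst_eq {g : π.ker} (t : (σ.hind α ς).toTwoRep.Tr g) (p : V × Vᵒᵖ) :
    trFst t p = (σ.hindFst α ς g t).app p.1 := by
  -- Naturality with respect to `(𝟙, 0)`: the first component does not depend on the second object.
  have h := trFst_naturality t (p := p) (q := (p.1, op p.1)) (𝟙 p.1)
  rw [CategoryTheory.Functor.map_id, Category.comp_id, Category.id_comp] at h
  exact h.symm

theorem TwoRep.vanishesInFst_sub (g : π.ker) (t : (σ.hind α ς).toTwoRep.Tr g) :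
    VanishesInFst (t - σ.hindIncl α ς g (σ.hindFst α ς g t)) := fun p =>
  (sub_eq_zero (G := p.1 ⟶ (σ.F g).obj p.1)).2 (trFst_eq t p)

variable {σ α ς} in
theorem VanishesInFst.hindFst_eq {g : π.ker} {t : (σ.hind α ς).toTwoRep.Tr g}
    (ht : VanishesInFst t) :
    σ.hindFst α ς g t = 0 :=
  NatTrans.ext (funext fun x => ht (x, op x))

variable {σ α ς} in
theorem VanishesInSnd.hindIncl_eq {g : π.ker} {t : (σ.hind α ς).toTwoRep.Tr g}
    (ht : VanishesInSnd t) :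
    σ.hindIncl α ς g (σ.hindFst α ς g t) = t :=
  NatTrans.ext (funext fun p => Prod.ext (trFst_eq t p).symm (ht p).symm)

theorem comp_comp_zero_comp {C : Type u} [Category.{v} C] [Limits.HasZeroMorphisms C]
    {a b c d e : C} (f : a ⟶ b) (f' : b ⟶ c) {m : c ⟶ d} (hm : m = 0) (n : d ⟶ e) :
    f ≫ f' ≫ m ≫ n = 0 := by
  simp [hm]

theorem TwoRep.hind_conj_hindIncl {g g' s : π.ker} (h : s * g = g' * s) (φ : σ.Tr g) :
    (σ.hind α ς).conj s h (σ.hindIncl α ς g φ) = σ.hindIncl α ς g' (σ.conj s h φ) := by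
  refine NatTrans.ext (funext fun p => Prod.ext ?_ ?_)
  · change (σ.ψe rfl).inv.app p.1 ≫ (psiIso σ _ 1 p.1).inv ≫
      (σ.F s).map (φ.app ((σ.F s⁻¹).obj p.1)) ≫ (psiIso σ h 1 ((σ.F s⁻¹).obj p.1)).hom ≫
      (psiIso σ rfl 1 ((σ.F s⁻¹).obj p.1)).inv ≫
      (σ.F g').map ((psiIso σ _ 1 p.1).hom ≫ (σ.ψe rfl).hom.app p.1) = _
    simp [psiIso, TwoRep.conj, TwoRep.hindIncl]
  · exact comp_comp_zero_comp _ _ (congrArg Quiver.Hom.op ((σ.F (ς.conjKer s)).map_zero _ _)) _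

variable {σ α ς} in
theorem VanishesInSnd.contract_snd {g : π.ker} {t : (σ.hind α ς).toTwoRep.Tr g}
    (ht : VanishesInSnd t) (p : V × Vᵒᵖ) : ((σ.hind α ς).contract g t p).2.unop = 0 := by
  have h : (t.app p).2.unop = 0 := congrArg Quiver.Hom.unop (ht p)
  exact (congrArg (_ ≫ ·) ((congrArg (σ.F (ς.conjKer g⁻¹)).map h).trans
    ((σ.F (ς.conjKer g⁻¹)).map_zero _ _))).trans Limits.comp_zero

variable {σ α ς} in
theorem VanishesInFst.contract_fst {g : π.ker} {t : (σ.hind α ς).toTwoRep.Tr g}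
    (ht : VanishesInFst t) (p : V × Vᵒᵖ) : ((σ.hind α ς).contract g t p).1 = 0 := by
  have h : (t.app p).1 = 0 := ht p
  exact (congrArg (· ≫ _) ((congrArg (σ.F g⁻¹).map h).trans
    ((σ.F g⁻¹).map_zero _ _))).trans Limits.zero_comp

/-- Conjugation by an element of degree `-1` exchanges the two factors. -/
theorem TwoRep.vanishesInFst_conjOdd {g g' : π.ker} (ω : OddElt π)
    (h : (ω : Γ) * (g : Γ)⁻¹ = g' * ω) {t : (σ.hind α ς).toTwoRep.Tr g} (ht : VanishesInSnd t) :
    VanishesInFst ((σ.hind α ς).conjOdd ω h t) := fun _ =>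
  comp_comp_zero_comp _ _
    ((congrArg (σ.F (ω.mulOdd ς)).map (ht.contract_snd _)).trans
      ((σ.F (ω.mulOdd ς)).map_zero _ _)) _

theorem TwoRep.vanishesInSnd_conjOdd {g g' : π.ker} (ω : OddElt π)
    (h : (ω : Γ) * (g : Γ)⁻¹ = g' * ω) {t : (σ.hind α ς).toTwoRep.Tr g} (ht : VanishesInFst t) :
    VanishesInSnd ((σ.hind α ς).conjOdd ω h t) := fun _ =>
  comp_comp_zero_comp _ _ (congrArg Quiver.Hom.op
    ((congrArg (σ.F (ς.inv.mulOdd ω)).map (ht.contract_fst _)).trans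
      ((σ.F (ς.inv.mulOdd ω)).map_zero _ _))) _

end HIndTrace

/-! ### The unoriented loop groupoid and the transgressed cocycle -/

section LoopGroupoid

variable {k : Type uk} [Field k] {Γ : Type uG} [Group Γ] {π : Γ →* ℤˣ}
variable {α : Γ → Γ → Γ → kˣ} {x y z : UnorientedLoop π}

instance UnorientedLoop.isIso (f : x ⟶ y) : IsIso f := by
  obtain ⟨ω, hω⟩ := f
  have h : ω⁻¹ * (y.elt : Γ) ^ ((π ω⁻¹ : ℤˣ) : ℤ) = x.elt * ω⁻¹ := by
    rw [show (y.elt : Γ) = ω * (x.elt : Γ) ^ ((π ω : ℤˣ) : ℤ) * ω⁻¹ by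
      rw [hω, mul_inv_cancel_right]]
    rcases Int.units_eq_one_or (π ω) with h | h <;> simp [h, mul_assoc]
  exact ⟨⟨ω⁻¹, h⟩, Subtype.ext (inv_mul_cancel ω), Subtype.ext (mul_inv_cancel ω)⟩

theorem UnorientedLoop.inv_val (f : x ⟶ y) : (inv f).1 = f.1⁻¹ :=
  eq_inv_of_mul_eq_one_right (congrArg Subtype.val (IsIso.inv_hom_id f))

theorem tauTwisting_val_of_even (hα : IsTwistedCocycle π α) (f : x ⟶ y) (g : y ⟶ z)
    (hf : π f.1 = 1) (hg : π g.1 = 1) :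
    (tauTwisting hα).val f g = α g.1 f.1 x.elt * α z.elt g.1 f.1 / α g.1 y.elt f.1 := by
  have ex : (y.elt : Γ) = f.1 * (x.elt : Γ) ^ ((π f.1 : ℤˣ) : ℤ) * f.1⁻¹ := by
    rw [f.2, mul_inv_cancel_right]
  have ez : (z.elt : Γ) = g.1 * (y.elt : Γ) ^ ((π g.1 : ℤˣ) : ℤ) * g.1⁻¹ := by
    rw [g.2, mul_inv_cancel_right]
  simp [tauTwisting, tauRef, hf, hg] at ex ez ⊢
  simp only [ex, ez, mul_assoc]

theorem tauTwisting_val_id_right (hα : IsTwistedCocycle π α) (f : x ⟶ y) :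
    (tauTwisting hα).val f (𝟙 y) = 1 := by
  have h : (𝟙 y : y ⟶ y).1 = 1 := rfl
  simp [tauTwisting, tauRef, h, hα.one_left, hα.one_mid]

theorem tauTwisting_val_id_left (hα : IsTwistedCocycle π α) (f : x ⟶ y) (hf : π f.1 = 1) :
    (tauTwisting hα).val (𝟙 x) f = 1 := by
  have h : (𝟙 x : x ⟶ x).1 = 1 := rfl
  simp [tauTwisting, tauRef, h, hf, hα.one_right, hα.one_mid]

end LoopGroupoid

/-! ### Rows of the character of the hyperbolic induction -/

section Characters

variable {k : Type uk} [Field k] {Γ : Type uG} [Group Γ] {π : Γ →* ℤˣ}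
variable {α : Γ → Γ → Γ → kˣ} {H : Subgroup π.ker}
variable {V : Type u} [Category.{v} V] [Preadditive V] [Linear k V] {ρ : TwoRep k H V}

theorem TwoRep.IsTwisted.character_isTwisted_pullback
    (hρ : ρ.IsTwisted fun c b a => α (c : π.ker) (b : π.ker) (a : π.ker))
    (hα : IsTwistedCocycle π α) :
    ρ.character.IsTwisted ((tauTwisting hα).pullback (loopInclusion π H)) :=
  hρ.character_isTwisted _ fun f g =>
    tauTwisting_val_of_even hα _ _ (f.1 : π.ker).2 (g.1 : π.ker).2

theorem TwoRep.IsTwisted.hindFrom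
    (hρ : ρ.IsTwisted fun c b a => α (c : π.ker) (b : π.ker) (a : π.ker))
    (hα : IsTwistedCocycle π α) (r : π.ker ⧸ H → π.ker)
    (hr : ∀ q, (QuotientGroup.mk (r q) : π.ker ⧸ H) = q) (ς : OddElt π) :
    (ρ.hindFrom α r hr ς).IsTwisted α :=
  (hρ.ind r hr hα.restrict_ker).hind hα ς

variable (ρ α) in
/-- The inclusion of the trace of `h` on `ρ` into the trace of `g = r_q h r_q⁻¹` on the hyperbolic
induction: `φ` at the row `q` of the first factor and zero at all other rows. -/
noncomputable def TwoRep.hindFromIncl (r : π.ker ⧸ H → π.ker)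
    (hr : ∀ q, (QuotientGroup.mk (r q) : π.ker ⧸ H) = q) (ς : OddElt π) {g : π.ker}
    {q : π.ker ⧸ H} {h : H} (hg : g * r q = r q * h) :
    ρ.character.obj ⟨h⟩ →ₗ[k] (ρ.hindFrom α r hr ς).character.obj ⟨g⟩ :=
  (ρ.ind r hr fun c b a => α c b a).hindIncl α ς g ∘ₗ
    ρ.indIncl r hr (fun c b a => α c b a) hg

variable (r : π.ker ⧸ H → π.ker) (hr : ∀ q, (QuotientGroup.mk (r q) : π.ker ⧸ H) = q)
  (ς : OddElt π)

/-- A morphism `g` of degree `1` maps the row `i` to the row `j = g i`. The scalar that appears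
compares the two ways around the square formed by `r_i`, `g`, `r_j` and `h₁`, where
`g r_i = r_j h₁`. -/
theorem TwoRep.IsTwisted.map_hindFromIncl
    (hρ : ρ.IsTwisted fun c b a => α (c : π.ker) (b : π.ker) (a : π.ker))
    (hα : IsTwistedCocycle π α) {γ γ' g : π.ker} {i j : π.ker ⧸ H} {y y' : Loop H}
    (hγ : γ * r i = r i * y.elt) (hγ' : γ' * r j = r j * y'.elt) (t : y ⟶ y')
    (hg : g * r i = r j * t.1) (f : (⟨γ⟩ : UnorientedLoop π) ⟶ ⟨γ'⟩) (hf : (g : Γ) = f.1)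
    (φ : ρ.character.obj y) :
    (ρ.hindFrom α r hr ς).character.map f (ρ.hindFromIncl α r hr ς hγ φ) =
      ((tauTwisting hα).val (cosetHom hγ) f /
        (tauTwisting hα).val ((loopInclusion π H).map t) (cosetHom hγ') : kˣ) •
        ρ.hindFromIncl α r hr ς hγ' (ρ.character.map t φ) := by
  have hc : g * γ = γ' * g := by
    have h := f.2
    rw [← hf, show π (g : Γ) = 1 from g.2] at h
    exact Subtype.ext (by simpa using h)
  rw [RealTwoRep.character_map_of_even _ f hf hc]
  refine (TwoRep.hind_conj_hindIncl _ α ς hc _).trans ?_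
  refine (congrArg (TwoRep.hindIncl _ α ς γ')
    (hρ.conj_indIncl r hr hα.restrict_ker hγ hg hγ' hc t.2 φ)).trans ?_
  rw [map_smul, Units.smul_def,
    tauTwisting_val_of_even hα (cosetHom hγ) f (r i).2 (by rw [← hf]; exact g.2),
    tauTwisting_val_of_even hα ((loopInclusion π H).map t) (cosetHom hγ') (t.1 : π.ker).2
      (r j).2, ← hf]
  rfl

end Characters

/-! ### The comparison of the two characters -/

section Comparison

variable {k : Type uk} [Field k] {Γ : Type uG} [Group Γ] {π : Γ →* ℤˣ}
variable {α : Γ → Γ → Γ → kˣ} {H : Subgroup π.ker}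
variable {V : Type u} [Category.{v} V] [Preadditive V] [Linear k V] {ρ : TwoRep k H V}
variable (r : π.ker ⧸ H → π.ker) (hr : ∀ q, (QuotientGroup.mk (r q) : π.ker ⧸ H) = q)
  (ς : OddElt π)

theorem conj_rep_mul (q : π.ker ⧸ H) (h : H) : r q * h * (r q)⁻¹ * r q = r q * h :=
  inv_mul_cancel_right _ _

/-- The morphism `h ⟶ r_q h r_q⁻¹` given by the representative `r_q` of the trivial coset. -/
def baseHom (y : Loop H) : (loopInclusion π H).obj y ⟶
    (⟨r (1 : π.ker) * y.elt * (r (1 : π.ker))⁻¹⟩ : UnorientedLoop π) :=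
  cosetHom (conj_rep_mul r (1 : π.ker) y.elt)

variable (ρ) in
/-- The morphism from the character of `ρ` to the restriction of the character of the hyperbolic
induction. The inclusion at the row of the trivial coset has values in the trace of
`r_q h r_q⁻¹`; it is transported back to the trace of `h`. -/
noncomputable def restrictedIncl (hα : IsTwistedCocycle π α) (y : Loop H) :
    ρ.character.obj y →ₗ[k]
      (ρ.hindFrom α r hr ς).character.obj ((loopInclusion π H).obj y) :=
  ProjRep.pullAlong (E := ρ.character) (T := (ρ.hindFrom α r hr ς).character)
    (tauTwisting hα) (baseHom r)
    (fun y => ρ.hindFromIncl α r hr ς (conj_rep_mul r (1 : π.ker) y.elt)) y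

theorem restrictedIncl_map (hρ : ρ.IsTwisted fun c b a => α (c : π.ker) (b : π.ker) (a : π.ker))
    (hα : IsTwistedCocycle π α) {y y' : Loop H} (t : y ⟶ y') (φ : ρ.character.obj y) :
    restrictedIncl ρ r hr ς hα y' (ρ.character.map t φ) =
      (ρ.hindFrom α r hr ς).character.map ((loopInclusion π H).map t)
        (restrictedIncl ρ r hr ς hα y φ) := by
  have hg := conj_rep_mul r (1 : π.ker) t.1
  let g := baseHom r y
  let f := inv (baseHom r y) ≫ (loopInclusion π H).map t ≫ baseHom r y'
  have hf : ((r (1 : π.ker) * t.1 * (r (1 : π.ker))⁻¹ : π.ker) : Γ) = f.1 := by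
    change _ = r (1 : π.ker) * (t.1 : π.ker) * (inv (baseHom r y)).1
    rw [UnorientedLoop.inv_val]
    rfl
  refine ((hρ.hindFrom hα r hr ς).character_isTwisted hα).pullAlong_map _ _ t f ?_ φ ?_
  · exact IsIso.hom_inv_id_assoc _ _
  · exact hρ.map_hindFromIncl r hr ς hα _ _ t hg f hf φ

/-- The map `s ⊗ φ ↦ T(s)(η φ)` from the induced character to the character `T` of the hyperbolic
induction, where `η` is `restrictedIncl`. -/
noncomputable def comparison
    (hρ : ρ.IsTwisted fun c b a => α (c : π.ker) (b : π.ker) (a : π.ker))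
    (hα : IsTwistedCocycle π α) (x : UnorientedLoop π) :
    (ρ.character.induced (loopInclusion π H) (tauTwisting hα)).obj x →ₗ[k]
      (ρ.hindFrom α r hr ς).character.obj x :=
  ProjRep.inducedLift ((hρ.hindFrom hα r hr ς).character_isTwisted hα)
    (restrictedIncl ρ r hr ς hα) (restrictedIncl_map r hr ς hρ hα) x

variable (hρ : ρ.IsTwisted fun c b a => α (c : π.ker) (b : π.ker) (a : π.ker))
  (hα : IsTwistedCocycle π α)

theorem comparison_map {x y : UnorientedLoop π} (f : x ⟶ y)
    (z : (ρ.character.induced (loopInclusion π H) (tauTwisting hα)).obj x) :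
    comparison r hr ς hρ hα y
        ((ρ.character.induced (loopInclusion π H) (tauTwisting hα)).map f z) =
      (ρ.hindFrom α r hr ς).character.map f (comparison r hr ς hρ hα x z) :=
  ProjRep.inducedLift_map _ _ _ f z

/-- The comparison map sends `r_q ⊗ φ` to `φ` at the row `q`. -/
theorem comparison_cosetHom {g : π.ker} {q : π.ker ⧸ H} {h : H} (hg : g * r q = r q * h)
    (φ : ρ.character.obj ⟨h⟩) :
    comparison r hr ς hρ hα ⟨g⟩ (ρ.character.inducedMk (loopInclusion π H) (tauTwisting hα)
      (cosetHom hg) φ) = ρ.hindFromIncl α r hr ς hg φ := by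
  have hT := (hρ.hindFrom hα r hr ς).character_isTwisted hα
  let f := inv (baseHom r ⟨h⟩) ≫ cosetHom hg
  have hf : ((r q * (r (1 : π.ker))⁻¹ : π.ker) : Γ) = f.1 := by
    change _ = r q * (inv (baseHom r ⟨h⟩)).1
    rw [UnorientedLoop.inv_val]
    rfl
  have hRf : baseHom r ⟨h⟩ ≫ f = cosetHom hg := IsIso.hom_inv_id_assoc _ _
  have hK := hρ.map_hindFromIncl r hr ς hα (conj_rep_mul r (1 : π.ker) h) hg (𝟙 (⟨h⟩ : Loop H))
    (g := r q * (r (1 : π.ker))⁻¹)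
    (by rw [inv_mul_cancel_right]; exact (mul_one _).symm) f hf φ
  have hid : ρ.character.map (𝟙 (⟨h⟩ : Loop H)) φ = φ :=
    (hρ.character_isTwisted_pullback hα).map_id_apply φ
  rw [CategoryTheory.Functor.map_id, tauTwisting_val_id_left hα (cosetHom hg) (r q).2, div_one]
    at hK
  rw [hid] at hK
  have hη : (ρ.hindFrom α r hr ς).character.map (baseHom r ⟨h⟩)
      (restrictedIncl ρ r hr ς hα ⟨h⟩ φ) = ρ.hindFromIncl α r hr ς (conj_rep_mul r _ h) φ :=
    hT.map_pullAlong _ _ _ φ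
  refine (ProjRep.inducedLift_mk _ _ _ _ _).trans ?_
  rw [← hRf, hT.map_comp_apply, hη, hK, ← Units.smul_def]
  exact inv_smul_smul _ _

end Comparison

/-! ### Generators of the induced character -/

section Generators

variable {k : Type uk} [Field k] {Γ : Type uG} [Group Γ] {π : Γ →* ℤˣ}
variable {α : Γ → Γ → Γ → kˣ} {H : Subgroup π.ker} [Fintype (π.ker ⧸ H)]
variable {V : Type u} [Category.{v} V] [Preadditive V] [Linear k V] {ρ : TwoRep k H V}
variable (r : π.ker ⧸ H → π.ker) (hr : ∀ q, (QuotientGroup.mk (r q) : π.ker ⧸ H) = q)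
  (ς : OddElt π) (hα : IsTwistedCocycle π α)

variable (ρ) in
/-- The map `(φ_q) ↦ ∑ r_q ⊗ φ_q` into the induced character at `g`, where `q` runs over the cosets
fixed by `g`. -/
noncomputable def cosetSum (g : π.ker) :
    (∀ q : {q : π.ker ⧸ H // q = g⁻¹ • q}, ρ.character.obj ⟨cosetPart r hr g q⟩) →ₗ[k]
      (ρ.character.induced (loopInclusion π H) (tauTwisting hα)).obj ⟨g⟩ :=
  open Classical in
  ∑ q : {q : π.ker ⧸ H // q = g⁻¹ • q},
    ρ.character.inducedMkₗ (loopInclusion π H) (tauTwisting hα)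
      (cosetHom (mul_rep_of_fixed r hr q.2)) ∘ₗ LinearMap.proj q

theorem cosetSum_apply (g : π.ker)
    (φ : ∀ q : {q : π.ker ⧸ H // q = g⁻¹ • q}, ρ.character.obj ⟨cosetPart r hr g q⟩) :
    cosetSum ρ r hr hα g φ = open Classical in ∑ q : {q : π.ker ⧸ H // q = g⁻¹ • q},
      ρ.character.inducedMk (loopInclusion π H) (tauTwisting hα)
        (cosetHom (mul_rep_of_fixed r hr q.2)) (φ q) := by
  classical
  simp only [cosetSum, LinearMap.sum_apply, LinearMap.comp_apply, LinearMap.proj_apply,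
    ProjRep.inducedMkₗ_apply]

/-- The class of `s ⊗ v` for `s` of degree `1` is of the form `r_q ⊗ φ`. -/
theorem inducedMk_mem_range_of_even {g : π.ker} {y : Loop H}
    (s : (loopInclusion π H).obj y ⟶ (⟨g⟩ : UnorientedLoop π)) (hs : π s.1 = 1)
    (φ : ρ.character.obj y) :
    ρ.character.inducedMk (loopInclusion π H) (tauTwisting hα) s φ ∈
      LinearMap.range (cosetSum ρ r hr hα g) := by
  classical
  -- For the coset `q` of `s`, write `s = r_q u` and move `u` to `φ`.
  let s' : π.ker := ⟨s.1, hs⟩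
  let q : π.ker ⧸ H := s'
  obtain ⟨u, hu⟩ : ∃ u : H, s' = r q * u :=
    ⟨⟨(r q)⁻¹ * s', QuotientGroup.eq.1 (hr q)⟩, (mul_inv_cancel_left _ _).symm⟩
  have hsg : s' * y.elt = g * s' := by
    have h := s.2
    rw [hs, Units.val_one, zpow_one] at h
    exact Subtype.ext h
  have hg : g * r q = r q * (u * y.elt * u⁻¹ : H) := by
    have h : g = s' * y.elt * s'⁻¹ := by rw [hsg, mul_inv_cancel_right]
    rw [h, hu]
    push_cast
    group
  have hq := coset_transport r hr hg
  have hc : u * y.elt * u⁻¹ = cosetPart r hr g q := eq_cosetPart r hr (by rw [← hq]; exact hg)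
  let t : y ⟶ (⟨cosetPart r hr g q⟩ : Loop H) :=
    ⟨u, by rw [← hc, inv_mul_cancel_right]⟩
  have hst : (loopInclusion π H).map t ≫ cosetHom (mul_rep_of_fixed r hr hq) = s :=
    Subtype.ext (congrArg (fun a : π.ker => (a : Γ)) hu.symm)
  have h := ProjRep.inducedMk_map (θ := tauTwisting hα) t
    (cosetHom (mul_rep_of_fixed r hr hq)) φ
  rw [hst] at h
  rw [eq_smul_inv_of_smul_eq h]
  refine Submodule.smul_mem _ _ ⟨Pi.single ⟨q, hq⟩ (ρ.character.map t φ), ?_⟩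
  rw [cosetSum_apply, Finset.sum_eq_single ⟨q, hq⟩, Pi.single_eq_same]
  · intro q' _ hq'
    rw [Pi.single_eq_of_ne hq', ← ProjRep.inducedMkₗ_apply, map_zero]
  · exact fun h => absurd (Finset.mem_univ _) h

/-- The morphism of the unoriented loop groupoid with target `g` given by `ς`. -/
def oddHom (g : π.ker) : (⟨(ς.conjKer g)⁻¹⟩ : UnorientedLoop π) ⟶ ⟨g⟩ :=
  ⟨ς, by simp [ς.2, OddElt.conjKer, OddElt.inv, OddElt.mulOdd]⟩

/-- The induced character at `g` is spanned by the elements `r_q ⊗ φ` and by the images under `ς`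
of such elements. -/
theorem exists_cosetSum_add (g : π.ker)
    (z : (ρ.character.induced (loopInclusion π H) (tauTwisting hα)).obj ⟨g⟩) :
    ∃ φ φ', z = cosetSum ρ r hr hα g φ +
      (ρ.character.induced (loopInclusion π H) (tauTwisting hα)).map (oddHom ς g)
        (cosetSum ρ r hr hα (ς.conjKer g)⁻¹ φ') := by
  have key : LinearMap.range (cosetSum ρ r hr hα g) ⊔
      (LinearMap.range (cosetSum ρ r hr hα (ς.conjKer g)⁻¹)).map
        ((ρ.character.induced (loopInclusion π H) (tauTwisting hα)).map (oddHom ς g)) = ⊤ := by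
    refine ProjRep.induced_eq_top fun y s v => ?_
    rcases Int.units_eq_one_or (π s.1) with hs | hs
    · exact Submodule.mem_sup_left (inducedMk_mem_range_of_even r hr hα s hs v)
    -- If `s` has degree `-1`, then `s = ς (ς⁻¹ s)` and `ς⁻¹ s` has degree `1`.
    · refine Submodule.mem_sup_right ?_
      have h := ProjRep.induced_map_mk (θ := tauTwisting hα) (E := ρ.character) (oddHom ς g)
        (s ≫ inv (oddHom ς g)) v
      rw [Category.assoc, IsIso.inv_hom_id, Category.comp_id] at h
      rw [eq_smul_inv_of_smul_eq h]
      refine Submodule.smul_mem _ _ (Submodule.mem_map_of_mem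
        (inducedMk_mem_range_of_even r hr hα _ ?_ v))
      change π ((inv (oddHom ς g)).1 * s.1) = 1
      rw [UnorientedLoop.inv_val, map_mul, map_inv, hs]
      change (π ς)⁻¹ * _ = _
      rw [ς.2]
      rfl
  obtain ⟨_, ⟨φ, rfl⟩, _, ⟨_, ⟨φ', rfl⟩, rfl⟩, h⟩ :=
    Submodule.mem_sup.1 (key ▸ Submodule.mem_top : z ∈ _)
  exact ⟨φ, φ', h.symm⟩

end Generators

/-! ### The two factors of the character of the hyperbolic induction -/

section Parts

variable {k : Type uk} [Field k] {Γ : Type uG} [Group Γ] {π : Γ →* ℤˣ}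
variable {α : Γ → Γ → Γ → kˣ} {H : Subgroup π.ker}
variable {V : Type u} [Category.{v} V] [Preadditive V] [Linear k V] {ρ : TwoRep k H V}
variable {r : π.ker ⧸ H → π.ker} {hr : ∀ q, (QuotientGroup.mk (r q) : π.ker ⧸ H) = q}
  {ς : OddElt π} {x y : UnorientedLoop π}

/-- The elements of the character of the hyperbolic induction that vanish in the second factor. -/
def InFirst (t : (ρ.hindFrom α r hr ς).character.obj x) : Prop :=
  VanishesInSnd (σ := ρ.ind r hr fun c b a => α c b a) t

/-- The elements of the character of the hyperbolic induction that vanish in the first factor. -/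
def InSecond (t : (ρ.hindFrom α r hr ς).character.obj x) : Prop :=
  VanishesInFst (σ := ρ.ind r hr fun c b a => α c b a) t

/-- Morphisms of degree `-1` exchange the two factors. -/
theorem InFirst.map {t : (ρ.hindFrom α r hr ς).character.obj x} (ht : InFirst t) (f : x ⟶ y)
    (hf : π f.1 = -1) : InSecond ((ρ.hindFrom α r hr ς).character.map f t) := by
  rw [RealTwoRep.character_map_of_odd _ f (s := ⟨f.1, hf⟩) rfl (by simpa [hf] using f.2)]
  exact TwoRep.vanishesInFst_conjOdd _ _ _ _ _ ht

theorem InSecond.map {t : (ρ.hindFrom α r hr ς).character.obj x} (ht : InSecond t) (f : x ⟶ y)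
    (hf : π f.1 = -1) : InFirst ((ρ.hindFrom α r hr ς).character.map f t) := by
  rw [RealTwoRep.character_map_of_odd _ f (s := ⟨f.1, hf⟩) rfl (by simpa [hf] using f.2)]
  exact TwoRep.vanishesInSnd_conjOdd _ _ _ _ _ ht

variable (α ρ r hr ς) in
/-- The rows of the first factor that are fixed by `g`. -/
def firstRows (g : π.ker) : (ρ.hindFrom α r hr ς).character.obj ⟨g⟩ →ₗ[k]
    ∀ q : {q : π.ker ⧸ H // q = g⁻¹ • q}, ρ.character.obj ⟨cosetPart r hr g q⟩ :=
  LinearMap.pi fun q => ρ.indRow r hr _ g q ∘ₗ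
    TwoRep.hindFst (ρ.ind r hr fun c b a => α c b a) α ς g

theorem InSecond.firstRows_eq {g : π.ker} {t : (ρ.hindFrom α r hr ς).character.obj ⟨g⟩}
    (ht : InSecond t) : firstRows α ρ r hr ς g t = 0 :=
  funext fun q => (congrArg (ρ.indRow r hr _ g q) ht.hindFst_eq).trans (map_zero _)

variable [Fintype (π.ker ⧸ H)]

variable (α ρ r hr ς) in
/-- The element of the character at `g` with given rows of the first factor, and zero in the
second factor. -/
noncomputable def ofFirstRows (g : π.ker) :
    (∀ q : {q : π.ker ⧸ H // q = g⁻¹ • q}, ρ.character.obj ⟨cosetPart r hr g q⟩) →ₗ[k]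
      (ρ.hindFrom α r hr ς).character.obj ⟨g⟩ :=
  TwoRep.hindIncl (ρ.ind r hr fun c b a => α c b a) α ς g ∘ₗ ρ.ofRows r hr _ g

theorem inFirst_ofFirstRows (g : π.ker)
    (φ : ∀ q : {q : π.ker ⧸ H // q = g⁻¹ • q}, ρ.character.obj ⟨cosetPart r hr g q⟩) :
    InFirst (ofFirstRows α ρ r hr ς g φ) :=
  TwoRep.vanishesInSnd_hindIncl _ α ς g _

theorem firstRows_ofFirstRows (g : π.ker)
    (φ : ∀ q : {q : π.ker ⧸ H // q = g⁻¹ • q}, ρ.character.obj ⟨cosetPart r hr g q⟩) :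
    firstRows α ρ r hr ς g (ofFirstRows α ρ r hr ς g φ) = φ :=
  funext fun q => ρ.indRow_ofRows r hr _ g φ q

theorem InFirst.ofFirstRows_firstRows {g : π.ker}
    {t : (ρ.hindFrom α r hr ς).character.obj ⟨g⟩} (ht : InFirst t) :
    ofFirstRows α ρ r hr ς g (firstRows α ρ r hr ς g t) = t :=
  (congrArg (TwoRep.hindIncl _ α ς g) (ρ.ofRows_indRow r hr _ g _)).trans ht.hindIncl_eq

theorem inSecond_sub {g : π.ker} (t : (ρ.hindFrom α r hr ς).character.obj ⟨g⟩) :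
    InSecond (t - ofFirstRows α ρ r hr ς g (firstRows α ρ r hr ς g t)) := by
  have h := TwoRep.vanishesInFst_sub (ρ.ind r hr fun c b a => α c b a) α ς g t
  rwa [← ρ.ofRows_indRow r hr _ g (TwoRep.hindFst _ α ς g t)] at h

theorem ofFirstRows_apply (g : π.ker)
    (φ : ∀ q : {q : π.ker ⧸ H // q = g⁻¹ • q}, ρ.character.obj ⟨cosetPart r hr g q⟩) :
    ofFirstRows α ρ r hr ς g φ =
      open Classical in ∑ q : {q : π.ker ⧸ H // q = g⁻¹ • q},
        ρ.hindFromIncl α r hr ς (mul_rep_of_fixed r hr q.2) (φ q) := by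
  exact (congrArg (TwoRep.hindIncl _ α ς g) (ρ.ofRows_apply r hr _ g φ)).trans (map_sum _ _ _)

end Parts

/-! ### The comparison map is the inverse of the unique isomorphism -/

section Bijectivity

variable {k : Type uk} [Field k] {Γ : Type uG} [Group Γ] {π : Γ →* ℤˣ}
variable {α : Γ → Γ → Γ → kˣ} {H : Subgroup π.ker} [Fintype (π.ker ⧸ H)]
variable {V : Type u} [Category.{v} V] [Preadditive V] [Linear k V] {ρ : TwoRep k H V}
variable (r : π.ker ⧸ H → π.ker) (hr : ∀ q, (QuotientGroup.mk (r q) : π.ker ⧸ H) = q)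
  (ς : OddElt π) (hα : IsTwistedCocycle π α)
  (hρ : ρ.IsTwisted fun c b a => α (c : π.ker) (b : π.ker) (a : π.ker))

theorem comparison_cosetSum (g : π.ker)
    (φ : ∀ q : {q : π.ker ⧸ H // q = g⁻¹ • q}, ρ.character.obj ⟨cosetPart r hr g q⟩) :
    comparison r hr ς hρ hα ⟨g⟩ (cosetSum ρ r hr hα g φ) = ofFirstRows α ρ r hr ς g φ := by
  rw [cosetSum_apply, map_sum, ofFirstRows_apply]
  exact Finset.sum_congr rfl fun q _ =>
    comparison_cosetHom r hr ς hρ hα (mul_rep_of_fixed r hr q.2) (φ q)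

theorem comparison_injective (g : π.ker) :
    Function.Injective (comparison r hr ς hρ hα ⟨g⟩) := by
  have hT := (hρ.hindFrom hα r hr ς).character_isTwisted hα
  refine (injective_iff_map_eq_zero _).2 fun z hz => ?_
  obtain ⟨φ, φ', rfl⟩ := exists_cosetSum_add r hr ς hα g z
  rw [map_add, comparison_map, comparison_cosetSum, comparison_cosetSum] at hz
  have hsnd := (inFirst_ofFirstRows (α := α) (ς := ς) _ φ').map (oddHom ς g) ς.2
  -- The two summands of `z` are mapped into different factors, so each image vanishes.
  have h₁ : φ = 0 := by
    have h := congrArg (firstRows α ρ r hr ς g) hz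
    rwa [map_add, firstRows_ofFirstRows, hsnd.firstRows_eq, add_zero, map_zero] at h
  rw [h₁, map_zero, zero_add] at hz
  have h₂ : φ' = 0 := by
    have h := hT.map_injective _ (hz.trans (map_zero _).symm)
    rw [← firstRows_ofFirstRows (α := α) (ς := ς) _ φ', h, map_zero]
  rw [h₁, h₂, map_zero, map_zero, map_zero, add_zero]

theorem InFirst.mem_range_comparison {g : π.ker}
    {t : (ρ.hindFrom α r hr ς).character.obj ⟨g⟩} (ht : InFirst t) :
    t ∈ LinearMap.range (comparison r hr ς hρ hα ⟨g⟩) :=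
  ⟨cosetSum ρ r hr hα g (firstRows α ρ r hr ς g t), by
    rw [comparison_cosetSum, ht.ofFirstRows_firstRows]⟩

theorem comparison_surjective (g : π.ker) :
    Function.Surjective (comparison r hr ς hρ hα ⟨g⟩) := by
  have hT := (hρ.hindFrom hα r hr ς).character_isTwisted hα
  refine LinearMap.range_eq_top.1 (eq_top_iff.2 fun t _ => ?_)
  -- `t` is the sum of an element of the first factor and one of the second, which is the image
  -- under `ς` of an element of the first factor.
  have hinv : π (inv (oddHom ς g)).1 = -1 := by
    rw [UnorientedLoop.inv_val, map_inv]
    exact congrArg (·⁻¹) ς.2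
  obtain ⟨z, hz⟩ := ((inSecond_sub t).map (inv (oddHom ς g)) hinv).mem_range_comparison
    r hr ς hα hρ
  have h₁ := (inFirst_ofFirstRows (α := α) (ς := ς) g
    (firstRows α ρ r hr ς g t)).mem_range_comparison r hr ς hα hρ
  have h₂ : t - ofFirstRows α ρ r hr ς g (firstRows α ρ r hr ς g t) ∈
      LinearMap.range (comparison r hr ς hρ hα ⟨g⟩) := by
    rw [← hT.map_map_inv (oddHom ς g) (t - _), ← hz, Units.smul_def, map_smul, ← comparison_map]
    exact Submodule.smul_mem _ _ ⟨_, rfl⟩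
  exact (sub_add_cancel t _) ▸ Submodule.add_mem _ h₂ h₁

/-- The comparison map as a linear equivalence. -/
noncomputable def comparisonEquiv (x : UnorientedLoop π) :
    (ρ.character.induced (loopInclusion π H) (tauTwisting hα)).obj x ≃ₗ[k]
      (ρ.hindFrom α r hr ς).character.obj x :=
  LinearEquiv.ofBijective (comparison r hr ς hρ hα x)
    ⟨comparison_injective r hr ς hα hρ x.elt, comparison_surjective r hr ς hα hρ x.elt⟩

/-- The isomorphism inverse to the comparison map. -/
noncomputable def characterIso : ProjRep.Iso (ρ.hindFrom α r hr ς).character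
    (ρ.character.induced (loopInclusion π H) (tauTwisting hα)) where
  equiv x := (comparisonEquiv r hr ς hα hρ x).symm
  comm {x y} f v := by
    rw [LinearEquiv.symm_apply_eq]
    refine Eq.trans ?_ (comparison_map r hr ς hρ hα f _).symm
    exact congrArg _ ((comparisonEquiv r hr ς hα hρ x).apply_symm_apply v).symm

theorem characterIso_hindFromIncl {g : π.ker} {q : π.ker ⧸ H} {h : H} (hg : g * r q = r q * h)
    (φ : ρ.character.obj ⟨h⟩) :
    (characterIso r hr ς hα hρ).equiv ⟨g⟩ (ρ.hindFromIncl α r hr ς hg φ) =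
      ρ.character.inducedMk (loopInclusion π H) (tauTwisting hα) (cosetHom hg) φ :=
  (LinearEquiv.symm_apply_eq _).2 (comparison_cosetHom r hr ς hρ hα hg φ).symm

/-- An isomorphism with the prescribed values on the rows of the first factor is inverse to the
comparison map, as these values determine it on the first factor, and its compatibility with `ς`
determines it on the second factor. -/
theorem apply_comparison (Φ : ProjRep.Iso (ρ.hindFrom α r hr ς).character
      (ρ.character.induced (loopInclusion π H) (tauTwisting hα)))
    (hΦ : ∀ (q : π.ker ⧸ H) (h : H) (g : π.ker) (hg : g * r q = r q * h)
      (φ : ρ.character.obj ⟨h⟩), Φ.equiv ⟨g⟩ (ρ.hindFromIncl α r hr ς hg φ) =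
        ρ.character.inducedMk (loopInclusion π H) (tauTwisting hα) (cosetHom hg) φ)
    (g : π.ker) (z : (ρ.character.induced (loopInclusion π H) (tauTwisting hα)).obj ⟨g⟩) :
    Φ.equiv ⟨g⟩ (comparison r hr ς hρ hα ⟨g⟩ z) = z := by
  have key (g : π.ker) (φ) :
      Φ.equiv ⟨g⟩ (ofFirstRows α ρ r hr ς g φ) = cosetSum ρ r hr hα g φ := by
    rw [ofFirstRows_apply, cosetSum_apply, map_sum]
    exact Finset.sum_congr rfl fun q _ => hΦ _ _ _ _ _
  obtain ⟨φ, φ', rfl⟩ := exists_cosetSum_add r hr ς hα g z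
  rw [map_add, comparison_map, comparison_cosetSum, comparison_cosetSum, map_add, Φ.comm, key,
    key]

end Bijectivity

end RealInd

theorem mainTheorem6 {k : Type uk} [Field k] {Γ : Type uG} [Group Γ] [Finite Γ]
    (π : Γ →* ℤˣ) (α : Γ → Γ → Γ → kˣ) (hα : RealInd.IsTwistedCocycle π α)
    (H : Subgroup π.ker) (r : π.ker ⧸ H → π.ker)
    (hr : ∀ q, (QuotientGroup.mk (r q) : π.ker ⧸ H) = q) (ς : RealInd.OddElt π)
    {V : Type u} [Category.{v} V] [Preadditive V] [Linear k V]
    (ρ : RealInd.TwoRep k H V)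
    (hρ : ρ.IsTwisted fun c b a => α (c : π.ker) (b : π.ker) (a : π.ker)) :
    (ρ.hindFrom α r hr ς).IsTwisted α ∧
    ρ.character.IsTwisted
      ((RealInd.tauTwisting hα).pullback (RealInd.loopInclusion π H)) ∧
    (ρ.hindFrom α r hr ς).character.IsTwisted (RealInd.tauTwisting hα) ∧
    (ρ.character.induced (RealInd.loopInclusion π H) (RealInd.tauTwisting hα)).IsTwisted
      (RealInd.tauTwisting hα) ∧
    ∃! Φ : RealInd.ProjRep.Iso (ρ.hindFrom α r hr ς).character
        (ρ.character.induced (RealInd.loopInclusion π H) (RealInd.tauTwisting hα)),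
      ∀ (q : π.ker ⧸ H) (h : H) (g : π.ker) (hg : g * r q = r q * h) (φ : ρ.Tr h),
        Φ.equiv ⟨g⟩ ((ρ.ind r hr fun c b a => α c b a).hindIncl α ς g
            (ρ.indIncl r hr (fun c b a => α c b a) hg φ)) =
          ρ.character.inducedMk (RealInd.loopInclusion π H) (RealInd.tauTwisting hα)
            (RealInd.cosetHom hg) φ := by
  have := Fintype.ofFinite (π.ker ⧸ H)
  refine ⟨hρ.hindFrom hα r hr ς, hρ.character_isTwisted_pullback hα,
    (hρ.hindFrom hα r hr ς).character_isTwisted hα,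
    RealInd.ProjRep.induced_isTwisted (RealInd.tauTwisting_val_id_right hα),
    RealInd.characterIso r hr ς hα hρ,
    fun q h g hg φ => RealInd.characterIso_hindFromIncl r hr ς hα hρ hg φ, fun Φ hΦ => ?_⟩
  refine RealInd.ProjRep.Iso.ext (funext fun x => LinearEquiv.ext fun t => ?_)
  obtain ⟨z, rfl⟩ := (RealInd.comparisonEquiv r hr ς hα hρ x).surjective t
  refine (RealInd.apply_comparison r hr ς hα hρ Φ hΦ x.elt z).trans ?_
  exact ((RealInd.comparisonEquiv r hr ς hα hρ x).symm_apply_apply z).symm
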